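/- Let $\mathbb N=\{0,1,2,\dots\}$. Consider the following three classes of functions $f:\mathbb N\to\mathbb N$. **Tile counting functions $\mathcal F$.** A *tile* is an axis-parallel simply connected closed polygon in $\mathbb R^2$ (the closed region bounded by a simple closed polygonal curve with axis-parallel edges); it is *tall* if it has height $1$. A *tiling* of a region $\Gamma\subset\mathbb R^2$ with a set $T$ of tiles is a collection of translates of tiles in $T$ with pairwise disjoint interiors and with union $\Gamma$. A function $f$ belongs to $\mathcal F$ if there are a finite set $T$ of tall tiles and a real number $\varepsilon\ge 0$ such that, for every $n\in\mathbb N$, $f(n)$ is the number of tilings with $T$ of the rectangle of height $1$ and length $n+\varepsilon$ (the rectangle of length $0$ is regarded as the empty region, with exactly one tiling, the empty one). **Diagonals $\mathcal D$.** For $k\ge 1$ let $\mathcal R_k$ be the smallest class of formal power series in $x_1,\dots,x_k$ such that (1) $0,x_1,\dots,x_k\in\mathcal R_k$; (2) if $F,G\in\mathcal R_k$ then $F+G,\ F\cdot G\in\mathcal R_k$; (3) if $F\in\mathcal R_k$ has zero constant term then $\frac1{1-F}\in\mathcal R_k$. A function $f$ belongs to $\mathcal D$ if there are $k\ge1$ and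 $G\in\mathcal R_k$ such that $f(n)=[x_1^n\cdots x_k^n]\,G$ for all $n\in\mathbb N$. **Binomial multisums $\mathcal B$.** For $a,b\in\mathbb Z$ let $\binom ab=\frac{a!}{b!\,(a-b)!}$ if $0\le b\le a$, let $\binom{-1}{0}=1$, and let $\binom ab=0$ otherwise. A function $f$ belongs to $\mathcal B$ if there are $r,d\in\mathbb N$ and functions $\alpha_i(v,n)=\mathbf a_i\cdot v+a_i'n+a_i''$ and $\beta_i(v,n)=\mathbf b_i\cdot v+b_i'n+b_i''$, $1\le i\le r$, with $\mathbf a_i,\mathbf b_i\in\mathbb Z^d$ and $a_i',a_i'',b_i',b_i''\in\mathbb Z$, such that for all $n\in\mathbb N$ $$f(n)=\sum_{v\in\mathbb Z^d}\ \prod_{i=1}^r\binom{\alpha_i(v,n)}{\beta_i(v,n)},$$ where for every $n$ only finitely many summands are nonzero. Then $\mathcal F=\mathcal D=\mathcal B$, and each of these classes is closed under pointwise addition and pointwise multiplication: if $f$ and $g$ belong to the class, then so do $n\mapsto f(n)+g(n)$ and $n\mapsto f(n)\,g(n)$. -/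

import Mathlib

namespace IrrationalTiling

/-! ### Tile counting functions -/

/-- An axis-parallel closed polygonal region in the plane `ℝ × ℝ`: a finite union of closed
axis-parallel rectangles `[b₁, b₂]` with nonempty interior. -/
def IsAxisParallelRegion (K : Set (ℝ × ℝ)) : Prop :=
  ∃ s : Finset ((ℝ × ℝ) × (ℝ × ℝ)),
    (∀ b ∈ s, b.1.1 < b.2.1 ∧ b.1.2 < b.2.2) ∧ K = ⋃ b ∈ s, Set.Icc b.1 b.2

/-- A tile: an axis-parallel simply connected closed polygon. For a finite union of rectangles,
being simply connected and having connected interior together say that it is a closed topological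
disc, i.e. the closed region bounded by a simple closed axis-parallel polygonal curve (two squares
sharing only a corner are excluded by the second condition). -/
structure IsTile (K : Set (ℝ × ℝ)) : Prop where
  region : IsAxisParallelRegion K
  simplyConnected : IsSimplyConnected K
  interior_connected : IsConnected (interior K)

/-- A tile is tall if its height is exactly `1`. -/
def IsTall (K : Set (ℝ × ℝ)) : Prop :=
  ∃ c : ℝ, Prod.snd '' K = Set.Icc c (c + 1)

/-- The translate of `K` by the vector `v`. -/
def translate (v : ℝ × ℝ) (K : Set (ℝ × ℝ)) : Set (ℝ × ℝ) :=
  (fun p => v + p) '' K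

/-- `P` is a tiling of the region `Γ` with the set of tiles `T`: a collection of translates of
tiles in `T` whose interiors are pairwise disjoint and whose union is `Γ`. -/
structure IsTiling (T : Set (Set (ℝ × ℝ))) (Γ : Set (ℝ × ℝ)) (P : Set (Set (ℝ × ℝ))) : Prop where
  pieces : ∀ K ∈ P, ∃ τ ∈ T, ∃ v : ℝ × ℝ, K = translate v τ
  nonoverlapping : ∀ K ∈ P, ∀ L ∈ P, K ≠ L → Disjoint (interior K) (interior L)
  covers : ⋃₀ P = Γ

/-- The rectangle of height `1` and length `a`. The degenerate rectangle of length `0` is the empty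
region (an empty union of polygons), so that it has exactly one tiling, the empty one. -/
noncomputable def rectangle (a : ℝ) : Set (ℝ × ℝ) :=
  open Classical in if 0 < a then Set.Icc 0 a ×ˢ Set.Icc 0 1 else ∅

/-- The class `F` of tile counting functions: `f n` is the number of tilings of the rectangle of
height `1` and length `n + ε` with a fixed finite set `T` of tall tiles, for a fixed `ε ≥ 0`. -/
def tileCountingFunctions : Set (ℕ → ℕ) :=
  {f | ∃ (T : Set (Set (ℝ × ℝ))) (ε : ℝ),
    T.Finite ∧ (∀ τ ∈ T, IsTile τ ∧ IsTall τ) ∧ 0 ≤ ε ∧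
      ∀ n : ℕ, {P | IsTiling T (rectangle (n + ε)) P}.encard = (f n : ℕ∞)}

/-! ### Diagonals of `ℕ`-rational generating functions -/

/-- The class `R_k` of `ℕ`-rational generating functions in `k` variables: the smallest class of
power series containing `0` and the variables, closed under sums and products, and containing
`G = 1 / (1 - F)` whenever it contains `F` and `F` has zero constant term. -/
inductive IsNRational {k : ℕ} : MvPowerSeries (Fin k) ℤ → Prop
  | zero : IsNRational 0
  | var (i : Fin k) : IsNRational (MvPowerSeries.X i)
  | add {F G : MvPowerSeries (Fin k) ℤ} :
      IsNRational F → IsNRational G → IsNRational (F + G)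
  | mul {F G : MvPowerSeries (Fin k) ℤ} :
      IsNRational F → IsNRational G → IsNRational (F * G)
  | inv_one_sub {F G : MvPowerSeries (Fin k) ℤ} :
      IsNRational F → MvPowerSeries.constantCoeff F = 0 → (1 - F) * G = 1 → IsNRational G

/-- The class `D` of diagonals `f n = [x₁ⁿ ⋯ x_kⁿ] G` of `ℕ`-rational generating functions `G` in
`k ≥ 1` variables. -/
def diagonals : Set (ℕ → ℕ) :=
  {f | ∃ (k : ℕ) (G : MvPowerSeries (Fin k) ℤ), 1 ≤ k ∧ IsNRational G ∧
    ∀ n : ℕ, MvPowerSeries.coeff (Finsupp.equivFunOnFinite.symm fun _ => n) G = (f n : ℤ)}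

/-! ### Binomial multisums -/

/-- Binomial coefficients extended to all integers, with value `1` at `(-1, 0)` and value `0` at all
other pairs that do not satisfy `0 ≤ b ≤ a`. -/
def binom (a b : ℤ) : ℕ :=
  if 0 ≤ b ∧ b ≤ a then a.toNat.choose b.toNat
  else if a = -1 ∧ b = 0 then 1 else 0

/-- An affine function `(v, n) ↦ c · v + c' n + c''` on `ℤ^d × ℕ` with integer coefficients. -/
structure AffineForm (d : ℕ) where
  lin : Fin d → ℤ
  coeffN : ℤ
  const : ℤ

/-- The value of an affine function at `(v, n)`. -/
def AffineForm.eval {d : ℕ} (α : AffineForm d) (v : Fin d → ℤ) (n : ℕ) : ℤ :=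
  (∑ j, α.lin j * v j) + α.coeffN * n + α.const

/-- The class `B` of binomial multisums: functions `f : ℕ → ℕ` such that
`f n = ∑_{v ∈ ℤ^d} ∏_{i < r} binom (α_i (v, n)) (β_i (v, n))`, where for every `n` only finitely
many summands are nonzero. -/
def binomialMultisums : Set (ℕ → ℕ) :=
  {f | ∃ (r d : ℕ) (α β : Fin r → AffineForm d), ∀ n : ℕ,
    (Function.support fun v : Fin d → ℤ =>
      ∏ i, binom ((α i).eval v n) ((β i).eval v n)).Finite ∧
    ∑ᶠ v : Fin d → ℤ, ∏ i, binom ((α i).eval v n) ((β i).eval v n) = f n}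

/-- A class of functions `ℕ → ℕ` is closed under pointwise addition and multiplication. -/
def ClosedUnderAddMul (C : Set (ℕ → ℕ)) : Prop :=
  ∀ f ∈ C, ∀ g ∈ C, (fun n => f n + g n) ∈ C ∧ (fun n => f n * g n) ∈ C

end IrrationalTiling

/-! The three classes are linked by a cycle of inclusions: tilings to diagonals, diagonals to
multisums, multisums to tilings.

Tilings are walks. After closed tiles are replaced by half-open ones, a tiling is an exact partition
(`encard_isTiling_eq_remCount`). The leftmost uncovered bottom point must be the anchor of the next
tile, so a partition is built in a unique order (`remCount_anchored`). Up to translation only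
finitely many remaining regions can still be completed (`finite_liveShapes`), because distances
between anchors and the frontier are sums of finitely many positive lengths. Hence `f n` counts
walks of length `n + ε` in a finite graph with real edge lengths.

Walks are diagonals. Edge lengths are written with nonnegative coordinates, over a common
denominator `M`, in a positive rationally independent family with sum `1` (`exists_positive_basis`).
Independence turns an equation of lengths into equations of coordinates, and the length `n` has all
coordinates `n`. Tracking coordinates modulo `M` in the state gives a linear system whose solution
is `ℕ`-rational (`mem_diagonals_of_isWalkCount`).

Diagonals are multisums. Structural induction works for the coefficients of all powers `G ^ m`,
jointly in `m` and the exponents (`IsNRational.exists_isMultisum`); a sum uses the binomial theorem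
and `1 / (1 - F)` uses the negative binomial series, whose case `m = 0` is the convention at `(-1,
0)`.

Multisums are tilings. A multisum splits into finitely many sums of products of `(x + y).choose x`
over natural solutions of linear systems. Finiteness and Gordan's theorem provide a positive
functional, and a generic perturbation of it merges the system into one equation between real
lengths (`isWalkSequence_systemSum`). The products then count walks through vertices with two loops
each. Two-step tiles realize such a graph, the offset of a side encoding a vertex, and one extra
edge of independent length supplies the flat left side
(`mem_tileCountingFunctions_of_isWalkSequence`).

Closure under sums is seen on walks, closure under products on multisums. -/

namespace IrrationalTiling

/-! ### Positive rational bases of finitely generated subgroups of the reals -/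

/-- `x` is a combination of the numbers `v i` with nonnegative rational coefficients. -/
def InCone {ι : Type} [Fintype ι] (v : ι → ℝ) (x : ℝ) : Prop :=
  ∃ r : ι → ℚ, (∀ i, 0 ≤ r i) ∧ x = ∑ i, (r i : ℝ) * v i

theorem InCone.trans {ι κ : Type} [Fintype ι] [Fintype κ] {v : ι → ℝ} {w : κ → ℝ} {x : ℝ}
    (hx : InCone v x) (hv : ∀ i, InCone w (v i)) : InCone w x := by
  obtain ⟨r, hr, rfl⟩ := hx
  choose s hs hsv using hv
  refine ⟨fun j => ∑ i, r i * s i j,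
    fun j => Finset.sum_nonneg fun i _ => mul_nonneg (hr i) (hs i j), ?_⟩
  push_cast
  simp_rw [Finset.sum_mul]
  rw [Finset.sum_comm]
  refine Finset.sum_congr rfl fun i _ => ?_
  rw [hsv i, Finset.mul_sum]
  exact Finset.sum_congr rfl fun j _ => by ring

theorem inCone_self {ι : Type} [Fintype ι] (v : ι → ℝ) (i : ι) : InCone v (v i) := by
  classical
  refine ⟨Pi.single i 1, fun j => ?_, ?_⟩
  · by_cases h : j = i
    · subst h; simp
    · simp [h]
  · rw [Finset.sum_eq_single i]
    · simp
    · intro j _ hj; simp [hj]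
    · simp

section elementary

variable {ι : Type} [DecidableEq ι]

/-- Subtract `t` times the `i`-th entry from the `j`-th entry. -/
def elementary (v : ι → ℝ) (i j : ι) (t : ℚ) (l : ι) : ℝ := v l - if l = j then t * v i else 0

theorem elementary_pos {v : ι → ℝ} (hv : ∀ l, 0 < v l) {i j : ι} {t : ℚ}
    (h : t * v i < v j) (l : ι) : 0 < elementary v i j t l := by
  unfold elementary
  split_ifs with hl
  · subst hl; linarith
  · simpa using hv l

variable [Fintype ι]

theorem sum_mul_elementary (v : ι → ℝ) (i j : ι) (t : ℚ) (r : ι → ℚ) :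
    ∑ l, (r l : ℝ) * elementary v i j t l = (∑ l, (r l : ℝ) * v l) - r j * (t * v i) := by
  simp [elementary, mul_sub, Finset.sum_sub_distrib]

/-- Since `v j` is the new `j`-th entry plus `t * v i`, the change of family only moves `r j * t`
onto the coefficient at `i`. -/
theorem sum_mul_eq_sum_mul_elementary (v : ι → ℝ) {i j : ι} (hij : i ≠ j) (t : ℚ) (r : ι → ℚ) :
    ∑ l, (r l : ℝ) * v l =
      ∑ l, ((r l + if l = i then r j * t else 0 : ℚ) : ℝ) * elementary v i j t l := by
  rw [sum_mul_elementary]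
  push_cast
  simp only [add_mul, Finset.sum_add_distrib]
  rw [if_neg hij.symm]
  have : ∑ x, ((if x = i then r j * t else 0 : ℚ) : ℝ) * v x = r j * t * v i := by
    rw [Finset.sum_eq_single i]
    · simp
    · intro b _ hb; simp [hb]
    · simp
  rw [this]
  push_cast
  ring

theorem linearIndependent_elementary {v : ι → ℝ} (hv : LinearIndependent ℚ v) {i j : ι}
    (hij : i ≠ j) (t : ℚ) : LinearIndependent ℚ (elementary v i j t) := by
  rw [Fintype.linearIndependent_iff] at hv ⊢
  intro g hg
  have h := hv (fun l => g l - if l = i then g j * t else 0) (by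
    simp only [Rat.smul_def] at hg ⊢
    rw [sum_mul_eq_sum_mul_elementary v hij t]
    rw [← hg]
    refine Finset.sum_congr rfl fun l _ => ?_
    simp [hij.symm])
  have hj : g j = 0 := by simpa [hij.symm] using h j
  intro l
  simpa [hj] using h l

theorem inCone_elementary (v : ι → ℝ) {i j : ι} (hij : i ≠ j) {t : ℚ} (ht : 0 ≤ t) (l : ι) :
    InCone (elementary v i j t) (v l) := by
  obtain ⟨r, hr, h⟩ := inCone_self v l
  refine ⟨_, fun m => ?_, h.trans (sum_mul_eq_sum_mul_elementary v hij t r)⟩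
  have := mul_nonneg (hr j) ht
  have := hr m
  split_ifs <;> linarith

/-- A positive rational combination of positive independent numbers becomes a nonnegative
combination after passing to another positive independent family. -/
theorem exists_inCone_of_pos (n : ℕ) : ∀ (v : ι → ℝ) (r : ι → ℚ),
    (∀ i, 0 < v i) → LinearIndependent ℚ v → 0 < ∑ i, (r i : ℝ) * v i →
    (Finset.univ.filter fun i => r i ≠ 0).card ≤ n →
    ∃ w : ι → ℝ, (∀ i, 0 < w i) ∧ LinearIndependent ℚ w ∧ (∀ i, InCone w (v i)) ∧
      InCone w (∑ i, (r i : ℝ) * v i) := by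
  induction n with
  | zero =>
    intro v r _ _ hx hc
    have : ∀ i, r i = 0 := by simpa [Finset.filter_eq_empty_iff] using hc
    simp [this] at hx
  | succ n ih =>
    intro v r hv hli hx hc
    by_cases hneg : ∀ i, 0 ≤ r i
    · exact ⟨v, hv, hli, inCone_self v, r, hneg, rfl⟩
    push Not at hneg
    obtain ⟨i, hi⟩ := hneg
    obtain ⟨j, hj⟩ : ∃ j, 0 < r j := by
      by_contra! h
      have : ∑ i, (r i : ℝ) * v i ≤ 0 := Finset.sum_nonpos fun l _ =>
        mul_nonpos_of_nonpos_of_nonneg (by exact_mod_cast h l) (hv l).le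
      linarith
    have hij : i ≠ j := by rintro rfl; linarith
    -- a reduction step that cancels the coefficient of the `a`-th entry
    have key : ∀ a b : ι, a ≠ b → r a ≠ 0 → r b ≠ 0 → 0 ≤ -(r a / r b) →
        ((-(r a / r b) : ℚ) : ℝ) * v a < v b →
        ∃ w : ι → ℝ, (∀ i, 0 < w i) ∧ LinearIndependent ℚ w ∧ (∀ i, InCone w (v i)) ∧
          InCone w (∑ i, (r i : ℝ) * v i) := by
      -- The factor `-(r a / r b)` is the one for which the coefficient at `a` becomes `r a + r b *
      -- t = 0`, so the number of nonzero coefficients drops.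
      intro a b hab ha hb ht hlt
      have hsum := sum_mul_eq_sum_mul_elementary v hab (-(r a / r b)) r
      obtain ⟨w, hw, hwl, hwv, hwx⟩ := ih (elementary v a b (-(r a / r b)))
        (fun l => r l + if l = a then r b * (-(r a / r b)) else 0)
        (elementary_pos hv hlt) (linearIndependent_elementary hli hab _)
        (by rw [← hsum]; exact hx) (by
          refine Nat.lt_succ_iff.mp (lt_of_lt_of_le (Finset.card_lt_card ?_) hc)
          rw [Finset.ssubset_iff_of_subset]
          · refine ⟨a, by simpa using ha, ?_⟩
            have : r a + r b * (-(r a / r b)) = 0 := by field_simp; ring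
            simpa using this
          · intro l
            simp only [Finset.mem_filter, Finset.mem_univ, true_and]
            rcases eq_or_ne l a with rfl | hl
            · intro _; exact ha
            · simp [hl])
      refine ⟨w, hw, hwl, fun l => (inCone_elementary v hab ht l).trans hwv, ?_⟩
      rw [hsum]; exact hwx
    -- Independence forbids a tie between the negative and the positive term. The smaller one in
    -- absolute value is cancelled, which is exactly what keeps the modified entry positive.
    have hne : (r i : ℝ) * v i + r j * v j ≠ 0 := by
      intro h0
      have := Fintype.linearIndependent_iff.mp hli
        (fun l => (if l = i then r i else 0) + if l = j then r j else 0)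
        (by simpa [Rat.smul_def, add_mul, Finset.sum_add_distrib,
          apply_ite (Rat.cast : ℚ → ℝ)] using h0) i
      exact hi.ne (by simpa [hij] using this)
    have hiR : (r i : ℝ) < 0 := by exact_mod_cast hi
    have hjR : (0 : ℝ) < r j := by exact_mod_cast hj
    rcases lt_or_gt_of_ne hne with h | h
    · refine key j i hij.symm hj.ne' hi.ne (by
        rw [neg_nonneg]; exact (div_neg_of_pos_of_neg hj hi).le) ?_
      push_cast
      rw [← neg_div_neg_eq, neg_div', neg_neg, div_mul_eq_mul_div,
        div_lt_iff₀ (by linarith)]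
      linarith
    · refine key i j hij hi.ne hj.ne' (by
        rw [neg_nonneg]; exact (div_neg_of_neg_of_pos hi hj).le) ?_
      push_cast
      rw [neg_div', div_mul_eq_mul_div, div_lt_iff₀ hjR]
      linarith

/-- A nonnegative nonzero combination becomes strictly positive in a suitable family. -/
theorem exists_strict_combination (n : ℕ) : ∀ (v : ι → ℝ) (r : ι → ℚ),
    (∀ i, 0 < v i) → LinearIndependent ℚ v → (∀ i, 0 ≤ r i) → (∃ i, 0 < r i) →
    (Finset.univ.filter fun i => r i = 0).card ≤ n →
    ∃ (w : ι → ℝ) (s : ι → ℚ), (∀ i, 0 < w i) ∧ LinearIndependent ℚ w ∧ (∀ i, InCone w (v i)) ∧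
      (∀ i, 0 < s i) ∧ ∑ i, (r i : ℝ) * v i = ∑ i, (s i : ℝ) * w i := by
  induction n with
  | zero =>
    intro v r hv hli hr _ hc
    have h0 : ∀ i, r i ≠ 0 := by simpa [Finset.filter_eq_empty_iff] using hc
    exact ⟨v, r, hv, hli, inCone_self v, fun i => lt_of_le_of_ne (hr i) (h0 i).symm, rfl⟩
  | succ n ih =>
    intro v r hv hli hr hex hc
    by_cases hall : ∀ i, 0 < r i
    · exact ⟨v, r, hv, hli, inCone_self v, hall, rfl⟩
    push Not at hall
    obtain ⟨i, hi⟩ := hall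
    obtain ⟨j, hj⟩ := hex
    have hi0 : r i = 0 := le_antisymm hi (hr i)
    have hij : i ≠ j := by rintro rfl; linarith
    -- Subtracting a small multiple of `v i` from `v j` turns the zero coefficient at `i` into `r j
    -- * t > 0` and changes no other coefficient.
    obtain ⟨t, ht0, ht⟩ := exists_rat_btwn (div_pos (hv j) (hv i))
    have ht0' : 0 < t := by exact_mod_cast ht0
    have hlt : (t : ℝ) * v i < v j := (lt_div_iff₀ (hv i)).mp ht
    have hsum := sum_mul_eq_sum_mul_elementary v hij t r
    have hpos := mul_pos hj ht0'
    have hval : ∀ l, 0 ≤ if l = i then r j * t else 0 := fun l => by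
      split_ifs <;> linarith
    obtain ⟨w, s, hw, hwl, hwv, hs, hsw⟩ := ih (elementary v i j t)
      (fun l => r l + if l = i then r j * t else 0)
      (elementary_pos hv hlt) (linearIndependent_elementary hli hij t)
      (fun l => add_nonneg (hr l) (hval l)) ⟨j, by simpa [hij.symm] using hj⟩ (by
        refine Nat.lt_succ_iff.mp (lt_of_lt_of_le (Finset.card_lt_card ?_) hc)
        rw [Finset.ssubset_iff_of_subset]
        · refine ⟨i, by simpa using hi0, ?_⟩
          simp [hi0, hj.ne', ht0'.ne']
        · intro l
          simp only [Finset.mem_filter, Finset.mem_univ, true_and]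
          intro h
          linarith [hr l, hval l])
    exact ⟨w, s, hw, hwl, fun l => (inCone_elementary v hij ht0'.le l).trans hwv, hs,
      hsum.trans hsw⟩

end elementary

/-- Numbers are added one at a time: one outside the rational span is adjoined to the family, one
inside is handled by `exists_inCone_of_pos`. `InCone.trans` preserves the earlier numbers. -/
theorem exists_independent_inCone (X : Finset ℝ) : (∀ x ∈ X, 0 < x) →
    ∃ (k : ℕ) (v : Fin k → ℝ), (∀ i, 0 < v i) ∧ LinearIndependent ℚ v ∧
      ∀ x ∈ X, InCone v x := by
  induction X using Finset.induction_on with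
  | empty => exact fun _ => ⟨0, Fin.elim0, fun i => i.elim0, linearIndependent_empty_type, by simp⟩
  | insert x X _ ih =>
    intro hX
    obtain ⟨k, v, hv, hli, hvX⟩ := ih fun y hy => hX y (Finset.mem_insert_of_mem hy)
    have hx := hX x (Finset.mem_insert_self x X)
    by_cases hmem : x ∈ Submodule.span ℚ (Set.range v)
    · obtain ⟨r, hr⟩ := (Submodule.mem_span_range_iff_exists_fun ℚ).mp hmem
      simp only [Rat.smul_def] at hr
      subst hr
      obtain ⟨w, hw, hwl, hwv, hwx⟩ := exists_inCone_of_pos _ v r hv hli hx le_rfl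
      refine ⟨k, w, hw, hwl, fun y hy => ?_⟩
      rcases Finset.mem_insert.mp hy with rfl | hy
      · exact hwx
      · exact (hvX y hy).trans hwv
    · refine ⟨k + 1, Fin.cons x v, fun i => ?_, linearIndependent_finCons.mpr ⟨hli, hmem⟩,
        fun y hy => ?_⟩
      · refine Fin.cases ?_ (fun i => ?_) i
        · simpa using hx
        · simpa using hv i
      · rcases Finset.mem_insert.mp hy with rfl | hy
        · exact inCone_self (Fin.cons y v : Fin (k + 1) → ℝ) 0
        · exact (hvX y hy).trans fun i => by
            simpa using inCone_self (Fin.cons x v : Fin (k + 1) → ℝ) i.succ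

/-- Finitely many nonnegative reals have nonnegative coordinates with a common denominator in a
suitable positive rationally independent family with sum `1`. -/
theorem exists_positive_basis (X : Finset ℝ) (hX : ∀ x ∈ X, 0 ≤ x) :
    ∃ (k : ℕ) (v : Fin k → ℝ) (M : ℕ), 0 < M ∧ (∀ i, 0 < v i) ∧ LinearIndependent ℚ v ∧
      ∑ i, v i = 1 ∧ ∀ x ∈ X, ∃ a : Fin k → ℕ, x * M = ∑ i, a i * v i := by
  classical
  -- The number `1` is included so that it can be given strictly positive coordinates `s i`;
  -- rescaling the family by them makes its sum equal to `1`.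
  obtain ⟨k, v, hv, hli, hvX⟩ := exists_independent_inCone (insert 1 (X.filter fun x => 0 < x))
    (by
      intro x hx
      rcases Finset.mem_insert.mp hx with rfl | hx
      · exact one_pos
      · exact (Finset.mem_filter.mp hx).2)
  obtain ⟨r, hr, hr1⟩ := hvX 1 (Finset.mem_insert_self _ _)
  obtain ⟨i0, hi0⟩ : ∃ i, 0 < r i := by
    by_contra! h
    have : ∑ i, (r i : ℝ) * v i = 0 := Finset.sum_eq_zero fun i _ => by
      simp [le_antisymm (h i) (hr i)]
    linarith
  obtain ⟨w, s, hw, hwl, hwv, hs, hsw⟩ :=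
    exists_strict_combination _ v r hv hli hr ⟨i0, hi0⟩ le_rfl
  have hcone : ∀ x ∈ X, InCone w x := by
    intro x hx
    rcases (hX x hx).lt_or_eq with h | h
    · exact (hvX x (Finset.mem_insert_of_mem (Finset.mem_filter.mpr ⟨hx, h⟩))).trans hwv
    · exact ⟨0, by simp, by simp [← h]⟩
  choose! c hc hcx using hcone
  -- coordinates with respect to the rescaled family
  have hc' : ∀ x ∈ X, ∀ i, 0 ≤ c x i / s i := fun x hx i => div_nonneg (hc x hx i) (hs i).le
  set M : ℕ := ∏ x ∈ X, ∏ i, (c x i / s i).den with hM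
  refine ⟨k, fun i => s i * w i, M,
    Finset.prod_pos fun x _ => Finset.prod_pos fun i _ => Rat.den_pos _,
    fun i => mul_pos (by exact_mod_cast hs i) (hw i), ?_, by rw [← hsw, hr1], fun x hx => ?_⟩
  · have := hwl.units_smul fun i => Units.mk0 (s i) (hs i).ne'
    convert this using 1
    ext i
    simp [Units.smul_def, Rat.smul_def]
  · have hdvd : ∀ i, (c x i / s i).den ∣ M := fun i =>
      (Finset.dvd_prod_of_mem (fun i => (c x i / s i).den) (Finset.mem_univ i)).trans
        (Finset.dvd_prod_of_mem (fun x => ∏ i, (c x i / s i).den) hx)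
    choose q hq using hdvd
    refine ⟨fun i => (c x i / s i).num.toNat * q i, ?_⟩
    have hxM : x * M = (∑ i, (c x i : ℝ) * w i) * M := by rw [← hcx x hx]
    rw [hxM, Finset.sum_mul]
    refine Finset.sum_congr rfl fun i _ => ?_
    have hnum : ((c x i / s i).num.toNat : ℚ) = (c x i / s i).num := by
      exact_mod_cast Int.toNat_of_nonneg (Rat.num_nonneg.mpr (hc' x hx i))
    have h1 : (c x i : ℚ) * M = (c x i / s i).num.toNat * q i * s i := by
      rw [hnum, hq i]
      have h2 := Rat.mul_den_eq_num (c x i / s i)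
      have h3 : c x i = c x i / s i * s i := by rw [div_mul_cancel₀ _ (hs i).ne']
      calc c x i * ((((c x i / s i).den * q i : ℕ)) : ℚ)
          = (c x i / s i * s i) * (((c x i / s i).den * q i : ℕ) : ℚ) := by rw [← h3]
        _ = (c x i / s i * (c x i / s i).den) * q i * s i := by push_cast; ring
        _ = _ := by rw [h2]
    have h1' : (c x i : ℝ) * M = ((c x i / s i).num.toNat : ℝ) * q i * s i := by exact_mod_cast h1
    push_cast
    calc (c x i : ℝ) * w i * M = (c x i : ℝ) * M * w i := by ring
      _ = _ := by rw [h1']; ring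

/-! ### `ℕ`-rational series: linear systems -/

section NRational

variable {k : ℕ}

theorem isNRational_one : IsNRational (1 : MvPowerSeries (Fin k) ℤ) :=
  IsNRational.inv_one_sub .zero (by simp) (by simp)

theorem IsNRational.pow {F : MvPowerSeries (Fin k) ℤ} (hF : IsNRational F) (n : ℕ) :
    IsNRational (F ^ n) := by
  induction n with
  | zero => simpa using isNRational_one
  | succ n ih => rw [pow_succ]; exact ih.mul hF

theorem isNRational_sum {ι : Type*} (s : Finset ι) (F : ι → MvPowerSeries (Fin k) ℤ)
    (hF : ∀ i ∈ s, IsNRational (F i)) : IsNRational (∑ i ∈ s, F i) :=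
  Finset.sum_induction F IsNRational (fun _ _ => .add) .zero hF

theorem isNRational_prod {ι : Type*} (s : Finset ι) (F : ι → MvPowerSeries (Fin k) ℤ)
    (hF : ∀ i ∈ s, IsNRational (F i)) : IsNRational (∏ i ∈ s, F i) :=
  Finset.prod_induction F IsNRational (fun _ _ => .mul) isNRational_one hF

theorem isNRational_monomial (c : Fin k →₀ ℕ) :
    IsNRational (MvPowerSeries.monomial c (1 : ℤ)) := by
  have h : MvPowerSeries.monomial c (1 : ℤ) = ∏ i, MvPowerSeries.X i ^ c i := by
    simp_rw [MvPowerSeries.X_pow_eq]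
    rw [MvPowerSeries.prod_monomial]
    simp [Finsupp.univ_sum_single]
  rw [h]
  exact isNRational_prod _ _ fun i _ => (IsNRational.var i).pow _

/-- A solution of a linear system with `ℕ`-rational coefficients is `ℕ`-rational, provided that
the entries with nonzero constant term are strictly increasing for some rank function. -/
theorem isNRational_of_linearSystem {ι : Type*} [DecidableEq ι] (ρ : ι → ℤ) (s : Finset ι) :
    ∀ (M : ι → ι → MvPowerSeries (Fin k) ℤ) (g y : ι → MvPowerSeries (Fin k) ℤ),
      (∀ i ∈ s, ∀ j ∈ s, IsNRational (M i j)) → (∀ i ∈ s, IsNRational (g i)) →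
      (∀ i ∈ s, ∀ j ∈ s, MvPowerSeries.constantCoeff (M i j) ≠ 0 → ρ i < ρ j) →
      (∀ i ∈ s, y i = ∑ j ∈ s, M i j * y j + g i) → ∀ i ∈ s, IsNRational (y i) := by
  induction s using Finset.induction_on with
  | empty => simp
  | insert a s ha ih =>
    intro M g y hM hg hρ hy
    have ma := Finset.mem_insert_self a s
    have ms : ∀ {i}, i ∈ s → i ∈ insert a s := fun h => Finset.mem_insert_of_mem h
    -- The rank cannot increase from `a` to itself, so the geometric series of `M a a` exists and `y
    -- a` can be eliminated.
    have haa : MvPowerSeries.constantCoeff (M a a) = 0 := by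
      by_contra h
      exact lt_irrefl _ (hρ a ma a ma h)
    obtain ⟨S, hS⟩ : ∃ S, (1 - M a a) * S = 1 := by
      have : IsUnit (1 - M a a) := by
        rw [MvPowerSeries.isUnit_iff_constantCoeff]
        simp [haa]
      exact this.exists_right_inv
    have hSr : IsNRational S := .inv_one_sub (hM a ma a ma) haa hS
    have hya : y a = S * (∑ j ∈ s, M a j * y j + g a) := by
      have h1 := hy a ma
      rw [Finset.sum_insert ha] at h1
      have h2 : (1 - M a a) * y a = ∑ j ∈ s, M a j * y j + g a := by linear_combination h1
      rw [← h2]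
      linear_combination (-y a) * hS
    have hs : ∀ i ∈ s, IsNRational (y i) := by
      -- Gaussian elimination without subtraction. A nonzero constant term of the detour through `a`
      -- comes from two rank increases, so the rank condition survives.
      refine ih (fun i j => M i j + M i a * S * M a j) (fun i => g i + M i a * S * g a) y
        ?_ ?_ ?_ ?_
      · exact fun i hi j hj => (hM i (ms hi) j (ms hj)).add
          (((hM i (ms hi) a ma).mul hSr).mul (hM a ma j (ms hj)))
      · exact fun i hi => (hg i (ms hi)).add (((hM i (ms hi) a ma).mul hSr).mul (hg a ma))
      · intro i hi j hj h
        by_cases h1 : MvPowerSeries.constantCoeff (M i j) = 0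
        · rw [map_add, h1, zero_add, map_mul, map_mul] at h
          exact (hρ i (ms hi) a ma (left_ne_zero_of_mul (left_ne_zero_of_mul h))).trans
            (hρ a ma j (ms hj) (right_ne_zero_of_mul h))
        · exact hρ i (ms hi) j (ms hj) h1
      · intro i hi
        have h1 := hy i (ms hi)
        rw [Finset.sum_insert ha, hya] at h1
        rw [h1]
        simp only [add_mul, Finset.sum_add_distrib, mul_add, Finset.mul_sum]
        simp only [mul_assoc]
        ring
    intro i hi
    rcases Finset.mem_insert.mp hi with rfl | hi
    · rw [hya]
      exact hSr.mul ((isNRational_sum _ _ fun j hj => (hM i ma j (ms hj)).mul (hs j hj)).add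
        (hg i ma))
    · exact hs i hi

end NRational

/-! ### Walk counts in finite graphs with real edge lengths -/

/-- Induction along the walks: a statement about pairs of a state and a length holds if it follows
from the statements for the lengths that are shorter by an edge. -/
theorem length_induction {E : Type} [Finite E] (len : E → ℝ) (hlen : ∀ e, 0 < len e)
    {motive : ℝ → Prop} (hneg : ∀ L < 0, motive L)
    (step : ∀ L, 0 ≤ L → (∀ e, motive (L - len e)) → motive L) (L : ℝ) : motive L := by
  -- Each edge shortens the length by at least the minimal length `m`, so ordinary induction on the
  -- number of multiples of `m` suffices.
  obtain ⟨m, hm, hml⟩ : ∃ m : ℝ, 0 < m ∧ ∀ e, m ≤ len e := by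
    rcases isEmpty_or_nonempty E with h | h
    · exact ⟨1, one_pos, fun e => (IsEmpty.false e).elim⟩
    · obtain ⟨e, he⟩ := Finite.exists_min len
      exact ⟨len e, hlen e, he⟩
  have key : ∀ n : ℕ, ∀ L, L < n * m → motive L := by
    intro n
    induction n with
    | zero => exact fun L hL => hneg L (by simpa using hL)
    | succ n ih =>
      intro L hL
      rcases lt_or_ge L 0 with h | h
      · exact hneg L h
      · refine step L h fun e => ih _ ?_
        have := hml e
        push_cast at hL
        linarith
  obtain ⟨n, hn⟩ := exists_nat_gt (L / m)
  exact key n L ((div_lt_iff₀ hm).mp hn)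

open scoped Classical in
/-- `N p L` is the number of walks of length `L` from `p` to `fin` in the finite directed
multigraph with edges `E`, expressed through the recursion on the first edge. -/
structure IsWalkCount {Q E : Type} [Fintype E] (src dst : E → Q) (len : E → ℝ) (fin : Q)
    {A : Type} [AddCommMonoidWithOne A] (N : Q → ℝ → A) : Prop where
  len_pos : ∀ e, 0 < len e
  of_neg : ∀ p, ∀ L < 0, N p L = 0
  first_edge : ∀ p L, 0 ≤ L → N p L = (if p = fin ∧ L = 0 then 1 else 0) +
    ∑ e, if src e = p then N (dst e) (L - len e) else 0

/-- The real number with coordinates `z j / M` in the family `v`. -/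
noncomputable def scaledValue {k : ℕ} (v : Fin k → ℝ) (M : ℕ) (z : Fin k → ℤ) : ℝ :=
  (∑ j, (z j : ℝ) * v j) / M

theorem scaledValue_sub {k : ℕ} (v : Fin k → ℝ) (M : ℕ) (z w : Fin k → ℤ) :
    scaledValue v M (z - w) = scaledValue v M z - scaledValue v M w := by
  simp [scaledValue, sub_mul, Finset.sum_sub_distrib, sub_div]

theorem scaledValue_eq_zero {k : ℕ} {v : Fin k → ℝ} (hv : LinearIndependent ℚ v) {M : ℕ}
    (hM : 0 < M) {z : Fin k → ℤ} (h : scaledValue v M z = 0) : z = 0 := by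
  have h1 : ∑ j, (z j : ℝ) * v j = 0 := by
    rcases div_eq_zero_iff.mp h with h | h
    · exact h
    · exact absurd h (by positivity)
  have h2 := Fintype.linearIndependent_iff.mp hv (fun j => (z j : ℚ)) (by
    simpa [Rat.smul_def] using h1)
  ext j
  exact_mod_cast h2 j

/-- Walk counts along an arithmetic progression of lengths are diagonals. -/
theorem mem_diagonals_of_isWalkCount {Q E : Type} [Finite Q] [Fintype E] {src dst : E → Q}
    {len : E → ℝ} {fin : Q} {N : Q → ℝ → ℕ} (hN : IsWalkCount src dst len fin N) (s : Q) {η : ℝ}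
    (hη : 0 ≤ η) : (fun n : ℕ => N s (n + η)) ∈ diagonals := by
  classical
  have := Fintype.ofFinite Q
  obtain ⟨k, v, M, hM, hv, hli, hsum, hX⟩ := exists_positive_basis
    (insert η (Finset.univ.image len)) (by
      intro x hx
      rcases Finset.mem_insert.mp hx with rfl | hx
      · exact hη
      · obtain ⟨e, _, rfl⟩ := Finset.mem_image.mp hx
        exact (hN.len_pos e).le)
  have hMR : (M : ℝ) ≠ 0 := by positivity
  have hMZ : (0 : ℤ) < M := by exact_mod_cast hM
  obtain ⟨h, hh⟩ := hX η (Finset.mem_insert_self _ _)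
  have hA : ∀ e, ∃ a : Fin k → ℕ, len e = scaledValue v M fun j => (a j : ℤ) := fun e => by
    obtain ⟨a, ha⟩ := hX (len e) (Finset.mem_insert_of_mem
      (Finset.mem_image_of_mem _ (Finset.mem_univ e)))
    refine ⟨a, ?_⟩
    rw [scaledValue, eq_div_iff hMR, ha]
    simp
  choose A hA using hA
  set val := scaledValue v M with hval
  have hApos : ∀ e, 0 < ∑ j, (A e j : ℤ) := by
    intro e
    by_contra hle
    have h0 : ∀ j ∈ Finset.univ, (A e j : ℤ) = 0 :=
      (Finset.sum_eq_zero_iff_of_nonneg fun j _ => by positivity).mp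
        (le_antisymm (not_lt.mp hle) (Finset.sum_nonneg fun j _ => by positivity))
    have := hN.len_pos e
    rw [hA e, hval, scaledValue] at this
    simp [fun j => h0 j (Finset.mem_univ j)] at this
  -- lengths with a negative coordinate carry no walks
  have hnonneg : ∀ L, ∀ (p : Q) (z : Fin k → ℤ), L = val z → N p L ≠ 0 → ∀ j, 0 ≤ z j := by
    refine length_induction len hN.len_pos ?_ ?_
    · exact fun L hL p z _ h0 => absurd (hN.of_neg p L hL) h0
    · intro L hL ih p z hz h0 j
      rw [hN.first_edge p L hL] at h0
      by_cases hfin : p = fin ∧ L = 0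
      · rw [scaledValue_eq_zero hli hM (hz.symm.trans hfin.2)]
        simp
      · rw [if_neg hfin, zero_add] at h0
        obtain ⟨e, _, he⟩ := Finset.exists_ne_zero_of_sum_ne_zero h0
        have he' : N (dst e) (L - len e) ≠ 0 := fun h => he (by simp [h])
        have := ih e (dst e) (z - fun j => (A e j : ℤ))
          (by rw [hz, hA e, hval, scaledValue_sub]) he' j
        simp only [Pi.sub_apply] at this
        have : (0 : ℤ) ≤ A e j := by positivity
        linarith
  -- A state carries a residue `κ`, in units of `v / M`, not yet recorded by variables. Traversing
  -- `e` adds `A e`; every full `M` in a coordinate is emitted as one factor of that variable and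
  -- the rest stays in `κ`.
  let out : (Fin k → ℤ) → E → (Fin k →₀ ℕ) := fun κ e =>
    Finsupp.equivFunOnFinite.symm fun j => ((κ j + A e j) / (M : ℤ)).toNat
  let nxt : (Fin k → ℤ) → E → Fin k → ℤ := fun κ e j => κ j + A e j - M * (out κ e j : ℤ)
  have hnxt : ∀ (κ : Fin k → ℤ) e j, (κ j + A e j < 0 ∧ out κ e j = 0 ∧ nxt κ e j = κ j + A e j) ∨
      (0 ≤ nxt κ e j ∧ nxt κ e j < M) := by
    intro κ e j
    rcases lt_or_ge (κ j + A e j) 0 with hlt | hge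
    · left
      have : (κ j + A e j) / (M : ℤ) < 0 := Int.ediv_neg_of_neg_of_pos hlt hMZ
      have h0 : out κ e j = 0 := by simp [out, this.le]
      exact ⟨hlt, h0, by simp [nxt, h0]⟩
    · right
      have h1 : (out κ e j : ℤ) = (κ j + A e j) / (M : ℤ) := by
        simp only [out, Finsupp.equivFunOnFinite_symm_apply_apply]
        exact Int.toNat_of_nonneg (Int.ediv_nonneg hge hMZ.le)
      have h2 : nxt κ e j = (κ j + A e j) % (M : ℤ) := by
        simp only [nxt, h1]
        rw [Int.emod_def]
      rw [h2]
      exact ⟨Int.emod_nonneg _ hMZ.ne', Int.emod_lt_of_pos _ hMZ⟩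
  -- Residues start at `-h`, which accounts for the extra length `η`. They never fall below it and
  -- stay below `M`, so the state set is finite.
  let S : Finset (Q × (Fin k → ℤ)) :=
    Finset.univ ×ˢ Fintype.piFinset fun j => Finset.Ico (-(h j : ℤ)) M
  have hS : ∀ p κ, (p, κ) ∈ S ↔ ∀ j, -(h j : ℤ) ≤ κ j ∧ κ j < M := by
    intro p κ
    simp [S, Fintype.mem_piFinset]
  have hSnxt : ∀ p κ, (p, κ) ∈ S → ∀ q e, (q, nxt κ e) ∈ S := by
    intro p κ hp q e
    rw [hS] at hp ⊢
    intro j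
    have h1 := hp j
    rcases hnxt κ e j with ⟨h2, _, h3⟩ | ⟨h2, h3⟩
    · omega
    · exact ⟨by omega, h3⟩
  -- The coefficient at `c` of the series of a state counts the walks of remaining length `M * c -
  -- κ`.
  let arg : (Fin k →₀ ℕ) → (Fin k → ℤ) → Fin k → ℤ := fun c κ j => M * (c j : ℤ) - κ j
  let y : Q × (Fin k → ℤ) → MvPowerSeries (Fin k) ℤ := fun i c => (N i.1 (val (arg c i.2)) : ℤ)
  let Mat : Q × (Fin k → ℤ) → Q × (Fin k → ℤ) → MvPowerSeries (Fin k) ℤ := fun i i' =>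
    ∑ e, if src e = i.1 ∧ (dst e, nxt i.2 e) = i' then
      MvPowerSeries.monomial (out i.2 e) (1 : ℤ) else 0
  let g : Q × (Fin k → ℤ) → MvPowerSeries (Fin k) ℤ := fun i =>
    if i.1 = fin ∧ i.2 = 0 then 1 else 0
  have hcoeff : ∀ (i : Q × (Fin k → ℤ)) (c : Fin k →₀ ℕ),
      MvPowerSeries.coeff c (y i) = (N i.1 (val (arg c i.2)) : ℤ) := fun _ _ => rfl
  have hterm : ∀ κ c e, val (arg c κ) - len e = val (fun j => M * ((c j : ℤ) - out κ e j)
      - nxt κ e j) := by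
    intro κ c e
    rw [hA e, hval, ← scaledValue_sub]
    congr 1
    ext j
    simp only [arg, nxt, Pi.sub_apply]
    ring
  have hsys : ∀ i ∈ S, y i = ∑ j ∈ S, Mat i j * y j + g i := by
    rintro ⟨p, κ⟩ hi
    have hswap : ∑ j ∈ S, Mat (p, κ) j * y j =
        ∑ e, if src e = p then MvPowerSeries.monomial (out κ e) (1 : ℤ) * y (dst e, nxt κ e)
          else 0 := by
      simp only [Mat, Finset.sum_mul]
      rw [Finset.sum_comm]
      refine Finset.sum_congr rfl fun e _ => ?_
      rw [Finset.sum_eq_single (dst e, nxt κ e)]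
      · by_cases hs : src e = p <;> simp [hs]
      · intro b _ hb
        rw [if_neg fun hc => hb hc.2.symm, zero_mul]
      · exact fun hb => absurd (hSnxt p κ hi _ _) hb
    rw [hswap]
    ext c
    rw [map_add, map_sum, hcoeff]
    have he : ∀ e, MvPowerSeries.coeff c
        (if src e = p then MvPowerSeries.monomial (out κ e) (1 : ℤ) * y (dst e, nxt κ e) else 0)
        = ((if src e = p then N (dst e) (val (arg c κ) - len e) else 0 : ℕ) : ℤ) := by
      intro e
      by_cases hs : src e = p
      · rw [if_pos hs, if_pos hs, MvPowerSeries.coeff_monomial_mul, hterm, one_mul]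
        split_ifs with hle
        · rw [hcoeff]
          congr 3
          ext j
          have := hle j
          simp only [arg, Finsupp.tsub_apply, Nat.cast_sub this]
        -- If `c` does not contain the emitted monomial, the product has no such term. The walk
        -- count vanishes too, because the remaining length has a negative coordinate.
        · symm
          rw [Nat.cast_eq_zero]
          by_contra hne
          obtain ⟨j, hj⟩ : ∃ j, c j < out κ e j := by
            by_contra! hc
            exact hle hc
          have h1 := hnonneg _ _ _ rfl hne j
          rcases hnxt κ e j with ⟨_, h3, _⟩ | ⟨h2, _⟩
          · omega
          · have : (M : ℤ) * ((c j : ℤ) - out κ e j) ≤ M * (-1) :=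
              mul_le_mul_of_nonneg_left (by omega) hMZ.le
            linarith
      · simp [hs]
    simp_rw [he]
    have hg : MvPowerSeries.coeff c (g (p, κ)) =
        ((if p = fin ∧ val (arg c κ) = 0 then 1 else 0 : ℕ) : ℤ) := by
      -- Independence gives `M * c j = κ j`, and `κ j < M` then forces both sides to be zero.
      have hiff : val (arg c κ) = 0 ↔ κ = 0 ∧ c = 0 := by
        constructor
        · intro h0
          have h1 := scaledValue_eq_zero hli hM h0
          have h2 : ∀ j, c j = 0 := by
            intro j
            have h3 : (M : ℤ) * (c j : ℤ) - κ j = 0 := congrFun h1 j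
            have h4 := ((hS p κ).mp hi j).2
            by_contra hc
            have : (M : ℤ) * 1 ≤ M * (c j : ℤ) :=
              mul_le_mul_of_nonneg_left (by omega) hMZ.le
            omega
          refine ⟨?_, by ext j; simpa using h2 j⟩
          ext j
          have h3 : (M : ℤ) * (c j : ℤ) - κ j = 0 := congrFun h1 j
          rw [h2 j] at h3
          simpa using h3
        · rintro ⟨rfl, rfl⟩
          simp [hval, scaledValue, arg]
      simp only [g, hiff]
      by_cases h1 : p = fin <;> by_cases h2 : κ = 0 <;> simp [h1, h2, MvPowerSeries.coeff_one]
    rw [hg]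
    rcases lt_or_ge (val (arg c κ)) 0 with hlt | hge
    · simp only [hN.of_neg _ _ hlt]
      rw [if_neg (fun hc => hlt.ne hc.2)]
      simp [fun e => hN.of_neg (dst e) (val (arg c κ) - len e)
        (by linarith [hN.len_pos e])]
    · rw [hN.first_edge p _ hge]
      push_cast
      ring
  -- A nonzero constant term means a transition that emits nothing, and then the sum of the residues
  -- grows by the positive sum of `A e`.
  have hrank : ∀ i ∈ S, ∀ j ∈ S, MvPowerSeries.constantCoeff (Mat i j) ≠ 0 →
      (∑ l, i.2 l) < ∑ l, j.2 l := by
    rintro ⟨p, κ⟩ _ j _ h0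
    simp only [Mat, map_sum] at h0
    obtain ⟨e, _, he⟩ := Finset.exists_ne_zero_of_sum_ne_zero h0
    split_ifs at he with hc
    · rw [← hc.2]
      have hout : out κ e = 0 := by
        by_contra hne
        apply he
        rw [← MvPowerSeries.coeff_zero_eq_constantCoeff_apply, MvPowerSeries.coeff_monomial,
          if_neg (Ne.symm hne)]
      have : ∀ l, nxt κ e l = κ l + A e l := fun l => by simp [nxt, hout]
      simp only [this, Finset.sum_add_distrib]
      linarith [hApos e]
    · simp at he
  have hmain := isNRational_of_linearSystem (fun i : Q × (Fin k → ℤ) => ∑ l, i.2 l) S Mat g y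
    (fun i _ j _ => isNRational_sum _ _ fun e _ => by
      split_ifs
      · exact isNRational_monomial _
      · exact .zero)
    (fun i _ => by
      simp only [g]
      split_ifs
      · exact isNRational_one
      · exact .zero) hrank hsys (s, fun j => -(h j : ℤ)) ((hS _ _).mpr fun j => by
        constructor
        · exact le_rfl
        · have : (0 : ℤ) ≤ h j := by positivity
          omega)
  rw [diagonals, Set.mem_ofPred_eq]
  refine ⟨k, _, ?_, hmain, fun n => ?_⟩
  · rcases Nat.eq_zero_or_pos k with rfl | hk
    · simp at hsum
    · exact hk
  · rw [hcoeff]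
    congr 3
    simp only [arg, hval, scaledValue, Finsupp.equivFunOnFinite_symm_apply_apply]
    push_cast
    rw [div_eq_iff hMR, add_mul, hh]
    -- The normalization `∑ v = 1` is what places the length `n` on the diagonal.
    have : (n : ℝ) * M = ∑ j, (M * (n : ℝ)) * v j := by rw [← Finset.mul_sum, hsum]; ring
    rw [this, ← Finset.sum_add_distrib]
    exact Finset.sum_congr rfl fun j _ => by ring

/-! ### Exact partitions into horizontal translates of half-open tiles -/

theorem mem_translate {v p : ℝ × ℝ} {K : Set (ℝ × ℝ)} : p ∈ translate v K ↔ p - v ∈ K := by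
  simp only [translate, Set.mem_image]
  constructor
  · rintro ⟨q, hq, rfl⟩
    simpa using hq
  · exact fun h => ⟨p - v, h, by simp⟩

theorem translate_translate (v w : ℝ × ℝ) (K : Set (ℝ × ℝ)) :
    translate v (translate w K) = translate (v + w) K := by
  ext p
  simp only [mem_translate]
  rw [sub_sub]

@[simp] theorem translate_zero (K : Set (ℝ × ℝ)) : translate 0 K = K := by
  ext p; simp [mem_translate]

theorem translate_injective (v : ℝ × ℝ) : Function.Injective (translate v) := fun K L h => by
  have := congrArg (translate (-v)) h
  simpa [translate_translate] using this

theorem translate_subset_translate {v : ℝ × ℝ} {K L : Set (ℝ × ℝ)} :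
    translate v K ⊆ translate v L ↔ K ⊆ L :=
  Set.image_subset_image_iff (add_right_injective v)

theorem translate_diff (v : ℝ × ℝ) (K L : Set (ℝ × ℝ)) :
    translate v (K \ L) = translate v K \ translate v L := by
  ext p; simp [mem_translate]

/-- `P` is an exact partition of `Γ` into horizontal translates of members of `𝓣`. -/
structure IsPartition (𝓣 : Set (Set (ℝ × ℝ))) (Γ : Set (ℝ × ℝ)) (P : Set (Set (ℝ × ℝ))) :
    Prop where
  pieces : ∀ K ∈ P, ∃ τ ∈ 𝓣, ∃ x : ℝ, K = translate (x, 0) τ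
  disjoint : P.PairwiseDisjoint id
  covers : ⋃₀ P = Γ

/-- The number of exact partitions of `Γ` into horizontal translates of members of `𝓣`. -/
noncomputable def partitionCount (𝓣 : Set (Set (ℝ × ℝ))) (Γ : Set (ℝ × ℝ)) : ℕ∞ :=
  {P | IsPartition 𝓣 Γ P}.encard

/-- The leftmost point of `τ` on the horizontal axis is the origin. -/
def IsAnchored (τ : Set (ℝ × ℝ)) : Prop := (0, 0) ∈ τ ∧ ∀ x : ℝ, (x, 0) ∈ τ → 0 ≤ x

theorem IsAnchored.mem_translate {τ : Set (ℝ × ℝ)} (h : IsAnchored τ) (x : ℝ) :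
    (x, 0) ∈ translate (x, 0) τ := by
  rw [IrrationalTiling.mem_translate, sub_self]
  exact h.1

theorem IsPartition.translate {𝓣 : Set (Set (ℝ × ℝ))} {Γ : Set (ℝ × ℝ)} {P : Set (Set (ℝ × ℝ))}
    (h : IsPartition 𝓣 Γ P) (x : ℝ) :
    IsPartition 𝓣 (translate (x, 0) Γ) (IrrationalTiling.translate (x, 0) '' P) where
  pieces := by
    rintro _ ⟨K, hK, rfl⟩
    obtain ⟨τ, hτ, y, rfl⟩ := h.pieces K hK
    exact ⟨τ, hτ, x + y, by simp [translate_translate]⟩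
  disjoint := by
    rintro _ ⟨K, hK, rfl⟩ _ ⟨L, hL, rfl⟩ hne
    have : Disjoint K L := h.disjoint hK hL fun h => hne (by rw [h])
    exact (Set.disjoint_image_iff (add_right_injective _)).mpr this
  covers := by
    rw [← h.covers]
    ext p
    simp [mem_translate]

theorem partitionCount_translate (𝓣 : Set (Set (ℝ × ℝ))) (Γ : Set (ℝ × ℝ)) (x : ℝ) :
    partitionCount 𝓣 (translate (x, 0) Γ) = partitionCount 𝓣 Γ := by
  have key : ∀ (Γ : Set (ℝ × ℝ)) (x : ℝ),
      partitionCount 𝓣 Γ ≤ partitionCount 𝓣 (translate (x, 0) Γ) := by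
    intro Γ x
    refine Set.encard_le_encard_of_injOn (f := fun P => translate (x, 0) '' P)
      (fun P hP => IsPartition.translate hP x) ?_
    exact (Set.image_injective.mpr (translate_injective _)).injOn
  refine le_antisymm ?_ (key Γ x)
  have := key (translate (x, 0) Γ) (-x)
  rwa [translate_translate, show ((-x, (0 : ℝ)) + (x, 0)) = 0 by ext <;> simp,
    translate_zero] at this

/-- Anchored sets are nonempty, so the family consisting of `∅` alone is not a second partition. -/
theorem partitionCount_empty {𝓣 : Set (Set (ℝ × ℝ))} (h𝓣 : ∀ τ ∈ 𝓣, IsAnchored τ) :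
    partitionCount 𝓣 ∅ = 1 := by
  rw [partitionCount, Set.encard_eq_one]
  refine ⟨∅, Set.eq_singleton_iff_unique_mem.mpr ⟨⟨by simp, by simp, by simp⟩, ?_⟩⟩
  intro P hP
  by_contra hne
  obtain ⟨K, hK⟩ := Set.nonempty_iff_ne_empty.mpr hne
  obtain ⟨τ, hτ, x, rfl⟩ := hP.pieces K hK
  have : ((x, 0) : ℝ × ℝ) ∈ ⋃₀ P := ⟨_, hK, (h𝓣 τ hτ).mem_translate x⟩
  rw [hP.covers] at this
  exact this

/-- Partitions of an anchored region, classified by the piece that covers the origin. -/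
theorem partitionCount_anchored (T : Finset (Set (ℝ × ℝ))) (hT : ∀ τ ∈ T, IsAnchored τ)
    {Γ : Set (ℝ × ℝ)} (hΓ : IsAnchored Γ) [DecidablePred (· ⊆ Γ)] :
    partitionCount T Γ = ∑ τ ∈ T, if τ ⊆ Γ then partitionCount T (Γ \ τ) else 0 := by
  classical
  have hset : {P | IsPartition T Γ P} = ⋃ τ ∈ T.filter (· ⊆ Γ),
      (fun P => insert τ P) '' {P | IsPartition T (Γ \ τ) P} := by
    ext P
    simp only [Set.mem_ofPred_eq, Set.mem_iUnion, Finset.mem_filter, exists_prop, Set.mem_image]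
    constructor
    · intro hP
      obtain ⟨K, hK, h0⟩ : (0, 0) ∈ ⋃₀ P := by rw [hP.covers]; exact hΓ.1
      obtain ⟨τ, hτ, x, rfl⟩ := hP.pieces K hK
      -- The piece contains the origin, so its anchor is not to the right of it. The anchor lies in
      -- `Γ`, so it is not to the left either.
      have h1 : 0 ≤ -x := (hT τ hτ).2 (-x) (by simpa [mem_translate] using h0)
      have h2 : 0 ≤ x := hΓ.2 x (by
        rw [← hP.covers]
        exact ⟨_, hK, (hT τ hτ).mem_translate x⟩)
      have hx : x = 0 := by linarith
      subst hx
      have hz : translate ((0 : ℝ), (0 : ℝ)) τ = τ := translate_zero τ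
      rw [hz] at hK
      refine ⟨τ, ⟨hτ, ?_⟩, P \ {τ}, ⟨fun K hK => hP.pieces K hK.1,
        hP.disjoint.subset Set.sdiff_subset, ?_⟩, by simp [Set.insert_eq_of_mem hK]⟩
      · rw [← hP.covers]
        exact Set.subset_sUnion_of_mem hK
      · rw [← hP.covers]
        ext p
        simp only [Set.mem_sUnion, Set.mem_sdiff, Set.mem_singleton_iff]
        constructor
        · rintro ⟨L, ⟨hL, hne⟩, hp⟩
          exact ⟨⟨L, hL, hp⟩, fun hp' => Set.disjoint_left.mp (hP.disjoint hL hK hne) hp hp'⟩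
        · rintro ⟨⟨L, hL, hp⟩, hp'⟩
          exact ⟨L, ⟨hL, by rintro rfl; exact hp' hp⟩, hp⟩
    · rintro ⟨τ, ⟨hτ, hsub⟩, P, hP, rfl⟩
      refine ⟨?_, ?_, ?_⟩
      · rintro K (rfl | hK)
        · exact ⟨K, hτ, 0, (translate_zero K).symm⟩
        · exact hP.pieces K hK
      · refine hP.disjoint.insert fun L hL _ => ?_
        have : L ⊆ Γ \ τ := by rw [← hP.covers]; exact Set.subset_sUnion_of_mem hL
        exact Set.disjoint_left.mpr fun p hp hL => (this hL).2 hp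
      · rw [Set.sUnion_insert, hP.covers, Set.union_sdiff_cancel hsub]
  -- The first tile is recognizable as the only piece containing the origin. This makes the union
  -- over `τ` disjoint and the insertion of `τ` injective.
  have hnot : ∀ τ ∈ T, ∀ P, IsPartition T (Γ \ τ) P → ∀ K ∈ P, (0, 0) ∉ K := by
    intro τ hτ P hP K hK h0
    have : ((0, 0) : ℝ × ℝ) ∈ Γ \ τ := by rw [← hP.covers]; exact ⟨K, hK, h0⟩
    exact this.2 (hT τ hτ).1
  rw [partitionCount, hset, ← Finset.sum_filter, ← Finset.set_biUnion_coe,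
    (Finset.finite_toSet _).encard_biUnion, finsum_mem_coe_finset]
  · refine Finset.sum_congr rfl fun τ hτ => ?_
    have hτT := (Finset.mem_filter.mp hτ).1
    rw [partitionCount, Set.InjOn.encard_image]
    intro P hP P' hP' heq
    have h1 : τ ∉ P := fun h => hnot τ hτT P hP τ h (hT τ hτT).1
    have h2 : τ ∉ P' := fun h => hnot τ hτT P' hP' τ h (hT τ hτT).1
    simp only at heq
    rw [← Set.insert_sdiff_self_of_notMem h1, heq, Set.insert_sdiff_self_of_notMem h2]
  · intro τ hτ τ' hτ' hne
    refine Set.disjoint_left.mpr ?_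
    rintro _ ⟨P, hP, rfl⟩ ⟨P', hP', heq⟩
    have hτT := (Finset.mem_filter.mp hτ).1
    have hτT' := (Finset.mem_filter.mp hτ').1
    have : τ' ∈ insert τ P := by
      simp only at heq
      rw [← heq]; exact Set.mem_insert _ _
    rcases this with h | h
    · exact hne h.symm
    · exact hnot τ hτT P hP τ' h (hT τ' hτT').1

/-- The part of the strip of height `1` to the right of the abscissa `ℓ`. -/
def halfStrip (ℓ : ℝ) : Set (ℝ × ℝ) := Set.Ici ℓ ×ˢ Set.Ico 0 1

theorem mem_halfStrip {ℓ : ℝ} {p : ℝ × ℝ} :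
    p ∈ halfStrip ℓ ↔ ℓ ≤ p.1 ∧ 0 ≤ p.2 ∧ p.2 < 1 := Iff.rfl

theorem translate_halfStrip (x ℓ : ℝ) :
    translate (x, 0) (halfStrip ℓ) = halfStrip (x + ℓ) := by
  ext p
  simp [mem_translate, mem_halfStrip, le_sub_iff_add_le, add_comm]

open scoped Classical in
/-- The number of partitions of the part of `R` to the left of the abscissa `ℓ`, where `R` has to
contain everything to the right. -/
noncomputable def remCount (𝓣 : Set (Set (ℝ × ℝ))) (R : Set (ℝ × ℝ)) (ℓ : ℝ) : ℕ∞ :=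
  if halfStrip ℓ ⊆ R then partitionCount 𝓣 (R \ halfStrip ℓ) else 0

theorem remCount_translate (𝓣 : Set (Set (ℝ × ℝ))) (R : Set (ℝ × ℝ)) (x ℓ : ℝ) :
    remCount 𝓣 (translate (x, 0) R) (x + ℓ) = remCount 𝓣 R ℓ := by
  rw [remCount, remCount, ← translate_halfStrip, translate_subset_translate, ← translate_diff,
    partitionCount_translate]

theorem remCount_of_neg (𝓣 : Set (Set (ℝ × ℝ))) {R : Set (ℝ × ℝ)} (hR : IsAnchored R) {ℓ : ℝ}
    (hℓ : ℓ < 0) : remCount 𝓣 R ℓ = 0 := by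
  rw [remCount, if_neg]
  intro h
  have := hR.2 ℓ (h (by simp [mem_halfStrip]))
  linarith

-- This is the recursion on the first edge of a walk, before shapes are identified up to
-- translation. For `ℓ > 0` the origin still has to be covered and `partitionCount_anchored`
-- applies; for `ℓ = 0` no piece can be placed, and only an exact half strip counts.
open scoped Classical in
theorem remCount_anchored (T : Finset (Set (ℝ × ℝ))) (hT : ∀ τ ∈ T, IsAnchored τ)
    {R : Set (ℝ × ℝ)} (hR : IsAnchored R) (ℓ : ℝ) :
    remCount T R ℓ = (if R = halfStrip 0 ∧ ℓ = 0 then 1 else 0) +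
      ∑ τ ∈ T, if τ ⊆ R then remCount T (R \ τ) ℓ else 0 := by
  by_cases hsub : halfStrip ℓ ⊆ R
  swap
  · rw [remCount, if_neg hsub, if_neg (by rintro ⟨rfl, rfl⟩; exact hsub subset_rfl), zero_add]
    symm
    refine Finset.sum_eq_zero fun τ _ => ?_
    have h0 : remCount T (R \ τ) ℓ = 0 := by
      rw [remCount, if_neg fun h => hsub (h.trans Set.sdiff_subset)]
    rw [h0, ite_self]
  rcases lt_trichotomy ℓ 0 with hneg | rfl | hpos
  · have := hR.2 ℓ (hsub (by simp [mem_halfStrip]))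
    linarith
  · have hz : ∀ τ ∈ T, (if τ ⊆ R then remCount T (R \ τ) 0 else 0) = 0 := by
      intro τ hτ
      have h0 : remCount T (R \ τ) 0 = 0 := by
        rw [remCount, if_neg]
        intro h
        exact (h (show ((0, 0) : ℝ × ℝ) ∈ halfStrip 0 by simp [mem_halfStrip])).2 (hT τ hτ).1
      rw [h0, ite_self]
    rw [Finset.sum_eq_zero hz, add_zero, remCount, if_pos hsub]
    by_cases hRe : R = halfStrip 0
    · subst hRe
      simp [partitionCount_empty (𝓣 := (T : Set _)) (by simpa using hT)]
    · rw [if_neg (by simp [hRe]), partitionCount, Set.encard_eq_zero,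
        Set.eq_empty_iff_forall_notMem]
      intro P hP
      -- A leftover region needs a piece, but the anchor of that piece has a nonnegative abscissa
      -- and therefore lies in the removed half strip.
      have hne : (R \ halfStrip 0).Nonempty := by
        rw [Set.nonempty_iff_ne_empty, Ne, Set.sdiff_eq_empty]
        exact fun h => hRe (h.antisymm hsub)
      obtain ⟨p, hp⟩ := hne
      rw [← hP.covers] at hp
      obtain ⟨K, hK, -⟩ := hp
      obtain ⟨τ, hτ, x, rfl⟩ := hP.pieces K hK
      have hx : ((x, 0) : ℝ × ℝ) ∈ R \ halfStrip 0 := by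
        rw [← hP.covers]
        exact ⟨_, hK, (hT τ hτ).mem_translate x⟩
      exact hx.2 (by simpa [mem_halfStrip] using hR.2 x hx.1)
  · have hΓ : IsAnchored (R \ halfStrip ℓ) :=
      ⟨⟨hR.1, by simp [mem_halfStrip, hpos]⟩, fun x hx => hR.2 x hx.1⟩
    rw [if_neg (fun h => hpos.ne' h.2), zero_add, remCount, if_pos hsub,
      partitionCount_anchored T hT hΓ]
    refine Finset.sum_congr rfl fun τ hτ => ?_
    by_cases h1 : τ ⊆ R
    · by_cases h2 : Disjoint τ (halfStrip ℓ)
      · rw [if_pos h1, if_pos (Set.subset_sdiff.mpr ⟨h1, h2⟩), remCount,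
          if_pos (Set.subset_sdiff.mpr ⟨hsub, h2.symm⟩), Set.sdiff_sdiff_comm]
      · rw [if_pos h1, if_neg (fun h => h2 (Set.subset_sdiff.mp h).2), remCount,
          if_neg (fun h => h2 (Set.subset_sdiff.mp h).2.symm)]
    · rw [if_neg h1, if_neg (fun h => h1 (h.trans Set.sdiff_subset))]

/-- A region that reaches too far to the left of its leftmost bottom point cannot be tiled. -/
theorem remCount_eq_zero_of_lt {𝓣 : Set (Set (ℝ × ℝ))} (h𝓣 : ∀ τ ∈ 𝓣, IsAnchored τ) {W : ℝ}
    (hW : ∀ τ ∈ 𝓣, ∀ p ∈ τ, -W ≤ p.1) {R : Set (ℝ × ℝ)} {q : ℝ} (hR : ∀ x, (x, 0) ∈ R → q ≤ x)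
    {p : ℝ × ℝ} (hp : p ∈ R) (hpW : p.1 < q - W) (hW0 : 0 ≤ W) (ℓ : ℝ) :
    remCount 𝓣 R ℓ = 0 := by
  rw [remCount]
  split_ifs with hsub
  · rw [partitionCount, Set.encard_eq_zero, Set.eq_empty_iff_forall_notMem]
    intro P hP
    have hℓ : q ≤ ℓ := hR ℓ (hsub (by simp [mem_halfStrip]))
    have hmem : p ∈ ⋃₀ P := by
      rw [hP.covers]
      exact ⟨hp, fun h => by linarith [(mem_halfStrip.mp h).1]⟩
    -- The anchor of the piece over `p` is a bottom point of `R`, so its abscissa is at least `q`,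
    -- while the piece reaches at most `W` to the left of its anchor.
    obtain ⟨K, hK, hpK⟩ := hmem
    obtain ⟨τ, hτ, x, rfl⟩ := hP.pieces K hK
    have hx : ((x, 0) : ℝ × ℝ) ∈ R \ halfStrip ℓ := by
      rw [← hP.covers]
      exact ⟨_, hK, (h𝓣 τ hτ).mem_translate x⟩
    have h1 := hR x hx.1
    have h2 := hW τ hτ _ (mem_translate.mp hpK)
    simp only [Prod.fst_sub] at h2
    linarith
  · rfl

/-! ### Tilings as walks in a finite graph of boundary shapes -/

theorem IsWalkCount.ne_top {Q E : Type} [Fintype E] {src dst : E → Q} {len : E → ℝ} {fin : Q}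
    {N : Q → ℝ → ℕ∞} (hN : IsWalkCount src dst len fin N) (p : Q) (L : ℝ) : N p L ≠ ⊤ := by
  revert p
  refine length_induction len hN.len_pos (motive := fun L => ∀ p, N p L ≠ ⊤) ?_ ?_ L
  · intro L hL p
    simp [hN.of_neg p L hL]
  · intro L hL ih p
    rw [hN.first_edge p L hL, Ne, ENat.add_eq_top, not_or]
    refine ⟨by split_ifs <;> simp, ?_⟩
    refine Finset.sum_induction _ (· ≠ ⊤) (fun a b ha hb => ?_) (by simp) fun e _ => ?_
    · simpa using ⟨ha, hb⟩
    · split_ifs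
      · exact ih e _
      · simp

theorem IsWalkCount.toNat {Q E : Type} [Fintype E] {src dst : E → Q} {len : E → ℝ} {fin : Q}
    {N : Q → ℝ → ℕ∞} (hN : IsWalkCount src dst len fin N) :
    IsWalkCount src dst len fin fun p L => (N p L).toNat where
  len_pos := hN.len_pos
  of_neg p L hL := by simp [hN.of_neg p L hL]
  first_edge p L hL := by
    have h := hN.first_edge p L hL
    have hcast : ∀ p L, ((N p L).toNat : ℕ∞) = N p L := fun p L => ENat.natCast_toNat (hN.ne_top p L)
    rw [← Nat.cast_inj (R := ℕ∞)]
    push_cast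
    simp only [hcast]
    exact h

/-- If the remaining regions form finitely many shapes up to translation, then the partition counts
are diagonals. -/
theorem mem_diagonals_of_finite_shapes (T : Finset (Set (ℝ × ℝ))) (hT : ∀ τ ∈ T, IsAnchored τ)
    {𝓢 : Set (Set (ℝ × ℝ))} (hfin : 𝓢.Finite) (h0 : halfStrip 0 ∈ 𝓢)
    (hanch : ∀ R ∈ 𝓢, IsAnchored R)
    (hstep : ∀ R ∈ 𝓢, ∀ τ ∈ T, τ ⊆ R → (∃ q > 0, translate (-q, 0) (R \ τ) ∈ 𝓢) ∨
      ∀ ℓ, remCount T (R \ τ) ℓ = 0) {ε : ℝ} (hε : 0 ≤ ε) {f : ℕ → ℕ}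
    (hf : ∀ n : ℕ, remCount T (halfStrip 0) (n + ε) = f n) : f ∈ diagonals := by
  classical
  have := hfin.to_subtype
  have := Fintype.ofFinite 𝓢
  -- Edges are placements whose remaining region, moved back by some `q`, is again in `𝓢`; the
  -- length of the edge is that shift. Dead placements need no edge, since they contribute zero.
  let valid : 𝓢 × T → Prop := fun e =>
    (e.2 : Set (ℝ × ℝ)) ⊆ e.1 ∧ ∃ q > 0, translate (-q, 0) ((e.1 : Set (ℝ × ℝ)) \ e.2) ∈ 𝓢
  let E := {e : 𝓢 × T // valid e}
  let len : E → ℝ := fun e => e.2.2.choose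
  have hlen : ∀ e : E, 0 < len e := fun e => e.2.2.choose_spec.1
  let dst : E → 𝓢 := fun e => ⟨_, e.2.2.choose_spec.2⟩
  have hdst : ∀ e : E, (dst e : Set (ℝ × ℝ)) = translate (-len e, 0) (e.1.1 \ e.1.2) :=
    fun e => rfl
  have hN : IsWalkCount (fun e : E => e.1.1) dst len (⟨_, h0⟩ : 𝓢) fun p L => remCount T p L := by
    refine ⟨hlen, fun p L hL => remCount_of_neg _ (hanch p p.2) hL, fun p L _ => ?_⟩
    rw [remCount_anchored T hT (hanch p p.2) L]
    congr 1
    · simp only [Subtype.ext_iff]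
    have h1 : ∀ e : E, remCount T (dst e) (L - len e) = remCount T (e.1.1 \ e.1.2) L := by
      intro e
      rw [hdst e, sub_eq_neg_add, remCount_translate]
    simp only [h1]
    rw [← Finset.sum_subtype (Finset.univ.filter valid) (by simp)
      (fun e : 𝓢 × T => if e.1 = p then remCount T (e.1 \ e.2) L else 0), Finset.sum_filter,
      Fintype.sum_prod_type, Finset.sum_eq_single p, ← Finset.sum_coe_sort]
    · refine Finset.sum_congr rfl fun τ _ => ?_
      by_cases hsub : (τ : Set (ℝ × ℝ)) ⊆ p
      · rw [if_pos hsub]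
        rcases hstep p p.2 τ τ.2 hsub with hq | hz
        · rw [if_pos ⟨hsub, hq⟩, if_pos rfl]
        · simp [hz]
      · rw [if_neg hsub, if_neg fun h => hsub h.1]
    · intro R _ hR
      simp [hR]
    · simp
  have := mem_diagonals_of_isWalkCount hN.toNat ⟨_, h0⟩ hε
  convert this using 2 with n
  simp [hf]

/-! ### Finiteness of the set of completable boundary shapes -/

section Shapes

/-- Among the right endpoints reachable from `t` without a gap take the largest: an interval
containing it would extend the run. -/
theorem exists_gap {J : Set (ℝ × ℝ)} (hJ : J.Finite) {t : ℝ}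
    (ht : ∃ i ∈ J, i.1 ≤ t ∧ t < i.2) :
    ∃ i ∈ J, t < i.2 ∧ (∀ x, t ≤ x → x < i.2 → ∃ j ∈ J, j.1 ≤ x ∧ x < j.2) ∧
      ¬ ∃ j ∈ J, j.1 ≤ i.2 ∧ i.2 < j.2 := by
  obtain ⟨i, ⟨hiJ, hti, hi⟩, hmax⟩ := Set.exists_max_image
    {i ∈ J | t < i.2 ∧ ∀ x, t ≤ x → x < i.2 → ∃ j ∈ J, j.1 ≤ x ∧ x < j.2} Prod.snd
    (hJ.subset (Set.sep_subset _ _)) (by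
      obtain ⟨i, hi, h1, h2⟩ := ht
      exact ⟨i, hi, h2, fun x hx hx' => ⟨i, hi, h1.trans hx, hx'⟩⟩)
  refine ⟨i, hiJ, hti, hi, ?_⟩
  rintro ⟨j, hj, h1, h2⟩
  have := hmax j ⟨hj, hti.trans h2, fun x hx hx' => by
    rcases lt_or_ge x i.2 with h | h
    · exact hi x hx h
    · exact ⟨j, hj, h1.trans h, hx'⟩⟩
  linarith

/-- The smallest generator is positive and bounds the number of summands, so only finitely many
lists of generators matter. -/
theorem finite_closure_le {C : Set ℝ} (hC : C.Finite) (hpos : ∀ c ∈ C, 0 < c) (B : ℝ) :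
    {r | r ∈ AddSubmonoid.closure C ∧ r ≤ B}.Finite := by
  rcases C.eq_empty_or_nonempty with rfl | hne
  · refine (Set.finite_singleton (0 : ℝ)).subset ?_
    rintro r ⟨hr, -⟩
    simpa using hr
  obtain ⟨m, hm, hmin⟩ := Set.exists_min_image C id hC hne
  have := hC.to_subtype
  obtain ⟨n, hn⟩ := exists_nat_gt (B / m)
  refine ((List.finite_length_le C n).image fun l => (l.map Subtype.val).sum).subset ?_
  rintro r ⟨hr, hB⟩
  obtain ⟨l, hl, rfl⟩ := AddSubmonoid.exists_list_of_mem_closure hr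
  lift l to List C using hl
  refine ⟨l, ?_, rfl⟩
  have h1 : (l.length : ℝ) * m ≤ (l.map Subtype.val).sum := by
    have := List.card_nsmul_le_sum (l.map Subtype.val) m (by
      intro x hx
      obtain ⟨c, _, rfl⟩ := List.mem_map.mp hx
      exact hmin c c.2)
    simpa using this
  have h2 : (l.length : ℝ) < n := by
    have h3 := (div_lt_iff₀ (hpos m hm)).mp hn
    have := hpos m hm
    by_contra! h
    nlinarith
  exact (by exact_mod_cast h2.le : l.length ≤ n)

/-- Tiles of the multiset `S` have been placed on the half strip so that `q` is the leftmost
bottom point that is not covered. -/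
structure IsConfig (T : Finset (Set (ℝ × ℝ))) (S : Set (ℝ × Set (ℝ × ℝ))) (q : ℝ) : Prop where
  finite : S.Finite
  mem : ∀ e ∈ S, e.2 ∈ T ∧ 0 ≤ e.1 ∧ e.1 < q
  disjoint : S.PairwiseDisjoint fun e => translate (e.1, 0) e.2
  covered : ∀ t, 0 ≤ t → t < q → ∃ e ∈ S, (t, 0) ∈ translate (e.1, 0) e.2
  uncovered : ∀ e ∈ S, (q, 0) ∉ translate (e.1, 0) e.2
  nonneg : 0 ≤ q

/-- The region that remains of the half strip, with its leftmost bottom point at the origin. -/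
def configRegion (S : Set (ℝ × Set (ℝ × ℝ))) (q : ℝ) : Set (ℝ × ℝ) :=
  translate (-q, 0) (halfStrip 0 \ ⋃ e ∈ S, translate (e.1, 0) e.2)

theorem mem_configRegion {S : Set (ℝ × Set (ℝ × ℝ))} {q : ℝ} {p : ℝ × ℝ} :
    p ∈ configRegion S q ↔ (0 ≤ p.1 + q ∧ 0 ≤ p.2 ∧ p.2 < 1) ∧
      ∀ e ∈ S, (p.1 + q - e.1, p.2) ∉ e.2 := by
  have h : p - (-q, 0) = (p.1 + q, p.2) := by ext <;> simp
  have h' : ∀ x : ℝ, ((p.1 + q, p.2) : ℝ × ℝ) - (x, 0) = (p.1 + q - x, p.2) := fun x => by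
    ext <;> simp
  simp only [configRegion, mem_translate, h, Set.mem_sdiff, mem_halfStrip, Set.mem_iUnion, h',
    not_exists]

theorem mem_translate_bottom {x t : ℝ} {τ : Set (ℝ × ℝ)} :
    (t, 0) ∈ translate (x, 0) τ ↔ (t - x, 0) ∈ τ := by
  rw [mem_translate]
  simp

theorem IsConfig.isAnchored {T : Finset (Set (ℝ × ℝ))} {S : Set (ℝ × Set (ℝ × ℝ))} {q : ℝ}
    (h : IsConfig T S q) : IsAnchored (configRegion S q) := by
  constructor
  · rw [mem_configRegion]
    refine ⟨by simpa using h.nonneg, fun e he hmem => h.uncovered e he ?_⟩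
    rw [mem_translate_bottom]
    simpa using hmem
  · intro x hx
    rw [mem_configRegion] at hx
    by_contra! hneg
    obtain ⟨e, he, hmem⟩ := h.covered (x + q) hx.1.1 (by linarith)
    exact hx.2 e he (mem_translate_bottom.mp hmem)

theorem isConfig_empty (T : Finset (Set (ℝ × ℝ))) : IsConfig T ∅ 0 where
  finite := Set.finite_empty
  mem := by simp
  disjoint := by simp
  covered t h0 h1 := absurd h1 (not_lt.mpr h0)
  uncovered := by simp
  nonneg := le_rfl

theorem configRegion_empty : configRegion ∅ 0 = halfStrip 0 := by
  ext p; simp [mem_configRegion, mem_halfStrip]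

variable {T : Finset (Set (ℝ × ℝ))} (hT : ∀ τ ∈ T, IsAnchored τ)
  {I : Set (ℝ × ℝ) → Set (ℝ × ℝ)} (hIfin : ∀ τ ∈ T, (I τ).Finite)
  (hI : ∀ τ ∈ T, ∀ x, (x, 0) ∈ τ ↔ ∃ i ∈ I τ, i.1 ≤ x ∧ x < i.2)
include hT hIfin hI

/-- The new tile is anchored at the frontier `q`. The next frontier is the end of the run of bottom
intervals through `q`, found by `exists_gap` among the intervals `I` of all placed tiles. -/
theorem IsConfig.step {S : Set (ℝ × Set (ℝ × ℝ))} {q : ℝ} (h : IsConfig T S q)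
    {τ : Set (ℝ × ℝ)} (hτ : τ ∈ T) (hsub : τ ⊆ configRegion S q) :
    ∃ r > 0, IsConfig T (insert (q, τ) S) (q + r) ∧
      translate (-r, 0) (configRegion S q \ τ) = configRegion (insert (q, τ) S) (q + r) := by
  let J : Set (ℝ × ℝ) := ⋃ e ∈ insert (q, τ) S, (fun i : ℝ × ℝ => (e.1 + i.1, e.1 + i.2)) '' I e.2
  have hmemT : ∀ e ∈ insert (q, τ) S, e.2 ∈ T := by
    rintro e (rfl | he)
    · exact hτ
    · exact (h.mem e he).1
  have hJ : J.Finite := (h.finite.insert _).biUnion fun e he => (hIfin _ (hmemT e he)).image _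
  have hJmem : ∀ x, (∃ j ∈ J, j.1 ≤ x ∧ x < j.2) ↔
      ∃ e ∈ insert (q, τ) S, (x, 0) ∈ translate (e.1, 0) e.2 := by
    intro x
    simp only [J, Set.mem_iUnion, Set.mem_image, mem_translate_bottom]
    constructor
    · rintro ⟨_, ⟨e, he, i, hi, rfl⟩, h1, h2⟩
      exact ⟨e, he, (hI _ (hmemT e he) _).mpr ⟨i, hi, by linarith, by linarith⟩⟩
    · rintro ⟨e, he, hx⟩
      obtain ⟨i, hi, h1, h2⟩ := (hI _ (hmemT e he) _).mp hx
      exact ⟨_, ⟨e, he, i, hi, rfl⟩, by simp only; linarith, by simp only; linarith⟩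
  obtain ⟨i, -, hqi, hcov, hunc⟩ := exists_gap hJ ((hJmem q).mpr
    ⟨(q, τ), Set.mem_insert _ _, (hT τ hτ).mem_translate q⟩)
  rw [hJmem] at hunc
  push Not at hunc
  refine ⟨i.2 - q, by linarith, ⟨h.finite.insert _, ?_, ?_, ?_, ?_, ?_⟩, ?_⟩
  · rintro e (rfl | he)
    · exact ⟨hτ, h.nonneg, by simp only; linarith⟩
    · obtain ⟨h1, h2, h3⟩ := h.mem e he
      exact ⟨h1, h2, by linarith⟩
  · refine h.disjoint.insert fun e he _ => ?_
    refine Set.disjoint_left.mpr fun p hp hpe => ?_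
    have := (mem_configRegion.mp (hsub (mem_translate.mp hp))).2 e he
    apply this
    have h2 := mem_translate.mp hpe
    convert h2 using 1
    ext <;> simp
  · intro t h0 ht
    rcases lt_or_ge t q with hlt | hge
    · obtain ⟨e, he, hm⟩ := h.covered t h0 hlt
      exact ⟨e, Set.mem_insert_of_mem _ he, hm⟩
    · exact (hJmem t).mp (hcov t hge (by linarith))
  · intro e he
    rw [show q + (i.2 - q) = i.2 by ring]
    exact hunc e he
  · linarith [h.nonneg]
  · ext p
    rw [mem_translate, Set.mem_sdiff, mem_configRegion, mem_configRegion]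
    simp only [Set.forall_mem_insert]
    have h1 : p - (-(i.2 - q), 0) = (p.1 + (i.2 - q), p.2) := by
      ext
      · simp; ring
      · simp
    rw [h1]
    simp only [show p.1 + (i.2 - q) + q = p.1 + (q + (i.2 - q)) by ring,
      show p.1 + (q + (i.2 - q)) - q = p.1 + (i.2 - q) by ring]
    tauto

/-- The lengths of unions of consecutive bottom intervals of tiles. -/
def bottomLengths (T : Finset (Set (ℝ × ℝ))) (I : Set (ℝ × ℝ) → Set (ℝ × ℝ)) : Set ℝ :=
  {c | 0 < c ∧ ∃ τ ∈ T, ∃ i ∈ I τ, ∃ j ∈ I τ, c = j.2 - i.1}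

omit hT hI in
theorem finite_bottomLengths : (bottomLengths T I).Finite := by
  have : (⋃ τ ∈ T, Set.image2 (fun i j : ℝ × ℝ => j.2 - i.1) (I τ) (I τ)).Finite :=
    T.finite_toSet.biUnion fun τ hτ => (hIfin τ hτ).image2 _ (hIfin τ hτ)
  refine this.subset ?_
  rintro c ⟨_, τ, hτ, i, hi, j, hj, rfl⟩
  simp only [Set.mem_iUnion]
  exact ⟨τ, hτ, i, hi, j, hj, rfl⟩

/-- The bottom line from `t` to the frontier is a chain of runs of single tiles. When `t` begins a
run of its tile, that run has a length in `bottomLengths`; the tile covering its end begins a run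
there, and the argument repeats until `q`. -/
theorem IsConfig.sub_mem_closure {S : Set (ℝ × Set (ℝ × ℝ))} {q : ℝ} (h : IsConfig T S q) (L : ℝ) :
    ∀ e ∈ S, ∀ t < q, L = q - t → (t, 0) ∈ translate (e.1, 0) e.2 →
      (∀ u < t, ∃ u', u < u' ∧ u' < t ∧ (u', 0) ∉ translate (e.1, 0) e.2) →
      L ∈ AddSubmonoid.closure (bottomLengths T I) := by
  have := (finite_bottomLengths (T := T) hIfin).to_subtype
  refine length_induction (E := bottomLengths T I) Subtype.val (fun c => c.2.1)
    (motive := fun L => ∀ e ∈ S, ∀ t < q, L = q - t → (t, 0) ∈ translate (e.1, 0) e.2 →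
      (∀ u < t, ∃ u', u < u' ∧ u' < t ∧ (u', 0) ∉ translate (e.1, 0) e.2) →
      L ∈ AddSubmonoid.closure (bottomLengths T I)) ?_ ?_ L
  · intro L hL e _ t ht hLt
    linarith
  · intro L _ ih e he t htq hLt ht hleft
    have heT := (h.mem e he).1
    rw [mem_translate_bottom] at ht
    obtain ⟨j, hj, hj1, hj2⟩ := (hI _ heT _).mp ht
    have hjt : j.1 = t - e.1 := by
      refine le_antisymm hj1 ?_
      by_contra! hlt
      obtain ⟨u, hu1, hu2, hu⟩ := hleft (e.1 + j.1) (by linarith)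
      exact hu (mem_translate_bottom.mpr ((hI _ heT _).mpr ⟨j, hj, by linarith, by linarith⟩))
    obtain ⟨i, hi, hti, hcov, hunc⟩ := exists_gap (hIfin _ heT) ((hI _ heT _).mp ht)
    have hcov' : ∀ x, t ≤ x → x < e.1 + i.2 → (x, 0) ∈ translate (e.1, 0) e.2 := fun x h1 h2 =>
      mem_translate_bottom.mpr ((hI _ heT _).mpr (hcov _ (by linarith) (by linarith)))
    have hunc' : (e.1 + i.2, 0) ∉ translate (e.1, 0) e.2 := by
      rw [mem_translate_bottom, hI _ heT]
      simpa using hunc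
    have hc : e.1 + i.2 - t ∈ bottomLengths T I :=
      ⟨by linarith, e.2, heT, j, hj, i, hi, by rw [hjt]; ring⟩
    -- The run cannot pass the frontier, because the bottom point `q` is uncovered.
    have hle : e.1 + i.2 ≤ q := by
      by_contra! hlt
      exact h.uncovered e he (hcov' q htq.le hlt)
    rcases hle.lt_or_eq with hlt | heq
    · obtain ⟨e', he', hm⟩ := h.covered (e.1 + i.2)
        (by linarith [h.mem e he, (hT _ heT).2 _ ht]) hlt
      have hne : e ≠ e' := by rintro rfl; exact hunc' hm
      -- Just before the end of the run all points belong to `e`, hence not to `e'` by disjointness,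
      -- so `e'` does begin a run there.
      have := ih ⟨_, hc⟩ e' he' _ hlt (by simp only; linarith) hm fun u hu => by
        obtain ⟨u', h1, h2⟩ := exists_between (max_lt hu (show t < e.1 + i.2 by linarith))
        refine ⟨u', (le_max_left _ _).trans_lt h1, h2, fun hu' => ?_⟩
        exact Set.disjoint_left.mp (h.disjoint he he' hne)
          (hcov' u' ((le_max_right _ _).trans h1.le) h2) hu'
      have h3 := AddSubmonoid.add_mem _ this (AddSubmonoid.subset_closure hc)
      simpa using h3
    · have h3 := AddSubmonoid.subset_closure (M := ℝ) hc
      rwa [heq, ← hLt] at h3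

theorem IsConfig.start_mem_closure {S : Set (ℝ × Set (ℝ × ℝ))} {q : ℝ} (h : IsConfig T S q)
    {e : ℝ × Set (ℝ × ℝ)} (he : e ∈ S) :
    q - e.1 ∈ AddSubmonoid.closure (bottomLengths T I) := by
  obtain ⟨heT, _, hq⟩ := h.mem e he
  refine h.sub_mem_closure hT hIfin hI _ e he e.1 hq rfl ((hT _ heT).mem_translate _) ?_
  intro u hu
  obtain ⟨u', h1, h2⟩ := exists_between hu
  refine ⟨u', h1, h2, fun hm => ?_⟩
  have := (hT _ heT).2 _ (mem_translate_bottom.mp hm)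
  linarith

/-- The tile over the bottom point `0` is anchored there, since no tile starts to the left of `0`.
-/
theorem IsConfig.mem_closure {S : Set (ℝ × Set (ℝ × ℝ))} {q : ℝ} (h : IsConfig T S q) :
    q ∈ AddSubmonoid.closure (bottomLengths T I) := by
  rcases h.nonneg.eq_or_lt with rfl | hq
  · exact AddSubmonoid.zero_mem _
  · obtain ⟨e, he, hm⟩ := h.covered 0 le_rfl hq
    obtain ⟨heT, h0, _⟩ := h.mem e he
    have h1 := (hT _ heT).2 _ (mem_translate_bottom.mp hm)
    have h2 : e.1 = 0 := by linarith
    simpa [h2] using h.start_mem_closure hT hIfin hI he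

/-- The shapes of remaining regions that do not reach too far to the left. -/
def liveShapes (T : Finset (Set (ℝ × ℝ))) (W : ℝ) : Set (Set (ℝ × ℝ)) :=
  {R | (∀ p ∈ R, -W ≤ p.1) ∧ ∃ S q, IsConfig T S q ∧ R = configRegion S q}

/-- Relative to the frontier, a live shape lies to the right of `-W`, and a tile anchored more than
`2 * W` behind the frontier ends before `-W`. So the shape depends only on `min q W` and on the
offsets of at most `2 * W`, all taken from finite sets. -/
theorem finite_liveShapes {W : ℝ} (hW0 : 0 ≤ W) (hW : ∀ τ ∈ T, ∀ p ∈ τ, p.1 ≤ W) :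
    (liveShapes T W).Finite := by
  let A : Set ℝ := {r | r ∈ AddSubmonoid.closure (bottomLengths T I) ∧ r ≤ 2 * W}
  have hA : A.Finite := finite_closure_le (finite_bottomLengths hIfin) (fun c hc => hc.1) _
  let Φ : ℝ → Set (ℝ × Set (ℝ × ℝ)) → Set (ℝ × ℝ) := fun m S' =>
    halfStrip (-m) \ ⋃ e ∈ S', translate (-e.1, 0) e.2
  refine (Set.Finite.image2 Φ (hA.insert W)
    ((hA.prod T.finite_toSet).finite_subsets)).subset ?_
  rintro R ⟨hlive, S, q, h, rfl⟩
  refine ⟨min q W, ?_, (fun e : ℝ × Set (ℝ × ℝ) => (q - e.1, e.2)) '' {e ∈ S | q - e.1 ≤ 2 * W},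
    ?_, ?_⟩
  · rcases le_total q W with hq | hq
    · rw [min_eq_left hq]
      exact Set.mem_insert_of_mem _ ⟨h.mem_closure hT hIfin hI, by linarith⟩
    · rw [min_eq_right hq]
      exact Set.mem_insert _ _
  · rintro _ ⟨e, ⟨he, hle⟩, rfl⟩
    exact ⟨⟨h.start_mem_closure hT hIfin hI he, hle⟩, (h.mem e he).1⟩
  · have key : ∀ (p : ℝ × ℝ) (x : ℝ), p - (-(q - x), 0) = (p.1 + q - x, p.2) := fun p x => by
      ext
      · simp; ring
      · simp
    ext p
    simp only [Φ, Set.mem_sdiff, mem_halfStrip, Set.mem_iUnion, Set.mem_image, mem_translate,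
      not_exists]
    constructor
    · rintro ⟨⟨h1, h2⟩, h3⟩
      have h1' := neg_le.mp h1
      refine mem_configRegion.mpr ⟨⟨by linarith [min_le_left q W], h2⟩, fun e he hm => ?_⟩
      by_cases hle : q - e.1 ≤ 2 * W
      · refine h3 _ ⟨e, ⟨he, hle⟩, rfl⟩ ?_
        rw [key]
        exact hm
      · have := hW _ (h.mem e he).1 _ hm
        simp only at this
        linarith [min_le_right q W]
    · intro hp
      have h1 := hlive p hp
      obtain ⟨⟨h2, h3⟩, h4⟩ := mem_configRegion.mp hp
      refine ⟨⟨?_, h3⟩, ?_⟩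
      · rw [neg_le]
        exact le_min (by linarith) (by linarith)
      · rintro _ ⟨e, ⟨he, -⟩, rfl⟩ hm
        simp only [key] at hm
        exact h4 e he hm

/-- Partition counts of half-open rectangles are diagonals. -/
theorem mem_diagonals_of_remCount {W : ℝ} (hW0 : 0 ≤ W)
    (hW : ∀ τ ∈ T, ∀ p ∈ τ, -W ≤ p.1 ∧ p.1 ≤ W) {ε : ℝ} (hε : 0 ≤ ε) {f : ℕ → ℕ}
    (hf : ∀ n : ℕ, remCount T (halfStrip 0) (n + ε) = f n) : f ∈ diagonals := by
  refine mem_diagonals_of_finite_shapes T hT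
    (finite_liveShapes hT hIfin hI hW0 fun τ hτ p hp => (hW τ hτ p hp).2) ?_ ?_ ?_ hε hf
  · refine ⟨fun p hp => ?_, ∅, 0, isConfig_empty T, configRegion_empty.symm⟩
    linarith [(mem_halfStrip.mp hp).1]
  · rintro R ⟨-, S, q, h, rfl⟩
    exact h.isAnchored
  · rintro R ⟨-, S, q, h, rfl⟩ τ hτ hsub
    obtain ⟨r, hr, h', heq⟩ := h.step hT hIfin hI hτ hsub
    by_cases hlive : ∀ p ∈ configRegion (insert (q, τ) S) (q + r), -W ≤ p.1
    · left
      refine ⟨r, hr, ?_⟩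
      rw [heq]
      exact ⟨hlive, _, _, h', rfl⟩
    · right
      intro ℓ
      push Not at hlive
      obtain ⟨p, hp, hpW⟩ := hlive
      have h1 := remCount_translate T (configRegion S q \ τ) (-r) ℓ
      rw [← h1, heq]
      exact remCount_eq_zero_of_lt (by simpa using hT) (fun τ hτ p hp => (hW τ hτ p hp).1)
        h'.isAnchored.2 hp (by simpa using hpW) hW0 _

end Shapes

/-! ### Closed regions and their half-open counterparts -/

/-- The points `p` such that `K` contains a small square with lower left corner `p`. -/
def germs (K : Set (ℝ × ℝ)) : Set (ℝ × ℝ) :=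
  {p | ∃ η > 0, Set.Ico p.1 (p.1 + η) ×ˢ Set.Ico p.2 (p.2 + η) ⊆ K}

/-- The half-open box with the given lower left and upper right corners. -/
def halfOpenBox (b : (ℝ × ℝ) × (ℝ × ℝ)) : Set (ℝ × ℝ) :=
  Set.Ico b.1.1 b.2.1 ×ˢ Set.Ico b.1.2 b.2.2

theorem mem_halfOpenBox {b : (ℝ × ℝ) × (ℝ × ℝ)} {p : ℝ × ℝ} :
    p ∈ halfOpenBox b ↔ (b.1.1 ≤ p.1 ∧ p.1 < b.2.1) ∧ b.1.2 ≤ p.2 ∧ p.2 < b.2.2 := Iff.rfl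

theorem germs_subset (K : Set (ℝ × ℝ)) : germs K ⊆ K := by
  rintro p ⟨η, hη, h⟩
  exact h ⟨by simp [hη], by simp [hη]⟩

@[simp] theorem germs_empty : germs ∅ = ∅ := Set.subset_empty_iff.mp (germs_subset ∅)

theorem germs_translate (v : ℝ × ℝ) (K : Set (ℝ × ℝ)) :
    germs (translate v K) = translate v (germs K) := by
  ext p
  rw [mem_translate]
  simp only [germs, Set.mem_ofPred_eq]
  refine exists_congr fun η => and_congr_right fun _ => ?_
  constructor
  · intro h q hq
    have : q + v ∈ translate v K := h (by
      obtain ⟨⟨h1, h2⟩, h3, h4⟩ := hq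
      simp only [Prod.fst_sub, Prod.snd_sub] at h1 h2 h3 h4
      refine ⟨⟨?_, ?_⟩, ?_, ?_⟩ <;> simp only [Prod.fst_add, Prod.snd_add] <;> linarith)
    rw [mem_translate] at this
    simpa using this
  · intro h q hq
    rw [mem_translate]
    apply h
    obtain ⟨⟨h1, h2⟩, h3, h4⟩ := hq
    refine ⟨⟨?_, ?_⟩, ?_, ?_⟩ <;> simp only [Prod.fst_sub, Prod.snd_sub] <;> linarith

theorem interior_subset_germs (K : Set (ℝ × ℝ)) : interior K ⊆ germs K := by
  intro p hp
  obtain ⟨η, hη, h⟩ := Metric.isOpen_iff.mp isOpen_interior p hp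
  refine ⟨η, hη, fun q hq => interior_subset (h ?_)⟩
  obtain ⟨⟨h1, h2⟩, h3, h4⟩ := hq
  rw [Metric.mem_ball, Prod.dist_eq, Real.dist_eq, Real.dist_eq]
  exact max_lt (abs_lt.mpr ⟨by linarith, by linarith⟩) (abs_lt.mpr ⟨by linarith, by linarith⟩)

/-- At a common germ point both sets contain a small square with that corner, and the centre of the
smaller square is interior to both. -/
theorem disjoint_germs_iff {K L : Set (ℝ × ℝ)} :
    Disjoint (germs K) (germs L) ↔ Disjoint (interior K) (interior L) := by
  refine ⟨fun h => h.mono (interior_subset_germs K) (interior_subset_germs L), fun h => ?_⟩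
  refine Set.disjoint_left.mpr ?_
  rintro p ⟨η, hη, hK⟩ ⟨η', hη', hL⟩
  have key : ∀ (M : Set (ℝ × ℝ)) (δ : ℝ), min η η' ≤ δ →
      Set.Ico p.1 (p.1 + δ) ×ˢ Set.Ico p.2 (p.2 + δ) ⊆ M →
      (p.1 + min η η' / 2, p.2 + min η η' / 2) ∈ interior M := by
    intro M δ hδ hM
    have hopen : IsOpen (Set.Ioo p.1 (p.1 + δ) ×ˢ Set.Ioo p.2 (p.2 + δ)) := isOpen_Ioo.prod isOpen_Ioo
    refine mem_interior.mpr ⟨_, (Set.prod_mono Set.Ioo_subset_Ico_self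
      Set.Ioo_subset_Ico_self).trans hM, hopen, ?_⟩
    have := lt_min hη hη'
    exact ⟨⟨by simp only; linarith, by simp only; linarith⟩,
      by simp only; linarith, by simp only; linarith⟩
  exact Set.disjoint_left.mp h (key K η (min_le_left _ _) hK) (key L η' (min_le_right _ _) hL)

/-- If `p` lies in no half-open box, the points `p + (t, t)` leave each closed box for all small `t
> 0`. Finitely many boxes are left simultaneously, so no square at `p` is covered. -/
theorem germs_biUnion_Icc {s : Set ((ℝ × ℝ) × (ℝ × ℝ))} (hs : s.Finite) :
    germs (⋃ b ∈ s, Set.Icc b.1 b.2) = ⋃ b ∈ s, halfOpenBox b := by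
  ext p
  simp only [Set.mem_iUnion, exists_prop]
  constructor
  · rintro ⟨η, hη, h⟩
    by_contra! hp
    have h1 : ∀ b ∈ s, ∀ᶠ t in nhdsWithin (0 : ℝ) (Set.Ioi 0),
        (p.1 + t, p.2 + t) ∉ Set.Icc b.1 b.2 := by
      intro b hb
      have hsmall : ∀ a > (0 : ℝ), ∀ᶠ t in nhdsWithin (0 : ℝ) (Set.Ioi 0), t < a := fun a ha =>
        eventually_nhdsWithin_of_eventually_nhds (eventually_lt_nhds ha)
      have hpb := hp b hb
      rw [mem_halfOpenBox] at hpb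
      simp only [Set.mem_Icc, Prod.le_def]
      by_cases c1 : b.1.1 ≤ p.1
      · by_cases c2 : p.1 < b.2.1
        · by_cases c3 : b.1.2 ≤ p.2
          · have c4 : b.2.2 ≤ p.2 := by
              by_contra! hlt
              exact hpb ⟨⟨c1, c2⟩, c3, hlt⟩
            filter_upwards [self_mem_nhdsWithin] with t (ht : 0 < t) hc
            linarith [hc.2.2]
          · filter_upwards [hsmall (b.1.2 - p.2) (by linarith)] with t ht hc
            linarith [hc.1.2]
        · filter_upwards [self_mem_nhdsWithin] with t (ht : 0 < t) hc
          linarith [hc.2.1]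
      · filter_upwards [hsmall (b.1.1 - p.1) (by linarith)] with t ht hc
        linarith [hc.1.1]
    have h2 := (Filter.eventually_all_finite hs).mpr h1
    have h3 : ∀ᶠ t in nhdsWithin (0 : ℝ) (Set.Ioi 0), t < η :=
      eventually_nhdsWithin_of_eventually_nhds (eventually_lt_nhds hη)
    obtain ⟨t, ⟨ht2, ht3⟩, ht0⟩ := ((h2.and h3).and self_mem_nhdsWithin).exists
    have ht0' : (0 : ℝ) < t := ht0
    have : (p.1 + t, p.2 + t) ∈ ⋃ b ∈ s, Set.Icc b.1 b.2 :=
      h ⟨⟨by simp only; linarith, by simp only; linarith⟩,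
        by simp only; linarith, by simp only; linarith⟩
    simp only [Set.mem_iUnion, exists_prop] at this
    obtain ⟨b, hb, hm⟩ := this
    exact ht2 b hb hm
  · rintro ⟨b, hb, ⟨h1, h2⟩, h3, h4⟩
    refine ⟨min (b.2.1 - p.1) (b.2.2 - p.2), lt_min (by linarith) (by linarith), ?_⟩
    rintro q ⟨⟨h5, h6⟩, h7, h8⟩
    have := min_le_left (b.2.1 - p.1) (b.2.2 - p.2)
    have := min_le_right (b.2.1 - p.1) (b.2.2 - p.2)
    simp only [Set.mem_iUnion]
    exact ⟨b, hb, ⟨by linarith, by linarith⟩, by linarith, by linarith⟩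

theorem closure_biUnion_halfOpenBox {s : Set ((ℝ × ℝ) × (ℝ × ℝ))} (hs : s.Finite)
    (hlt : ∀ b ∈ s, b.1.1 < b.2.1 ∧ b.1.2 < b.2.2) :
    closure (⋃ b ∈ s, halfOpenBox b) = ⋃ b ∈ s, Set.Icc b.1 b.2 := by
  rw [hs.closure_biUnion]
  refine Set.iUnion₂_congr fun b hb => ?_
  rw [halfOpenBox, closure_prod_eq, closure_Ico (hlt b hb).1.ne, closure_Ico (hlt b hb).2.ne,
    Set.Icc_prod_Icc]

/-- Closure undoes `germs` on regions; this makes the passage to half-open tiles reversible. -/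
theorem IsAxisParallelRegion.closure_germs {K : Set (ℝ × ℝ)} (h : IsAxisParallelRegion K) :
    closure (germs K) = K := by
  obtain ⟨s, hs, rfl⟩ := h
  have := germs_biUnion_Icc s.finite_toSet
  have h2 := closure_biUnion_halfOpenBox s.finite_toSet hs
  simp only [Finset.mem_coe] at this h2
  rw [this, h2]

theorem IsAxisParallelRegion.translate {K : Set (ℝ × ℝ)} (h : IsAxisParallelRegion K)
    (v : ℝ × ℝ) : IsAxisParallelRegion (translate v K) := by
  classical
  obtain ⟨s, hs, rfl⟩ := h
  refine ⟨s.image fun b => (v + b.1, v + b.2), ?_, ?_⟩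
  · intro b hb
    obtain ⟨b', hb', rfl⟩ := Finset.mem_image.mp hb
    simpa using hs b' hb'
  · simp only [Finset.mem_image, Set.iUnion_exists, Set.biUnion_and', Set.iUnion_iUnion_eq_right,
      IrrationalTiling.translate, Set.image_iUnion, Set.image_const_add_Icc]

theorem germs_sUnion {P : Set (Set (ℝ × ℝ))} (hP : P.Finite)
    (h : ∀ K ∈ P, IsAxisParallelRegion K) : germs (⋃₀ P) = ⋃ K ∈ P, germs K := by
  choose! s hs hK using h
  have hfin : (⋃ K ∈ P, (s K : Set ((ℝ × ℝ) × (ℝ × ℝ)))).Finite :=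
    hP.biUnion fun K _ => (s K).finite_toSet
  have h1 : ⋃₀ P = ⋃ b ∈ ⋃ K ∈ P, (s K : Set ((ℝ × ℝ) × (ℝ × ℝ))), Set.Icc b.1 b.2 := by
    rw [Set.sUnion_eq_biUnion, Set.biUnion_iUnion]
    refine Set.iUnion_congr fun K => ?_
    rw [Set.biUnion_iUnion]
    exact Set.iUnion_congr fun hKP => by simpa using hK K hKP
  rw [h1, germs_biUnion_Icc hfin, Set.biUnion_iUnion]
  refine Set.iUnion_congr fun K => ?_
  rw [Set.biUnion_iUnion]
  refine Set.iUnion_congr fun hKP => ?_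
  rw [← germs_biUnion_Icc (s K).finite_toSet]
  congr 1
  simpa using (hK K hKP).symm

theorem translate_eq_preimage (v : ℝ × ℝ) (K : Set (ℝ × ℝ)) :
    translate v K = (fun p => -v + p) ⁻¹' K := by
  ext p
  rw [mem_translate, Set.mem_preimage, sub_eq_neg_add]

theorem translate_interior (v : ℝ × ℝ) (K : Set (ℝ × ℝ)) :
    interior (translate v K) = translate v (interior K) :=
  ((Homeomorph.addLeft v).image_interior K).symm

theorem translate_closure (v : ℝ × ℝ) (K : Set (ℝ × ℝ)) :
    closure (translate v K) = translate v (closure K) :=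
  ((Homeomorph.addLeft v).image_closure K).symm

/-- Only finitely many nonoverlapping translates of tiles fit into a bounded region. -/
theorem finite_of_nonoverlapping {T P : Set (Set (ℝ × ℝ))} (hT : T.Finite)
    (hint : ∀ τ ∈ T, (interior τ).Nonempty)
    (hpieces : ∀ K ∈ P, ∃ τ ∈ T, ∃ v : ℝ × ℝ, K = translate v τ)
    (hdisj : ∀ K ∈ P, ∀ L ∈ P, K ≠ L → Disjoint (interior K) (interior L))
    {B : Set (ℝ × ℝ)} (hB : Bornology.IsBounded B) (hsub : ∀ K ∈ P, interior K ⊆ B) :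
    P.Finite := by
  have hcov : P ⊆ ⋃ τ ∈ T, {K ∈ P | ∃ v, K = translate v τ} := by
    intro K hK
    obtain ⟨τ, hτ, v, hv⟩ := hpieces K hK
    simp only [Set.mem_iUnion]
    exact ⟨τ, hτ, hK, v, hv⟩
  refine (hT.biUnion fun τ hτ => ?_).subset hcov
  have hpos : 0 < MeasureTheory.volume (interior τ) :=
    isOpen_interior.measure_pos _ (hint τ hτ)
  have := MeasureTheory.Measure.finite_const_le_meas_of_disjoint_iUnion
    (MeasureTheory.volume : MeasureTheory.Measure (ℝ × ℝ)) hpos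
    (As := fun K : {K ∈ P | ∃ v, K = translate v τ} => interior (K : Set (ℝ × ℝ)))
    (fun K => isOpen_interior.measurableSet)
    (fun K L hne => hdisj K K.2.1 L L.2.1 fun h => hne (Subtype.ext h))
    (ne_top_of_le_ne_top hB.measure_lt_top.ne
      (MeasureTheory.measure_mono (Set.iUnion_subset fun K => hsub K K.2.1)))
  -- All translates of one tile have the same positive interior measure, and a set of finite measure
  -- holds only finitely many disjoint ones.
  have huniv : {K : {K ∈ P | ∃ v, K = translate v τ} | MeasureTheory.volume (interior τ) ≤
      MeasureTheory.volume (interior (K : Set (ℝ × ℝ)))} = Set.univ := by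
    refine Set.eq_univ_of_forall ?_
    rintro ⟨K, hK, v, rfl⟩
    simp only [Set.mem_ofPred_eq]
    rw [translate_interior, translate_eq_preimage, MeasureTheory.measure_preimage_add]
  rw [huniv] at this
  exact Set.finite_coe_iff.mp (Set.finite_univ_iff.mp this)

theorem rectangle_subset (L : ℝ) : rectangle L ⊆ Set.Icc 0 L ×ˢ Set.Icc 0 1 := by
  unfold rectangle
  split_ifs
  · exact subset_rfl
  · exact Set.empty_subset _

theorem germs_rectangle (L : ℝ) : germs (rectangle L) = halfStrip 0 \ halfStrip L := by
  have hdiff : halfStrip 0 \ halfStrip L = halfOpenBox ((0, 0), (L, 1)) := by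
    ext p
    simp only [Set.mem_sdiff, mem_halfStrip, mem_halfOpenBox]
    constructor
    · rintro ⟨⟨h1, h2⟩, h3⟩
      refine ⟨⟨h1, ?_⟩, h2⟩
      by_contra! h
      exact h3 ⟨h, h2⟩
    · rintro ⟨⟨h1, h2⟩, h3⟩
      exact ⟨⟨h1, h3⟩, fun h => by linarith [h.1]⟩
  rw [hdiff]
  unfold rectangle
  split_ifs with hL
  · have := germs_biUnion_Icc (Set.finite_singleton (((0 : ℝ), (0 : ℝ)), (L, (1 : ℝ))))
    simpa [Set.Icc_prod_Icc] using this
  · rw [germs_empty, halfOpenBox]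
    simp [Set.Ico_eq_empty (show ¬ (0 : ℝ) < L from hL)]

theorem closure_germs_rectangle (L : ℝ) : closure (germs (rectangle L)) = rectangle L := by
  by_cases hL : 0 < L
  · refine IsAxisParallelRegion.closure_germs ⟨{((0, 0), (L, 1))}, by simpa using hL, ?_⟩
    simp [rectangle, hL, Set.Icc_prod_Icc]
  · simp [rectangle, hL]

theorem IsAxisParallelRegion.interior_nonempty {K : Set (ℝ × ℝ)} (h : IsAxisParallelRegion K)
    (hne : K.Nonempty) : (interior K).Nonempty := by
  obtain ⟨s, hs, rfl⟩ := h
  obtain ⟨p, hp⟩ := hne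
  simp only [Set.mem_iUnion] at hp
  obtain ⟨b, hb, -⟩ := hp
  have hopen : IsOpen (Set.Ioo b.1.1 b.2.1 ×ˢ Set.Ioo b.1.2 b.2.2) := isOpen_Ioo.prod isOpen_Ioo
  obtain ⟨x, hx⟩ := Set.nonempty_Ioo.mpr (hs b hb).1
  obtain ⟨y, hy⟩ := Set.nonempty_Ioo.mpr (hs b hb).2
  refine ⟨(x, y), mem_interior.mpr ⟨_, ?_, hopen, hx, hy⟩⟩
  intro q hq
  simp only [Set.mem_iUnion]
  exact ⟨b, hb, ⟨hq.1.1.le, hq.2.1.le⟩, hq.1.2.le, hq.2.2.le⟩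

/-- Tilings of a rectangle by closed tall regions correspond to exact partitions of the half-open
rectangle into horizontal translates of normalized half-open regions. -/
theorem encard_isTiling_eq_remCount {T : Set (Set (ℝ × ℝ))} (hT : T.Finite)
    (hreg : ∀ τ ∈ T, IsAxisParallelRegion τ) (v : Set (ℝ × ℝ) → ℝ × ℝ)
    (htall : ∀ τ ∈ T, Prod.snd '' τ = Set.Icc (-(v τ).2) (-(v τ).2 + 1)) {L : ℝ} (hL : 0 ≤ L) :
    {P | IsTiling T (rectangle L) P}.encard =
      remCount ((fun τ => translate (v τ) (germs τ)) '' T) (halfStrip 0) L := by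
  have hne : ∀ τ ∈ T, τ.Nonempty := fun τ hτ => by
    have : (Prod.snd '' τ).Nonempty := by
      rw [htall τ hτ]
      exact Set.nonempty_Icc.mpr (by linarith)
    exact this.of_image
  have hrem : remCount ((fun τ => translate (v τ) (germs τ)) '' T) (halfStrip 0) L =
      partitionCount ((fun τ => translate (v τ) (germs τ)) '' T) (halfStrip 0 \ halfStrip L) := by
    rw [remCount, if_pos]
    exact fun p hp => ⟨hL.trans (mem_halfStrip.mp hp).1, hp.2⟩
  rw [hrem, partitionCount]
  have hB : Bornology.IsBounded (Set.Icc (0 : ℝ) L ×ˢ Set.Icc (0 : ℝ) 1) :=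
    (Metric.isBounded_Icc 0 L).prod (Metric.isBounded_Icc 0 1)
  have hregion : ∀ {P : Set (Set (ℝ × ℝ))}, (∀ K ∈ P, ∃ τ ∈ T, ∃ v : ℝ × ℝ, K = translate v τ) →
      ∀ K ∈ P, IsAxisParallelRegion K := by
    intro P hP K hK
    obtain ⟨τ, hτ, u, rfl⟩ := hP K hK
    exact (hreg τ hτ).translate u
  -- Taking germs of all pieces sends tilings to partitions, with closure as inverse. Both
  -- directions need finiteness of the family, since neither operation is compatible with infinite
  -- unions.
  have himage : {P | IsPartition ((fun τ => translate (v τ) (germs τ)) '' T)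
      (halfStrip 0 \ halfStrip L) P} =
      (fun P => germs '' P) '' {P | IsTiling T (rectangle L) P} := by
    ext P'
    simp only [Set.mem_ofPred_eq, Set.mem_image]
    constructor
    · intro hP'
      have hpc : ∀ K' ∈ P', ∃ τ ∈ T, ∃ u, K' = germs (translate u τ) ∧
          closure K' = translate u τ := by
        intro K' hK'
        obtain ⟨_, ⟨τ, hτ, rfl⟩, x, rfl⟩ := hP'.pieces K' hK'
        refine ⟨τ, hτ, (x, 0) + v τ, ?_, ?_⟩
        · rw [germs_translate, translate_translate]
        · rw [translate_translate, translate_closure, (hreg τ hτ).closure_germs]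
      have hgc : ∀ K' ∈ P', germs (closure K') = K' := fun K' hK' => by
        obtain ⟨τ, _, u, h1, h2⟩ := hpc K' hK'
        rw [h2, h1]
      have hback : germs '' (closure '' P') = P' := by
        rw [Set.image_image]
        ext K
        constructor
        · rintro ⟨K', hK', rfl⟩
          simp only [hgc K' hK', hK']
        · exact fun hK => ⟨K, hK, hgc K hK⟩
      have hpieces : ∀ K ∈ closure '' P', ∃ τ ∈ T, ∃ v : ℝ × ℝ, K = translate v τ := by
        rintro _ ⟨K', hK', rfl⟩
        obtain ⟨τ, hτ, u, -, h2⟩ := hpc K' hK'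
        exact ⟨τ, hτ, u, h2⟩
      have hdisj : ∀ K ∈ closure '' P', ∀ L ∈ closure '' P', K ≠ L →
          Disjoint (interior K) (interior L) := by
        rintro _ ⟨K', hK', rfl⟩ _ ⟨L', hL', rfl⟩ hne
        rw [← disjoint_germs_iff, hgc K' hK', hgc L' hL']
        exact hP'.disjoint hK' hL' fun h => hne (by rw [h])
      have hfin : (closure '' P').Finite := by
        refine finite_of_nonoverlapping hT (fun τ hτ => (hreg τ hτ).interior_nonempty (hne τ hτ))
          hpieces hdisj hB ?_
        rintro _ ⟨K', hK', rfl⟩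
        refine (interior_subset_germs _).trans ?_
        rw [hgc K' hK']
        refine (Set.subset_sUnion_of_mem hK').trans ?_
        rw [hP'.covers, ← germs_rectangle]
        exact (germs_subset _).trans (rectangle_subset L)
      refine ⟨closure '' P', ⟨hpieces, hdisj, ?_⟩, hback⟩
      have hP'fin : P'.Finite := hback ▸ hfin.image _
      rw [Set.sUnion_image, ← hP'fin.closure_biUnion, ← Set.sUnion_eq_biUnion, hP'.covers,
        ← germs_rectangle, closure_germs_rectangle]
    · rintro ⟨P, hP, rfl⟩
      have hsub : ∀ K ∈ P, K ⊆ Set.Icc 0 L ×ˢ Set.Icc 0 1 := fun K hK =>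
        (Set.subset_sUnion_of_mem hK).trans (hP.covers ▸ rectangle_subset L)
      have hfin : P.Finite :=
        finite_of_nonoverlapping hT (fun τ hτ => (hreg τ hτ).interior_nonempty (hne τ hτ))
          hP.pieces hP.nonoverlapping hB fun K hK => interior_subset.trans (hsub K hK)
      refine ⟨?_, ?_, ?_⟩
      · rintro _ ⟨K, hK, rfl⟩
        obtain ⟨τ, hτ, u, rfl⟩ := hP.pieces K hK
        -- A piece of height `1` inside a strip of height `1` has a determined vertical position, so
        -- only horizontal translations remain.
        have hu : u.2 = (v τ).2 := by
          have key : ∀ y ∈ Set.Icc (-(v τ).2) (-(v τ).2 + 1), y + u.2 ∈ Set.Icc (0 : ℝ) 1 := by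
            intro y hy
            rw [← htall τ hτ] at hy
            obtain ⟨p, hp, rfl⟩ := hy
            have := (hsub _ hK (show u + p ∈ translate u τ from ⟨p, hp, rfl⟩)).2
            simpa [add_comm] using this
          have h1 := (key (-(v τ).2) ⟨le_rfl, by linarith⟩).1
          have h2 := (key (-(v τ).2 + 1) ⟨by linarith, le_rfl⟩).2
          linarith
        refine ⟨_, ⟨τ, hτ, rfl⟩, u.1 - (v τ).1, ?_⟩
        rw [germs_translate, translate_translate]
        congr 1
        ext
        · simp
        · simp [hu]
      · rintro _ ⟨K, hK, rfl⟩ _ ⟨K', hK', rfl⟩ hne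
        exact disjoint_germs_iff.mpr (hP.nonoverlapping K hK K' hK' fun h => hne (by rw [h]))
      · rw [Set.sUnion_image, ← germs_sUnion hfin (hregion hP.pieces), hP.covers,
          germs_rectangle]
  rw [himage, Set.InjOn.encard_image]
  intro P hP P' hP' heq
  have hinv : ∀ {P}, IsTiling T (rectangle L) P → closure '' (germs '' P) = P := by
    intro P hP
    rw [Set.image_image]
    ext K
    constructor
    · rintro ⟨K', hK', rfl⟩
      simp only [(hregion hP.pieces K' hK').closure_germs, hK']
    · exact fun hK => ⟨K, hK, (hregion hP.pieces K hK).closure_germs⟩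
  simp only at heq
  rw [← hinv hP, heq, hinv hP']

/-- A tall region has a normalized half-open version. -/
theorem IsAxisParallelRegion.exists_normalization {K : Set (ℝ × ℝ)} (h : IsAxisParallelRegion K)
    (htall : IsTall K) : ∃ v : ℝ × ℝ, Prod.snd '' K = Set.Icc (-v.2) (-v.2 + 1) ∧
      IsAnchored (IrrationalTiling.translate v (germs K)) ∧
      (∃ W, ∀ p ∈ IrrationalTiling.translate v (germs K), -W ≤ p.1 ∧ p.1 ≤ W) ∧
      ∃ I : Set (ℝ × ℝ), I.Finite ∧ ∀ x, (x, 0) ∈ IrrationalTiling.translate v (germs K) ↔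
        ∃ i ∈ I, i.1 ≤ x ∧ x < i.2 := by
  obtain ⟨c, hc⟩ := htall
  obtain ⟨s, hs, rfl⟩ := h
  have hg := germs_biUnion_Icc s.finite_toSet
  simp only [Finset.mem_coe] at hg
  have hlow : ∀ b ∈ s, c ≤ b.1.2 := by
    intro b hb
    have : b.1.2 ∈ Prod.snd '' ⋃ b ∈ s, Set.Icc b.1 b.2 := by
      refine ⟨b.1, ?_, rfl⟩
      simp only [Set.mem_iUnion]
      exact ⟨b, hb, le_rfl, (hs b hb).1.le, (hs b hb).2.le⟩
    rw [hc] at this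
    exact this.1
  obtain ⟨b0, hb0, hb0c⟩ : ∃ b ∈ s, b.1.2 = c := by
    have : c ∈ Prod.snd '' ⋃ b ∈ s, Set.Icc b.1 b.2 := by
      rw [hc]
      exact ⟨le_rfl, by linarith⟩
    obtain ⟨p, hp, hpc⟩ := this
    simp only [Set.mem_iUnion] at hp
    obtain ⟨b, hb, hpb⟩ := hp
    exact ⟨b, hb, le_antisymm (hpc ▸ hpb.1.2) (hlow b hb)⟩
  -- The lower left corner of the leftmost box resting on the bottom line becomes the origin.
  obtain ⟨b1, hb1, hmin⟩ := Set.exists_min_image {b | b ∈ s ∧ b.1.2 = c} (fun b => b.1.1)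
    (s.finite_toSet.subset fun b hb => hb.1) ⟨b0, hb0, hb0c⟩
  have hmem : ∀ x : ℝ, ((x, 0) : ℝ × ℝ) ∈ IrrationalTiling.translate (-b1.1.1, -c)
      (germs (⋃ b ∈ s, Set.Icc b.1 b.2)) ↔
      ∃ b ∈ s, b.1.2 = c ∧ b.1.1 ≤ x + b1.1.1 ∧ x + b1.1.1 < b.2.1 := by
    intro x
    rw [IrrationalTiling.mem_translate, hg]
    simp only [Set.mem_iUnion, mem_halfOpenBox, exists_prop, Prod.mk_sub_mk, sub_neg_eq_add,
      zero_add]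
    refine exists_congr fun b => and_congr_right fun hb => ?_
    constructor
    · rintro ⟨h1, h2, h3⟩
      exact ⟨le_antisymm h2 (hlow b hb), h1⟩
    · rintro ⟨h1, h2⟩
      exact ⟨h2, h1.le, h1 ▸ (hs b hb).2⟩
  refine ⟨(-b1.1.1, -c), by simpa using hc, ⟨?_, ?_⟩, ?_, ?_⟩
  · exact (hmem 0).mpr ⟨b1, hb1.1, hb1.2, by simp, by simpa using (hs b1 hb1.1).1⟩
  · intro x hx
    obtain ⟨b, hb, hbc, h1, _⟩ := (hmem x).mp hx
    have := hmin b ⟨hb, hbc⟩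
    linarith
  · refine ⟨∑ b ∈ s, (|b.1.1| + |b.2.1|) + |b1.1.1|, fun p hp => ?_⟩
    rw [IrrationalTiling.mem_translate, hg] at hp
    simp only [Set.mem_iUnion, mem_halfOpenBox, exists_prop, Prod.fst_sub, sub_neg_eq_add] at hp
    obtain ⟨b, hb, ⟨h1, h2⟩, -⟩ := hp
    have h3 := Finset.single_le_sum (f := fun b : (ℝ × ℝ) × (ℝ × ℝ) => |b.1.1| + |b.2.1|)
      (fun b _ => by positivity) hb
    have := abs_le.mp (le_refl |b1.1.1|)
    have := abs_le.mp (le_refl |b.1.1|)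
    have := abs_le.mp (le_refl |b.2.1|)
    have := abs_nonneg b.1.1
    have := abs_nonneg b.2.1
    constructor <;> linarith
  · refine ⟨(fun b : (ℝ × ℝ) × (ℝ × ℝ) => (b.1.1 - b1.1.1, b.2.1 - b1.1.1)) ''
      {b | b ∈ s ∧ b.1.2 = c}, (s.finite_toSet.subset fun b hb => hb.1).image _, fun x => ?_⟩
    rw [hmem]
    constructor
    · rintro ⟨b, hb, hbc, h1, h2⟩
      exact ⟨_, ⟨b, ⟨hb, hbc⟩, rfl⟩, by simp only; linarith, by simp only; linarith⟩
    · rintro ⟨_, ⟨b, ⟨hb, hbc⟩, rfl⟩, h1, h2⟩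
      exact ⟨b, hb, hbc, by linarith, by linarith⟩

theorem tileCountingFunctions_subset_diagonals : tileCountingFunctions ⊆ diagonals := by
  classical
  rintro f ⟨T, ε, hT, htile, hε, hf⟩
  have hnorm : ∀ τ ∈ T, _ := fun τ hτ =>
    (htile τ hτ).1.region.exists_normalization (htile τ hτ).2
  choose! v hv hanch hW hI using hnorm
  set F : Set (ℝ × ℝ) → Set (ℝ × ℝ) := fun τ => translate (v τ) (germs τ) with hF
  choose! W hW using hW
  choose! I hIfin hI using hI
  let T' : Finset (Set (ℝ × ℝ)) := (hT.image F).toFinset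
  have hT' : ∀ τ' ∈ T', ∃ τ ∈ T, F τ = τ' := fun τ' h => by simpa [T'] using h
  -- Different closed tiles may have the same normalization, so one representative is chosen for
  -- each half-open tile.
  choose! pre hpre hpreF using hT'
  refine mem_diagonals_of_remCount (T := T') (I := fun τ' => I (pre τ'))
    (W := ∑ τ' ∈ T', |W (pre τ')|) ?_ ?_ ?_ ?_ ?_ hε (f := f) ?_
  · intro τ' hτ'
    have := hanch _ (hpre τ' hτ')
    rwa [← hpreF τ' hτ']
  · exact fun τ' hτ' => hIfin _ (hpre τ' hτ')
  · intro τ' hτ' x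
    have := hI _ (hpre τ' hτ') x
    rw [← this]
    nth_rewrite 1 [← hpreF τ' hτ']
    rfl
  · exact Finset.sum_nonneg fun _ _ => abs_nonneg _
  · intro τ' hτ' p hp
    have h1 := hW _ (hpre τ' hτ') p (by rw [← hpreF τ' hτ'] at hp; exact hp)
    have h2 := Finset.single_le_sum (f := fun τ' => |W (pre τ')|) (fun _ _ => abs_nonneg _) hτ'
    have h3 := le_abs_self (W (pre τ'))
    constructor <;> linarith
  · intro n
    rw [← hf n, encard_isTiling_eq_remCount hT (fun τ hτ => (htile τ hτ).1.region) v hv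
      (by positivity)]
    simp [T', hF]

open scoped ENNReal

/-! ### Sums of natural numbers as extended nonnegative reals -/

/-- In `ℝ≥0∞` the finite support required of a multisum becomes part of the value of the sum, so
sums can be rearranged freely. -/
theorem tsum_natCast_eq_iff {X : Type*} (t : X → ℕ) (N : ℕ) :
    ∑' x, (t x : ℝ≥0∞) = N ↔ (Function.support t).Finite ∧ ∑ᶠ x, t x = N := by
  have key : ∀ hfin : (Function.support t).Finite,
      ∑' x, (t x : ℝ≥0∞) = ((∑ᶠ x, t x : ℕ) : ℝ≥0∞) := by
    intro hfin
    rw [finsum_eq_sum_of_support_subset (s := hfin.toFinset) t (by simp), Nat.cast_sum]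
    exact tsum_eq_sum fun x hx => by simpa using hx
  constructor
  · intro h
    have hfin : (Function.support t).Finite := by
      have := ENNReal.finite_const_le_of_tsum_ne_top (a := fun x => (t x : ℝ≥0∞))
        (by rw [h]; simp) one_ne_zero
      refine this.subset fun x hx => ?_
      have : 1 ≤ t x := Nat.one_le_iff_ne_zero.mpr hx
      simpa using this
    refine ⟨hfin, ?_⟩
    rw [key hfin] at h
    exact_mod_cast h
  · rintro ⟨hfin, h⟩
    rw [key hfin, h]

theorem tsum_ite_eq_sum {X Y : Type*} (s : Finset Y) (e : Y → X) (he : Set.InjOn e s)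
    (cond : X → Prop) [DecidablePred cond] (hcond : ∀ x, cond x ↔ ∃ y ∈ s, e y = x)
    (h : X → ℝ≥0∞) : ∑' x, (if cond x then h x else 0) = ∑ y ∈ s, h (e y) := by
  classical
  rw [tsum_eq_sum (s := s.image e), Finset.sum_image he]
  · refine Finset.sum_congr rfl fun y hy => if_pos ((hcond _).mpr ⟨y, hy, rfl⟩)
  · intro x hx
    refine if_neg fun hc => hx ?_
    obtain ⟨y, hy, rfl⟩ := (hcond x).mp hc
    exact Finset.mem_image_of_mem e hy

/-! ### Affine functions on natural vectors and parametrized binomial multisums -/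

/-- Integer-valued affine functions with integer coefficients. -/
def IsAff {ι : Type} [Fintype ι] (φ : (ι → ℕ) → ℤ) : Prop :=
  ∃ (a : ι → ℤ) (c : ℤ), ∀ p, φ p = ∑ i, a i * p i + c

section IsAff

variable {ι κ : Type} [Fintype ι] [Fintype κ]

theorem isAff_const (c : ℤ) : IsAff fun _ : ι → ℕ => c := ⟨0, c, by simp⟩

theorem isAff_coord (i : ι) : IsAff fun p : ι → ℕ => (p i : ℤ) := by
  classical
  exact ⟨Pi.single i 1, 0, fun p => by simp [Pi.single_apply]⟩

theorem IsAff.add {φ ψ : (ι → ℕ) → ℤ} (hφ : IsAff φ) (hψ : IsAff ψ) :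
    IsAff fun p => φ p + ψ p := by
  obtain ⟨a, c, h⟩ := hφ
  obtain ⟨a', c', h'⟩ := hψ
  refine ⟨a + a', c + c', fun p => ?_⟩
  simp only [h, h', Pi.add_apply, add_mul, Finset.sum_add_distrib]
  ring

theorem IsAff.const_mul {φ : (ι → ℕ) → ℤ} (hφ : IsAff φ) (b : ℤ) : IsAff fun p => b * φ p := by
  obtain ⟨a, c, h⟩ := hφ
  refine ⟨fun i => b * a i, b * c, fun p => ?_⟩
  simp only [h, mul_add, Finset.mul_sum, mul_assoc]

theorem IsAff.sub {φ ψ : (ι → ℕ) → ℤ} (hφ : IsAff φ) (hψ : IsAff ψ) :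
    IsAff fun p => φ p - ψ p := by
  simpa [sub_eq_add_neg] using hφ.add (hψ.const_mul (-1))

theorem isAff_sum {X : Type*} (s : Finset X) (φ : X → (ι → ℕ) → ℤ) (h : ∀ x ∈ s, IsAff (φ x)) :
    IsAff fun p => ∑ x ∈ s, φ x p := by
  classical
  induction s using Finset.induction_on with
  | empty => simpa using isAff_const 0
  | insert x s hx ih =>
    simp only [Finset.sum_insert hx]
    exact (h x (Finset.mem_insert_self x s)).add (ih fun y hy => h y (Finset.mem_insert_of_mem hy))

theorem IsAff.reindex {φ : (ι → ℕ) → ℤ} (hφ : IsAff φ) (σ : ι → κ) :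
    IsAff fun p : κ → ℕ => φ (p ∘ σ) := by
  obtain ⟨a, c, h⟩ := hφ
  simp only [h]
  exact (isAff_sum _ _ fun i _ => (isAff_coord (σ i)).const_mul (a i)).add (isAff_const c)

end IsAff

/-- Functions of a natural vector given by a multisum of products of binomial coefficients of
affine functions, with summation over natural vectors. -/
def IsMultisum {ι : Type} [Fintype ι] (g : (ι → ℕ) → ℝ≥0∞) : Prop :=
  ∃ (ρ κ : Type) (_ : Fintype ρ) (_ : Fintype κ) (α β : ρ → (ι ⊕ κ → ℕ) → ℤ),
    (∀ i, IsAff (α i)) ∧ (∀ i, IsAff (β i)) ∧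
    ∀ p, g p = ∑' v : κ → ℕ, ∏ i, (binom (α i (Sum.elim p v)) (β i (Sum.elim p v)) : ℝ≥0∞)

section IsMultisum

variable {ι κ : Type} [Fintype ι] [Fintype κ]

theorem isMultisum_prod_binom {ρ : Type} [Fintype ρ] (α β : ρ → (ι → ℕ) → ℤ)
    (hα : ∀ i, IsAff (α i)) (hβ : ∀ i, IsAff (β i)) :
    IsMultisum fun p : ι → ℕ => ∏ i, (binom (α i p) (β i p) : ℝ≥0∞) := by
  refine ⟨ρ, Empty, inferInstance, inferInstance, fun i p => α i (p ∘ Sum.inl),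
    fun i p => β i (p ∘ Sum.inl), fun i => (hα i).reindex _, fun i => (hβ i).reindex _, fun p => ?_⟩
  rw [tsum_eq_single default]
  · simp
  · intro v hv
    exact absurd (Subsingleton.elim v default) hv

theorem isMultisum_binom {α β : (ι → ℕ) → ℤ} (hα : IsAff α) (hβ : IsAff β) :
    IsMultisum fun p : ι → ℕ => (binom (α p) (β p) : ℝ≥0∞) := by
  simpa using isMultisum_prod_binom (ρ := Unit) (fun _ => α) (fun _ => β) (fun _ => hα) fun _ => hβ

theorem IsMultisum.reindex {g : (ι → ℕ) → ℝ≥0∞} (hg : IsMultisum g) (σ : ι → κ) :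
    IsMultisum fun p : κ → ℕ => g (p ∘ σ) := by
  obtain ⟨ρ, μ, _, _, α, β, hα, hβ, h⟩ := hg
  refine ⟨ρ, μ, inferInstance, inferInstance, fun i p => α i (p ∘ Sum.map σ id),
    fun i p => β i (p ∘ Sum.map σ id), fun i => (hα i).reindex _, fun i => (hβ i).reindex _,
    fun p => ?_⟩
  simp only [h, Sum.elim_comp_map, Function.comp_id]

theorem IsMultisum.mul {g g' : (ι → ℕ) → ℝ≥0∞} (hg : IsMultisum g) (hg' : IsMultisum g') :
    IsMultisum fun p => g p * g' p := by
  obtain ⟨ρ, μ, _, _, α, β, hα, hβ, h⟩ := hg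
  obtain ⟨ρ', μ', _, _, α', β', hα', hβ', h'⟩ := hg'
  let l : ι ⊕ μ → ι ⊕ (μ ⊕ μ') := Sum.map id Sum.inl
  let r : ι ⊕ μ' → ι ⊕ (μ ⊕ μ') := Sum.map id Sum.inr
  refine ⟨ρ ⊕ ρ', μ ⊕ μ', inferInstance, inferInstance,
    Sum.elim (fun i p => α i (p ∘ l)) (fun i p => α' i (p ∘ r)),
    Sum.elim (fun i p => β i (p ∘ l)) (fun i p => β' i (p ∘ r)), ?_, ?_, fun p => ?_⟩
  · rintro (i | i)
    · exact (hα i).reindex l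
    · exact (hα' i).reindex r
  · rintro (i | i)
    · exact (hβ i).reindex l
    · exact (hβ' i).reindex r
  · beta_reduce
    rw [← (Equiv.sumArrowEquivProdArrow μ μ' ℕ).symm.tsum_eq, ENNReal.tsum_prod', h, h',
      ← ENNReal.tsum_mul_right]
    refine tsum_congr fun v => ?_
    rw [← ENNReal.tsum_mul_left]
    refine tsum_congr fun v' => ?_
    have hl : Sum.elim p ((Equiv.sumArrowEquivProdArrow μ μ' ℕ).symm (v, v')) ∘ l =
        Sum.elim p v := by ext (i | i) <;> rfl
    have hr : Sum.elim p ((Equiv.sumArrowEquivProdArrow μ μ' ℕ).symm (v, v')) ∘ r =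
        Sum.elim p v' := by ext (i | i) <;> rfl
    simp only [Fintype.prod_sum_type, Sum.elim_inl, Sum.elim_inr, hl, hr]

theorem IsMultisum.tsum {g : (ι ⊕ κ → ℕ) → ℝ≥0∞} (hg : IsMultisum g) :
    IsMultisum fun p : ι → ℕ => ∑' w : κ → ℕ, g (Sum.elim p w) := by
  obtain ⟨ρ, μ, _, _, α, β, hα, hβ, h⟩ := hg
  let l : (ι ⊕ κ) ⊕ μ → ι ⊕ (κ ⊕ μ) := Equiv.sumAssoc ι κ μ
  refine ⟨ρ, κ ⊕ μ, inferInstance, inferInstance, fun i p => α i (p ∘ l), fun i p => β i (p ∘ l),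
    fun i => (hα i).reindex l, fun i => (hβ i).reindex l, fun p => ?_⟩
  rw [← (Equiv.sumArrowEquivProdArrow κ μ ℕ).symm.tsum_eq, ENNReal.tsum_prod']
  refine tsum_congr fun w => ?_
  rw [h]
  refine tsum_congr fun v => ?_
  have hl : Sum.elim p ((Equiv.sumArrowEquivProdArrow κ μ ℕ).symm (w, v)) ∘ l =
      Sum.elim (Sum.elim p w) v := by ext ((i | i) | i) <;> rfl
  simp only [hl]

end IsMultisum

theorem binom_zero_left (x : ℤ) : binom 0 x = if x = 0 then 1 else 0 := by
  unfold binom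
  rcases lt_trichotomy x 0 with h | rfl | h
  · rw [if_neg (by omega), if_neg (by omega), if_neg h.ne]
  · simp
  · rw [if_neg (by omega), if_neg (by omega), if_neg h.ne']

theorem binom_natCast (a b : ℕ) : binom a b = a.choose b := by
  unfold binom
  split_ifs with h1 h2
  · simp
  · omega
  · rw [Nat.choose_eq_zero_of_lt (by omega)]

/-- The indicator of a finite system of affine equations is a multisum. -/
theorem isMultisum_indicator {ι ρ : Type} [Fintype ι] [Fintype ρ] (φ : ρ → (ι → ℕ) → ℤ)
    (hφ : ∀ i, IsAff (φ i)) [DecidablePred fun p : ι → ℕ => ∀ i, φ i p = 0] :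
    IsMultisum fun p : ι → ℕ => if ∀ i, φ i p = 0 then 1 else 0 := by
  convert isMultisum_prod_binom (fun _ _ => 0) φ (fun _ => isAff_const 0) hφ using 2 with p
  simp only [binom_zero_left]
  split_ifs with h
  · simp [h]
  · push Not at h
    obtain ⟨i, hi⟩ := h
    exact (Finset.prod_eq_zero (Finset.mem_univ i) (by simp [hi])).symm

/-- Summation over integers is cut down to natural numbers by extra factors `binom v v`, which are
`1` for `v ≥ 0` and `0` for `v < 0`, including `v = -1`. -/
theorem mem_binomialMultisums_of_isMultisum {g : (Unit → ℕ) → ℝ≥0∞} (hg : IsMultisum g)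
    {f : ℕ → ℕ} (hf : ∀ n, g (fun _ => n) = f n) : f ∈ binomialMultisums := by
  classical
  obtain ⟨ρ, κ, _, _, α, β, hα, hβ, h⟩ := hg
  choose a c hα using hα
  choose b c' hβ using hβ
  let eκ := Fintype.equivFin κ
  let eρ := Fintype.equivFin (ρ ⊕ κ)
  let A : ρ ⊕ κ → AffineForm (Fintype.card κ) := Sum.elim
    (fun i => ⟨fun j => a i (Sum.inr (eκ.symm j)), a i (Sum.inl ()), c i⟩)
    (fun j => ⟨Pi.single (eκ j) 1, 0, 0⟩)
  let B : ρ ⊕ κ → AffineForm (Fintype.card κ) := Sum.elim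
    (fun i => ⟨fun j => b i (Sum.inr (eκ.symm j)), b i (Sum.inl ()), c' i⟩)
    (fun j => ⟨Pi.single (eκ j) 1, 0, 0⟩)
  refine ⟨Fintype.card (ρ ⊕ κ), Fintype.card κ, fun i => A (eρ.symm i), fun i => B (eρ.symm i),
    fun n => ?_⟩
  rw [← tsum_natCast_eq_iff, ← hf n, h]
  have hprod : ∀ v : Fin (Fintype.card κ) → ℤ,
      ∏ i, binom ((A (eρ.symm i)).eval v n) ((B (eρ.symm i)).eval v n) =
      (∏ i : ρ, binom ((A (.inl i)).eval v n) ((B (.inl i)).eval v n)) *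
        ∏ j : κ, binom (v (eκ j)) (v (eκ j)) := by
    intro v
    rw [eρ.symm.prod_comp fun i => binom ((A i).eval v n) ((B i).eval v n),
      Fintype.prod_sum_type]
    congr 1
    refine Finset.prod_congr rfl fun j _ => ?_
    simp [A, B, AffineForm.eval, Pi.single_apply]
  let emb : (κ → ℕ) → Fin (Fintype.card κ) → ℤ := fun v j => v (eκ.symm j)
  have hinj : Function.Injective emb := by
    intro v w hvw
    ext j
    have := congrFun hvw (eκ j)
    simpa [emb] using this
  rw [← hinj.tsum_eq]
  · refine tsum_congr fun v => ?_
    rw [hprod]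
    have h1 : ∏ j : κ, binom (emb v (eκ j)) (emb v (eκ j)) = 1 :=
      Finset.prod_eq_one fun j _ => by
        simp only [emb, Equiv.symm_apply_apply, binom_natCast, Nat.choose_self]
    rw [h1, mul_one, Nat.cast_prod]
    refine Finset.prod_congr rfl fun i _ => ?_
    have hA : (A (.inl i)).eval (emb v) n = α i (Sum.elim (fun _ => n) v) := by
      rw [hα i]
      simp only [A, Sum.elim_inl, AffineForm.eval, emb, Fintype.sum_sum_type, Sum.elim_inr]
      rw [eκ.symm.sum_comp fun j => a i (Sum.inr j) * (v j : ℤ)]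
      simp
      ring
    have hB : (B (.inl i)).eval (emb v) n = β i (Sum.elim (fun _ => n) v) := by
      rw [hβ i]
      simp only [B, Sum.elim_inl, AffineForm.eval, emb, Fintype.sum_sum_type, Sum.elim_inr]
      rw [eκ.symm.sum_comp fun j => b i (Sum.inr j) * (v j : ℤ)]
      simp
      ring
    rw [hA, hB]
  · intro v hv
    have hpos : ∀ j, 0 ≤ v (eκ j) := by
      intro j
      by_contra! hneg
      apply hv
      beta_reduce
      rw [hprod, Finset.prod_eq_zero (i := j) (Finset.mem_univ j) (f := fun j =>
        binom (v (eκ j)) (v (eκ j)))]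
      · simp
      · unfold binom
        rw [if_neg (by omega), if_neg (by omega)]
    refine ⟨fun j => (v (eκ j)).toNat, ?_⟩
    ext j
    simp only [emb, Equiv.apply_symm_apply]
    have := hpos (eκ.symm j)
    simp only [Equiv.apply_symm_apply] at this
    exact Int.toNat_of_nonneg this

/-! ### Coefficients of powers of `ℕ`-rational series are multisums -/

/-- In a commutative ring, if `(1 - F) G = 1`, then `G ^ m` agrees with a partial sum of the binomial
series modulo `F ^ N`. -/
theorem pow_dvd_inv_pow_sub_sum {R : Type*} [CommRing R] {F G : R} (h : (1 - F) * G = 1)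
    (N m : ℕ) : F ^ N ∣ G ^ m - ∑ j ∈ Finset.range N, (binom (m + j - 1) j : R) * F ^ j := by
  induction m with
  | zero =>
    rcases N with _ | N
    · simp
    -- For `m = 0` only `j = 0` survives, and its coefficient is the exceptional value at `(-1, 0)`.
    · rw [Finset.sum_range_succ', Finset.sum_eq_zero]
      · simp [binom]
      · intro j _
        have : binom (((0 : ℕ) : ℤ) + ((j + 1 : ℕ) : ℤ) - 1) ((j + 1 : ℕ) : ℤ) = 0 := by
          unfold binom
          rw [if_neg (by push_cast; omega), if_neg (by push_cast; omega)]
        rw [this]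
        simp
  | succ m ih =>
    have hchoose : ∀ j : ℕ, binom (((m + 1 : ℕ) : ℤ) + j - 1) j = (m + j).choose j := by
      intro j
      rw [← binom_natCast]
      congr 1
      push_cast
      ring
    have hb : ∀ j : ℕ, (binom ((m : ℤ) + (j + 1 : ℕ) - 1) (j + 1 : ℕ) : R) =
        ((m + (j + 1)).choose (j + 1) : R) - ((m + j).choose j : R) := by
      intro j
      have h1 : binom ((m : ℤ) + (j + 1 : ℕ) - 1) (j + 1 : ℕ) = (m + j).choose (j + 1) := by
        rw [← binom_natCast]
        congr 1
        push_cast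
        ring
      rw [h1, ← add_assoc, Nat.choose_succ_succ]
      push_cast
      ring
    have hb0 : binom ((m : ℤ) + (0 : ℕ) - 1) (0 : ℕ) = 1 := by
      rcases m with _ | m
      · simp [binom]
      · rw [show (((m + 1 : ℕ) : ℤ) + ((0 : ℕ) : ℤ) - 1) = (m : ℕ) by push_cast; ring,
          binom_natCast, Nat.choose_zero_right]
    simp only [hchoose]
    -- By Pascal's rule, multiplication by `1 - F` lowers `m + 1` to `m`, up to a boundary term
    -- divisible by `F ^ N`.
    have htel : ∀ N : ℕ, ∃ z : R, (1 - F) * ∑ j ∈ Finset.range N, ((m + j).choose j : R) * F ^ j =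
        ∑ j ∈ Finset.range N, (binom ((m : ℤ) + j - 1) j : R) * F ^ j + z * F ^ N ∧
        z = -(if N = 0 then 0 else ((m + (N - 1)).choose (N - 1) : R)) := by
      intro N
      refine ⟨_, ?_, rfl⟩
      induction N with
      | zero => simp
      | succ N ih =>
        rw [Finset.sum_range_succ, Finset.sum_range_succ, mul_add, ih]
        rcases N with _ | N
        · simp only [hb0]
          simp
          ring
        · rw [hb N]
          simp only [Nat.add_eq_zero_iff, one_ne_zero, and_false, if_false, Nat.add_sub_cancel]
          ring
    obtain ⟨z, hz, -⟩ := htel N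
    have : G ^ (m + 1) - ∑ j ∈ Finset.range N, ((m + j).choose j : R) * F ^ j =
        G * (G ^ m - ∑ j ∈ Finset.range N, (binom ((m : ℤ) + j - 1) j : R) * F ^ j)
          - G * z * F ^ N := by
      have e1 : ∑ j ∈ Finset.range N, ((m + j).choose j : R) * F ^ j =
          G * ((1 - F) * ∑ j ∈ Finset.range N, ((m + j).choose j : R) * F ^ j) := by
        linear_combination
          (-∑ j ∈ Finset.range N, ((m + j).choose j : R) * F ^ j) * h
      rw [e1, hz, pow_succ]
      ring
    rw [this]
    exact dvd_sub (ih.mul_left G) (Dvd.intro_left _ rfl)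

section Coefficients

variable {k : ℕ}

/-- The exponent vector in the coordinates `some i` of `p`. -/
noncomputable def exponent (p : Option (Fin k) → ℕ) : Fin k →₀ ℕ :=
  Finsupp.equivFunOnFinite.symm fun i => p (some i)

/-- The coefficients of the powers of `G`, as a function of the power `p none` and the exponents
`p (some i)`. -/
noncomputable def powerCoeff (G : MvPowerSeries (Fin k) ℕ) (p : Option (Fin k) → ℕ) : ℝ≥0∞ :=
  (MvPowerSeries.coeff (exponent p) (G ^ p none) : ℕ)

theorem powerCoeff_zero (p : Option (Fin k) → ℕ) [Decidable (∀ i, (p i : ℤ) = 0)] :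
    powerCoeff (0 : MvPowerSeries (Fin k) ℕ) p = if ∀ i, (p i : ℤ) = 0 then 1 else 0 := by
  classical
  unfold powerCoeff
  rcases Nat.eq_zero_or_pos (p none) with h0 | h0
  · rw [h0, pow_zero, MvPowerSeries.coeff_one]
    have : exponent p = 0 ↔ ∀ i, (p i : ℤ) = 0 := by
      rw [Option.forall]
      simp [h0, exponent, Finsupp.ext_iff]
    simp only [this]
    split_ifs <;> simp
  · rw [zero_pow h0.ne', if_neg]
    · simp
    · intro h
      have := h none
      omega

theorem powerCoeff_X (i : Fin k) (p : Option (Fin k) → ℕ)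
    [Decidable (∀ j : Fin k, (p (some j) : ℤ) - (if j = i then 1 else 0) * p none = 0)] :
    powerCoeff (MvPowerSeries.X i) p =
      if ∀ j : Fin k, (p (some j) : ℤ) - (if j = i then 1 else 0) * p none = 0 then 1 else 0 := by
  classical
  unfold powerCoeff
  rw [MvPowerSeries.coeff_X_pow]
  have : exponent p = Finsupp.single i (p none) ↔
      ∀ j : Fin k, (p (some j) : ℤ) - (if j = i then 1 else 0) * p none = 0 := by
    simp only [Finsupp.ext_iff, exponent, Finsupp.equivFunOnFinite_symm_apply_apply,
      Finsupp.single_apply]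
    refine forall_congr' fun j => ?_
    by_cases h : j = i
    · simp only [h, if_true]
      omega
    · simp only [h, Ne.symm h, if_false]
      omega
  simp only [this]
  split_ifs <;> simp

theorem powerCoeff_mul (F G : MvPowerSeries (Fin k) ℕ) (p : Option (Fin k) → ℕ)
    [DecidablePred fun w : Fin k ⊕ Fin k → ℕ =>
      ∀ i, (w (.inl i) : ℤ) + w (.inr i) - p (some i) = 0] :
    powerCoeff (F * G) p = ∑' w : Fin k ⊕ Fin k → ℕ,
      (if ∀ i, (w (.inl i) : ℤ) + w (.inr i) - p (some i) = 0 then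
        powerCoeff F (Option.elim · (p none) (w ∘ Sum.inl)) *
        powerCoeff G (Option.elim · (p none) (w ∘ Sum.inr)) else 0) := by
  rw [tsum_ite_eq_sum (Finset.HasAntidiagonal.antidiagonal (exponent p)) (fun x => Sum.elim x.1 x.2)]
  · rw [powerCoeff, mul_pow, MvPowerSeries.coeff_mul]
    push_cast
    refine Finset.sum_congr rfl fun x _ => ?_
    have h1 : exponent (Option.elim · (p none) (x.1 : Fin k → ℕ)) = x.1 := by
      ext i; simp [exponent]
    have h2 : exponent (Option.elim · (p none) (x.2 : Fin k → ℕ)) = x.2 := by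
      ext i; simp [exponent]
    simp only [powerCoeff, Sum.elim_comp_inl, Sum.elim_comp_inr, h1, h2, Option.elim_none]
  · intro x _ y _ h
    simp only [Sum.elim_eq_iff, DFunLike.coe_fn_eq] at h
    exact Prod.ext h.1 h.2
  · intro w
    simp only [Finset.HasAntidiagonal.mem_antidiagonal, Prod.exists]
    constructor
    · intro h
      refine ⟨Finsupp.equivFunOnFinite.symm (w ∘ Sum.inl),
        Finsupp.equivFunOnFinite.symm (w ∘ Sum.inr), ?_, ?_⟩
      · ext i
        have := h i
        simp only [Finsupp.add_apply, Finsupp.equivFunOnFinite_symm_apply_apply,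
          Function.comp_apply, exponent]
        omega
      · ext (i | i) <;> simp
    · rintro ⟨a, b, hab, rfl⟩ i
      have := DFunLike.congr_fun hab i
      simp only [Finsupp.add_apply, exponent, Finsupp.equivFunOnFinite_symm_apply_apply] at this
      simp only [Sum.elim_inl, Sum.elim_inr]
      omega

/-- Binomial theorem and Cauchy product: the two halves of `w` hold the power and the exponents
contributed by `F` and by `G`. -/
theorem powerCoeff_add (F G : MvPowerSeries (Fin k) ℕ) (p : Option (Fin k) → ℕ)
    [DecidablePred fun w : Option (Fin k) ⊕ Option (Fin k) → ℕ =>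
      ∀ i, (w (.inl i) : ℤ) + w (.inr i) - p i = 0] :
    powerCoeff (F + G) p = ∑' w : Option (Fin k) ⊕ Option (Fin k) → ℕ,
      (if ∀ i, (w (.inl i) : ℤ) + w (.inr i) - p i = 0 then
        (binom (p none) (w (.inl none)) : ℝ≥0∞) *
          (powerCoeff F (w ∘ Sum.inl) * powerCoeff G (w ∘ Sum.inr)) else 0) := by
  rw [tsum_ite_eq_sum (Finset.HasAntidiagonal.antidiagonal (p none) ×ˢ Finset.HasAntidiagonal.antidiagonal (exponent p))
    (fun x => Sum.elim (Option.elim · x.1.1 x.2.1) (Option.elim · x.1.2 x.2.2))]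
  · rw [powerCoeff, (Commute.all F G).add_pow', map_sum, Finset.sum_product]
    push_cast
    refine Finset.sum_congr rfl fun x _ => ?_
    rw [map_nsmul, MvPowerSeries.coeff_mul, nsmul_eq_mul]
    push_cast
    rw [Finset.mul_sum]
    refine Finset.sum_congr rfl fun y _ => ?_
    have h1 : exponent (Option.elim · x.1 (y.1 : Fin k → ℕ)) = y.1 := by
      ext i; simp [exponent]
    have h2 : exponent (Option.elim · x.2 (y.2 : Fin k → ℕ)) = y.2 := by
      ext i; simp [exponent]
    simp only [powerCoeff, Sum.elim_comp_inl, Sum.elim_comp_inr, h1, h2, Option.elim_none,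
      Sum.elim_inl, binom_natCast]
  · intro x _ y _ h
    have h' := congrFun h
    exact Prod.ext (Prod.ext (h' (.inl none)) (h' (.inr none)))
      (Prod.ext (Finsupp.ext fun i => h' (.inl (some i))) (Finsupp.ext fun i => h' (.inr (some i))))
  · intro w
    simp only [Finset.mem_product, Finset.HasAntidiagonal.mem_antidiagonal]
    constructor
    · intro h
      refine ⟨((w (.inl none), w (.inr none)),
        (Finsupp.equivFunOnFinite.symm fun i => w (.inl (some i)),
        Finsupp.equivFunOnFinite.symm fun i => w (.inr (some i)))), ⟨?_, ?_⟩, ?_⟩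
      · have := h none
        simp only
        omega
      · ext i
        have := h (some i)
        simp only [Finsupp.add_apply, Finsupp.equivFunOnFinite_symm_apply_apply, exponent]
        omega
      · ext ((_ | i) | (_ | i)) <;> simp
    · rintro ⟨x, ⟨hm, hab⟩, rfl⟩ (_ | i)
      · simp only [Sum.elim_inl, Sum.elim_inr, Option.elim_none]
        omega
      · have := DFunLike.congr_fun hab i
        simp only [Finsupp.add_apply, exponent, Finsupp.equivFunOnFinite_symm_apply_apply] at this
        simp only [Sum.elim_inl, Sum.elim_inr, Option.elim_some]
        omega

theorem coeff_pow_of_lt {R : Type*} [CommSemiring R] {F : MvPowerSeries (Fin k) R}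
    (hF : MvPowerSeries.constantCoeff F = 0) {c : Fin k →₀ ℕ} {j : ℕ} (h : c.degree < j) :
    MvPowerSeries.coeff c (F ^ j) = 0 := by
  refine MvPowerSeries.coeff_of_lt_order (lt_of_lt_of_le ?_
    (MvPowerSeries.le_order_pow_of_constantCoeff_eq_zero j hF))
  exact_mod_cast h

/-- The error of the truncated binomial series is divisible by a power of `F` whose terms all have
degree above that of `c`. -/
theorem coeff_inv_pow {F G : MvPowerSeries (Fin k) ℤ} (hF : MvPowerSeries.constantCoeff F = 0)
    (h : (1 - F) * G = 1) (c : Fin k →₀ ℕ) (m : ℕ) :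
    MvPowerSeries.coeff c (G ^ m) = ∑ j ∈ Finset.range (c.degree + 1),
      (binom (m + j - 1) j : ℤ) * MvPowerSeries.coeff c (F ^ j) := by
  obtain ⟨Q, hQ⟩ := pow_dvd_inv_pow_sub_sum h (c.degree + 1) m
  rw [sub_eq_iff_eq_add] at hQ
  rw [hQ, map_add, map_sum]
  have h0 : MvPowerSeries.coeff c (F ^ (c.degree + 1) * Q) = 0 := by
    rw [MvPowerSeries.coeff_mul]
    refine Finset.sum_eq_zero fun x hx => ?_
    rw [coeff_pow_of_lt hF, zero_mul]
    rw [← Finset.HasAntidiagonal.mem_antidiagonal.mp hx, map_add]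
    omega
  rw [h0, zero_add]
  refine Finset.sum_congr rfl fun j _ => ?_
  rw [← nsmul_eq_mul, map_nsmul, nsmul_eq_mul]

theorem powerCoeff_inv {F G : MvPowerSeries (Fin k) ℕ}
    (hF : MvPowerSeries.constantCoeff F = 0)
    (h : ∀ c (m : ℕ), MvPowerSeries.coeff c (G ^ m) = ∑ j ∈ Finset.range (c.degree + 1),
      binom (m + j - 1) j * MvPowerSeries.coeff c (F ^ j)) (p : Option (Fin k) → ℕ) :
    powerCoeff G p = ∑' w : Unit → ℕ, (binom ((p none : ℤ) + w () - 1) (w ()) : ℝ≥0∞) *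
      powerCoeff F (Option.elim · (w ()) fun i => p (some i)) := by
  rw [← (Equiv.funUnique Unit ℕ).symm.tsum_eq,
    tsum_eq_sum (s := Finset.range ((exponent p).degree + 1))]
  · rw [powerCoeff, h]
    push_cast
    rfl
  · intro j hj
    have : exponent (Option.elim · j fun i => p (some i)) = exponent p := rfl
    simp only [powerCoeff, Equiv.funUnique_symm_apply, uniqueElim_const, this, Option.elim_none]
    rw [coeff_pow_of_lt hF (by simpa using hj)]
    simp

/-- The coefficients of all powers of an `ℕ`-rational series form a multisum. -/
theorem IsNRational.exists_isMultisum {G : MvPowerSeries (Fin k) ℤ} (hG : IsNRational G) :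
    ∃ G' : MvPowerSeries (Fin k) ℕ, MvPowerSeries.map (Nat.castRingHom ℤ) G' = G ∧
      IsMultisum (powerCoeff G') := by
  classical
  induction hG with
  | zero =>
    refine ⟨0, by simp, ?_⟩
    convert isMultisum_indicator (ι := Option (Fin k)) (fun i p => (p i : ℤ)) isAff_coord using 2
      with p
    exact powerCoeff_zero p
  | var i =>
    refine ⟨MvPowerSeries.X i, MvPowerSeries.map_X _ _, ?_⟩
    convert isMultisum_indicator (ι := Option (Fin k)) (fun (j : Fin k) p =>
      (p (some j) : ℤ) - (if j = i then 1 else 0) * p none)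
      (fun j => (isAff_coord (some j)).sub ((isAff_coord none).const_mul _)) using 2 with p
    exact powerCoeff_X i p
  | add _ _ ihF ihG =>
    obtain ⟨F, rfl, hF⟩ := ihF
    obtain ⟨G, rfl, hG⟩ := ihG
    refine ⟨F + G, map_add _ _ _, ?_⟩
    have h1 := isMultisum_indicator (ι := Option (Fin k) ⊕ (Option (Fin k) ⊕ Option (Fin k)))
      (fun i q => (q (.inr (.inl i)) : ℤ) + q (.inr (.inr i)) - q (.inl i))
      (fun i => ((isAff_coord _).add (isAff_coord _)).sub (isAff_coord _))
    have h2 := isMultisum_binom (ι := Option (Fin k) ⊕ (Option (Fin k) ⊕ Option (Fin k)))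
      (isAff_coord (.inl none)) (isAff_coord (.inr (.inl none)))
    have h3 := (h1.mul (h2.mul ((hF.reindex (Sum.inr ∘ Sum.inl)).mul
      (hG.reindex (Sum.inr ∘ Sum.inr))))).tsum
    convert h3 using 2 with p
    rw [powerCoeff_add]
    refine tsum_congr fun w => ?_
    by_cases h : ∀ i, (w (.inl i) : ℤ) + w (.inr i) - p i = 0
    · exact ((if_pos h).trans (one_mul _).symm).trans (congrArg₂ (· * ·) (if_pos h).symm rfl)
    · exact ((if_neg h).trans (zero_mul _).symm).trans (congrArg₂ (· * ·) (if_neg h).symm rfl)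
  | mul _ _ ihF ihG =>
    obtain ⟨F, rfl, hF⟩ := ihF
    obtain ⟨G, rfl, hG⟩ := ihG
    refine ⟨F * G, map_mul _ _ _, ?_⟩
    have h1 := isMultisum_indicator (ι := Option (Fin k) ⊕ (Fin k ⊕ Fin k))
      (fun i q => (q (.inr (.inl i)) : ℤ) + q (.inr (.inr i)) - q (.inl (some i)))
      (fun i => ((isAff_coord _).add (isAff_coord _)).sub (isAff_coord _))
    have h3 := (h1.mul ((hF.reindex (Option.elim · (.inl none) fun i => .inr (.inl i))).mul
      (hG.reindex (Option.elim · (.inl none) fun i => .inr (.inr i))))).tsum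
    convert h3 using 2 with p
    rw [powerCoeff_mul]
    refine tsum_congr fun w => ?_
    have e1 : (Sum.elim p w ∘ fun x : Option (Fin k) => x.elim (.inl none) fun i => .inr (.inl i)) =
        (Option.elim · (p none) (w ∘ Sum.inl)) := by ext (_ | i) <;> rfl
    have e2 : (Sum.elim p w ∘ fun x : Option (Fin k) => x.elim (.inl none) fun i => .inr (.inr i)) =
        (Option.elim · (p none) (w ∘ Sum.inr)) := by ext (_ | i) <;> rfl
    rw [e1, e2]
    by_cases h : ∀ i, (w (.inl i) : ℤ) + w (.inr i) - p (some i) = 0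
    · exact ((if_pos h).trans (one_mul _).symm).trans (congrArg₂ (· * ·) (if_pos h).symm rfl)
    · exact ((if_neg h).trans (zero_mul _).symm).trans (congrArg₂ (· * ·) (if_neg h).symm rfl)
  | @inv_one_sub _ G _ hc hinv ihF =>
    obtain ⟨F, rfl, hF⟩ := ihF
    have hc' : MvPowerSeries.constantCoeff F = 0 := by
      rw [MvPowerSeries.constantCoeff_map] at hc
      simpa using hc
    -- The lift of `1 / (1 - F)` to natural coefficients is defined by the expansion with `m = 1`;
    -- the formula for other powers is then transported back from `ℤ`.
    let G' : MvPowerSeries (Fin k) ℕ := fun c => ∑ j ∈ Finset.range (c.degree + 1),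
      binom (((1 : ℕ) : ℤ) + j - 1) j * MvPowerSeries.coeff c (F ^ j)
    have hG' : MvPowerSeries.map (Nat.castRingHom ℤ) G' = G := by
      ext c
      have h1 := coeff_inv_pow hc hinv c 1
      rw [pow_one] at h1
      rw [h1, MvPowerSeries.coeff_map]
      have : MvPowerSeries.coeff c G' = ∑ j ∈ Finset.range (c.degree + 1),
        binom (((1 : ℕ) : ℤ) + j - 1) j * MvPowerSeries.coeff c (F ^ j) := rfl
      rw [this]
      simp only [← map_pow, MvPowerSeries.coeff_map]
      simp
    refine ⟨G', hG', ?_⟩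
    have hcoeff : ∀ c (m : ℕ), MvPowerSeries.coeff c (G' ^ m) =
        ∑ j ∈ Finset.range (c.degree + 1),
          binom (m + j - 1) j * MvPowerSeries.coeff c (F ^ j) := by
      intro c m
      have h1 := coeff_inv_pow hc hinv c m
      rw [← hG', ← map_pow, MvPowerSeries.coeff_map] at h1
      simp only [← map_pow, MvPowerSeries.coeff_map, eq_natCast] at h1
      exact_mod_cast h1
    have h2 := isMultisum_binom (ι := Option (Fin k) ⊕ Unit)
      (((isAff_coord (.inl none)).add (isAff_coord (.inr ()))).sub (isAff_const 1))
      (isAff_coord (.inr ()))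
    have h3 := (h2.mul (hF.reindex (Option.elim · (.inr ()) fun i => .inl (some i)))).tsum
    convert h3 using 2 with p
    rw [powerCoeff_inv hc' hcoeff]
    refine tsum_congr fun w => ?_
    simp only [Sum.elim_inl, Sum.elim_inr]
    congr 2
    ext (_ | i) <;> rfl

end Coefficients

theorem exists_isMultisum_of_mem_diagonals {f : ℕ → ℕ} (hf : f ∈ diagonals) :
    ∃ g : (Unit → ℕ) → ℝ≥0∞, IsMultisum g ∧ ∀ n, g (fun _ => n) = f n := by
  classical
  obtain ⟨k, G, -, hG, hf⟩ := hf
  obtain ⟨G', rfl, hG'⟩ := hG.exists_isMultisum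
  have h1 := isMultisum_indicator (ι := Unit ⊕ Option (Fin k))
    (fun i q => (q (.inr i) : ℤ) - Option.elim i 1 fun _ => q (.inl ()))
    (fun i => (isAff_coord _).sub (by
      rcases i with _ | i
      · exact isAff_const 1
      · exact isAff_coord _))
  -- The indicator fixes the power to `1` and every exponent to `n`, so the sum has the diagonal
  -- coefficient as its only term.
  refine ⟨_, (h1.mul (hG'.reindex Sum.inr)).tsum, fun n => ?_⟩
  rw [tsum_eq_single (Option.elim · 1 fun _ => n)]
  · rw [if_pos]
    · simp only [Sum.elim_comp_inr, one_mul, powerCoeff, Option.elim_none, pow_one]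
      have := hf n
      rw [MvPowerSeries.coeff_map, eq_natCast] at this
      have h2 : exponent (k := k) (Option.elim · 1 fun _ => n) =
        Finsupp.equivFunOnFinite.symm fun _ => n := rfl
      rw [h2]
      exact_mod_cast this
    · rintro (_ | i) <;> simp
  · intro w hw
    rw [if_neg, zero_mul]
    intro h
    apply hw
    ext (_ | i)
    · have := h none
      simp only [Sum.elim_inr, Option.elim_none] at this
      simp only [Option.elim_none]
      omega
    · have := h (some i)
      simp only [Sum.elim_inr, Sum.elim_inl, Option.elim_some] at this
      simp only [Option.elim_some]
      omega

theorem diagonals_subset_binomialMultisums : diagonals ⊆ binomialMultisums := by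
  intro f hf
  obtain ⟨g, hg, hgf⟩ := exists_isMultisum_of_mem_diagonals hf
  exact mem_binomialMultisums_of_isMultisum hg hgf

theorem mul_mem_binomialMultisums {f g : ℕ → ℕ} (hf : f ∈ diagonals) (hg : g ∈ diagonals) :
    (fun n => f n * g n) ∈ binomialMultisums := by
  obtain ⟨F, hF, hFf⟩ := exists_isMultisum_of_mem_diagonals hf
  obtain ⟨G, hG, hGg⟩ := exists_isMultisum_of_mem_diagonals hg
  refine mem_binomialMultisums_of_isMultisum (hF.mul hG) fun n => ?_
  rw [hFf, hGg]
  push_cast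
  rfl

/-! ### Gordan's theorem over the rationals and generic positive functionals -/

theorem exists_small_perturbation {X : Type*} (s : Finset X) (p q : X → ℚ)
    (hp : ∀ x ∈ s, 0 < p x) : ∃ η : ℚ, 0 < η ∧ ∀ x ∈ s, 0 < p x + η * q x := by
  have h : ∀ᶠ η in nhdsWithin (0 : ℚ) (Set.Ioi 0), ∀ x ∈ s, 0 < p x + η * q x := by
    rw [Filter.eventually_all_finset]
    intro x hx
    refine eventually_nhdsWithin_of_eventually_nhds ?_
    have hc : Continuous fun η : ℚ => p x + η * q x := by fun_prop
    exact hc.continuousAt.eventually (lt_mem_nhds (by simpa using hp x hx))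
  obtain ⟨η, h1, h2⟩ := (h.and self_mem_nhdsWithin).exists
  exact ⟨η, h2, h1⟩

/-- Gordan's theorem of the alternative. -/
theorem gordan {K X : Type*} [Fintype K] (s : Finset X) : ∀ w : X → K → ℚ,
    (∃ c : X → ℚ, (∀ x ∈ s, 0 ≤ c x) ∧ (∃ x ∈ s, 0 < c x) ∧ ∑ x ∈ s, c x • w x = 0) ∨
      ∃ y : K → ℚ, ∀ x ∈ s, 0 < y ⬝ᵥ w x := by
  classical
  induction s using Finset.induction_on with
  | empty => exact fun w => .inr ⟨0, by simp⟩
  | insert a s ha ih =>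
    intro w
    have hupd : ∀ (c : X → ℚ) (r : ℚ), ∑ x ∈ s, Function.update c a r x • w x =
        ∑ x ∈ s, c x • w x := fun c r => Finset.sum_congr rfl fun x hx => by
      rw [Function.update_of_ne (ne_of_mem_of_not_mem hx ha)]
    have hne : ∀ {x}, x ∈ s → x ≠ a := fun hx => ne_of_mem_of_not_mem hx ha
    rcases ih w with ⟨c, hc0, ⟨x, hx, hcx⟩, hc⟩ | ⟨y, hy⟩
    · refine .inl ⟨Function.update c a 0, ?_, ⟨x, Finset.mem_insert_of_mem hx, ?_⟩, ?_⟩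
      · intro z hz
        rcases Finset.mem_insert.mp hz with rfl | hz
        · simp
        · rw [Function.update_of_ne (hne hz)]
          exact hc0 z hz
      · rwa [Function.update_of_ne (hne hx)]
      · rw [Finset.sum_insert ha, hupd, hc]
        simp
    rcases lt_trichotomy (y ⬝ᵥ w a) 0 with hneg | hzero | hpos
    · set A := y ⬝ᵥ w a with hA
      have hA0 : A ≠ 0 := hneg.ne
      -- These combinations are orthogonal to `y`. A relation between them expands to one with
      -- nonnegative coefficients between the original vectors, `w a` included.
      rcases ih fun x => (-A) • w x + (y ⬝ᵥ w x) • w a with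
        ⟨c, hc0, ⟨x, hx, hcx⟩, hc⟩ | ⟨z, hz⟩
      · refine .inl ⟨Function.update (fun x => c x * -A) a (∑ x ∈ s, c x * (y ⬝ᵥ w x)), ?_,
          ⟨x, Finset.mem_insert_of_mem hx, ?_⟩, ?_⟩
        · intro z hz
          rcases Finset.mem_insert.mp hz with rfl | hz
          · rw [Function.update_self]
            exact Finset.sum_nonneg fun x hx => mul_nonneg (hc0 x hx) (hy x hx).le
          · rw [Function.update_of_ne (hne hz)]
            exact mul_nonneg (hc0 z hz) (by linarith)
        · rw [Function.update_of_ne (hne hx)]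
          exact mul_pos hcx (by linarith)
        · rw [Finset.sum_insert ha, hupd, Function.update_self, Finset.sum_smul,
            ← Finset.sum_add_distrib, ← hc]
          refine Finset.sum_congr rfl fun x _ => ?_
          rw [smul_add, smul_smul, smul_smul, add_comm]
      · right
        obtain ⟨η, hη, hs⟩ := exists_small_perturbation s
          (fun x => z ⬝ᵥ w x + (z ⬝ᵥ w a / -A) * (y ⬝ᵥ w x)) (fun x => -(y ⬝ᵥ w x)) (by
            intro x hx
            have h1 := hz x hx
            rw [dotProduct_add, dotProduct_smul, dotProduct_smul, smul_eq_mul, smul_eq_mul] at h1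
            have h2 : z ⬝ᵥ w x + (z ⬝ᵥ w a / -A) * (y ⬝ᵥ w x) =
                (-A * (z ⬝ᵥ w x) + (y ⬝ᵥ w x) * (z ⬝ᵥ w a)) / -A := by
              field_simp
              ring
            rw [h2]
            exact div_pos h1 (by linarith))
        -- With `η = 0` the functional vanishes on `w a` and is positive on `s`; a small `η > 0`
        -- makes it positive on `w a`, since `A < 0`.
        refine ⟨z + (z ⬝ᵥ w a / -A - η) • y, fun x hx => ?_⟩
        rw [add_dotProduct, smul_dotProduct, smul_eq_mul]
        rcases Finset.mem_insert.mp hx with rfl | hx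
        · rw [← hA]
          have : z ⬝ᵥ w x + (z ⬝ᵥ w x / -A - η) * A = -(η * A) := by field_simp; ring
          rw [this]
          nlinarith
        · have := hs x hx
          linarith
    · by_cases hwa : w a = 0
      · refine .inl ⟨Function.update 0 a 1, ?_, ⟨a, Finset.mem_insert_self _ _, by simp⟩, ?_⟩
        · intro x hx
          rcases Finset.mem_insert.mp hx with rfl | hx
          · simp
          · rw [Function.update_of_ne (hne hx)]
            simp
        · rw [Finset.sum_insert ha, hupd, hwa]
          simp
      · right
        -- When `y` vanishes on `w a ≠ 0`, moving slightly in the direction `w a` adds `η * (w a ⬝ᵥ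
        -- w a) > 0`.
        obtain ⟨η, hη, hs⟩ := exists_small_perturbation s (fun x => y ⬝ᵥ w x)
          (fun x => w a ⬝ᵥ w x) hy
        refine ⟨y + η • w a, fun x hx => ?_⟩
        rw [add_dotProduct, smul_dotProduct, smul_eq_mul]
        rcases Finset.mem_insert.mp hx with rfl | hx
        · rw [hzero, zero_add]
          refine mul_pos hη (lt_of_le_of_ne (Finset.sum_nonneg fun k _ => mul_self_nonneg _) ?_)
          exact fun h => hwa (dotProduct_self_eq_zero.mp h.symm)
        · exact hs x hx
    · refine .inr ⟨y, fun x hx => ?_⟩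
      rcases Finset.mem_insert.mp hx with rfl | hx
      · exact hpos
      · exact hy x hx

theorem exists_pos_mul_eq_intCast {X : Type*} (s : Finset X) (c : X → ℚ) :
    ∃ (D : ℕ) (z : X → ℤ), 0 < D ∧ ∀ x ∈ s, c x * D = z x := by
  refine ⟨∏ x ∈ s, (c x).den, fun x => (c x * (∏ x ∈ s, (c x).den : ℕ)).num,
    Finset.prod_pos fun x _ => Rat.den_pos _, fun x hx => ?_⟩
  obtain ⟨q, hq⟩ := Finset.dvd_prod_of_mem (fun x => (c x).den) hx
  have h : c x * (∏ x ∈ s, (c x).den : ℕ) = ((c x).num * q : ℤ) := by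
    rw [hq]
    push_cast
    rw [← mul_assoc, Rat.mul_den_eq_num]
  beta_reduce
  rw [h, Rat.num_intCast]

/-- Integer version of Gordan's theorem for a finite family of integer vectors. -/
theorem gordan_int {K X : Type*} [Fintype K] [Fintype X] (w : X → K → ℤ) :
    (∃ c : X → ℕ, c ≠ 0 ∧ ∀ k, ∑ x, (c x : ℤ) * w x k = 0) ∨
      ∃ y : K → ℤ, ∀ x, 0 < ∑ k, y k * w x k := by
  rcases gordan Finset.univ fun x k => (w x k : ℚ) with ⟨c, hc0, ⟨x, -, hx⟩, hc⟩ | ⟨y, hy⟩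
  · left
    obtain ⟨D, z, hD, hz⟩ := exists_pos_mul_eq_intCast Finset.univ c
    have hDQ : (0 : ℚ) < D := by exact_mod_cast hD
    have hznn : ∀ x, ((z x).toNat : ℤ) = z x := fun x => by
      refine Int.toNat_of_nonneg ?_
      have : (0 : ℚ) ≤ z x := by
        rw [← hz x (Finset.mem_univ x)]
        exact mul_nonneg (hc0 x (Finset.mem_univ x)) hDQ.le
      exact_mod_cast this
    refine ⟨fun x => (z x).toNat, fun h => ?_, fun k => ?_⟩
    · have h1 : (z x).toNat = 0 := congrFun h x
      have h2 : z x = 0 := by rw [← hznn x, h1]; rfl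
      have h3 := hz x (Finset.mem_univ x)
      rw [h2] at h3
      have := mul_pos hx hDQ
      simp at h3
      rcases h3 with h3 | h3 <;> simp [h3] at this
    · simp only [hznn]
      have h1 := congrFun hc k
      simp only [Finset.sum_apply, Pi.smul_apply, smul_eq_mul, Pi.zero_apply] at h1
      have h2 : ∑ x, (z x : ℚ) * w x k = 0 := by
        have : ∑ x, (z x : ℚ) * w x k = D * ∑ x, c x * w x k := by
          rw [Finset.mul_sum]
          refine Finset.sum_congr rfl fun x hx => ?_
          rw [← hz x hx]
          ring
        rw [this, h1, mul_zero]
      exact_mod_cast h2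
  · right
    obtain ⟨D, z, hD, hz⟩ := exists_pos_mul_eq_intCast Finset.univ y
    refine ⟨z, fun x => ?_⟩
    have h1 := hy x (Finset.mem_univ x)
    have h2 : (0 : ℚ) < ∑ k, (z k : ℚ) * w x k := by
      have : ∑ k, (z k : ℚ) * w x k = D * ∑ k, y k * w x k := by
        rw [Finset.mul_sum]
        refine Finset.sum_congr rfl fun k hk => ?_
        rw [← hz k hk]
        ring
      rw [this]
      exact mul_pos (by exact_mod_cast hD) h1
    exact_mod_cast h2

/-- A functional that is positive on finitely many integer vectors can be perturbed to a real
functional that is injective on integer vectors and still positive. -/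
theorem exists_generic_functional {K X : Type*} [Fintype K] [Fintype X] (w : X → K → ℤ)
    (y : K → ℤ) (hy : ∀ x, 0 < ∑ k, y k * w x k) :
    ∃ l : K → ℝ, (∀ z : K → ℤ, ∑ k, (z k : ℝ) * l k = 0 → z = 0) ∧
      ∀ x, 0 < ∑ k, (w x k : ℝ) * l k := by
  classical
  -- Powers of a transcendental number give the perturbation its injectivity; the integer
  -- functional, scaled by a large `M`, keeps the positivity.
  have ht := transcendental_liouvilleNumber (m := 2) le_rfl
  set t := liouvilleNumber ((2 : ℕ) : ℝ) with htdef
  let e := Fintype.equivFin K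
  obtain ⟨M, hM⟩ := exists_nat_gt (∑ x, |∑ k, (w x k : ℝ) * t ^ ((e k : ℕ) + 1)|)
  refine ⟨fun k => M * y k + t ^ ((e k : ℕ) + 1), fun z hz => ?_, fun x => ?_⟩
  · let P : Polynomial ℤ := Polynomial.C (M * ∑ k, z k * y k) +
      ∑ k, Polynomial.C (z k) * Polynomial.X ^ ((e k : ℕ) + 1)
    have hP : P = 0 := by
      refine (transcendental_iff.mp ht) P ?_
      simp only [P, map_add, map_sum, map_mul, map_pow, Polynomial.aeval_C, Polynomial.aeval_X,
        algebraMap_int_eq]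
      simp only [eq_intCast, map_natCast]
      rw [← hz]
      push_cast
      rw [Finset.mul_sum, ← Finset.sum_add_distrib]
      refine Finset.sum_congr rfl fun k _ => ?_
      ring
    ext k
    have := congrArg (Polynomial.coeff · ((e k : ℕ) + 1)) hP
    simp only [P, Polynomial.coeff_add, Polynomial.coeff_C_succ, Polynomial.finsetSum_coeff,
      Polynomial.coeff_C_mul, Polynomial.coeff_X_pow, Polynomial.coeff_zero, zero_add,
      add_left_inj, Fin.val_inj, e.injective.eq_iff] at this
    simpa using this
  · have h1 : (1 : ℝ) ≤ ∑ k, (y k : ℝ) * w x k := by exact_mod_cast hy x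
    have h2 := Finset.single_le_sum (f := fun x => |∑ k, (w x k : ℝ) * t ^ ((e k : ℕ) + 1)|)
      (fun _ _ => abs_nonneg _) (Finset.mem_univ x)
    have h3 := neg_abs_le (∑ k, (w x k : ℝ) * t ^ ((e k : ℕ) + 1))
    have h4 : ∑ k, (w x k : ℝ) * (M * y k + t ^ ((e k : ℕ) + 1)) =
        M * ∑ k, (y k : ℝ) * w x k + ∑ k, (w x k : ℝ) * t ^ ((e k : ℕ) + 1) := by
      rw [Finset.mul_sum, ← Finset.sum_add_distrib]
      exact Finset.sum_congr rfl fun k _ => by ring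
    rw [h4]
    have h5 : (M : ℝ) * 1 ≤ M * ∑ k, (y k : ℝ) * w x k :=
      mul_le_mul_of_nonneg_left h1 (by positivity)
    linarith

/-! ### Walks in digraphs without parallel edges -/

/-- `N p L` counts the walks of length `L` from `p` to `fin` in the digraph with an edge of length
`len p q` from `p` to `q` whenever `0 < len p q`. The vertex `fin` has no outgoing edges. -/
structure IsSimpleWalkCount {Q : Type} [Fintype Q] (len : Q → Q → ℝ) (fin : Q)
    (N : Q → ℝ → ℝ≥0∞) : Prop where
  fin_out : ∀ q, len fin q ≤ 0
  of_neg : ∀ p L, L < 0 → N p L = 0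
  first_edge : ∀ p L, N p L = (open Classical in if p = fin ∧ L = 0 then 1 else 0) +
    ∑ q, if 0 < len p q then N q (L - len p q) else 0

/-- Functions of the length counting the walks between two fixed vertices. -/
def IsWalkable (g : ℝ → ℝ≥0∞) : Prop :=
  ∃ (Q : Type) (_ : Fintype Q) (len : Q → Q → ℝ) (fin : Q) (N : Q → ℝ → ℝ≥0∞) (s : Q),
    IsSimpleWalkCount len fin N ∧ N s = g

theorem IsWalkable.of_neg {g : ℝ → ℝ≥0∞} (hg : IsWalkable g) {L : ℝ} (hL : L < 0) : g L = 0 := by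
  obtain ⟨Q, _, len, fin, N, s, h, rfl⟩ := hg
  exact h.of_neg s L hL

open Classical in
theorem isWalkable_indicator_zero : IsWalkable fun L => if L = 0 then 1 else 0 := by
  refine ⟨Unit, inferInstance, fun _ _ => 0, (), fun _ L => if L = 0 then 1 else 0, (),
    ⟨by simp, ?_, ?_⟩, rfl⟩
  · intro p L hL
    simp [hL.ne]
  · simp

theorem isWalkable_zero : IsWalkable fun _ => 0 := by
  classical
  refine ⟨Bool, inferInstance, fun _ _ => 0, true, fun b L => if b = true ∧ L = 0 then 1 else 0,
    false, ⟨by simp, ?_, ?_⟩, by simp⟩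
  · intro p L hL
    simp [hL.ne]
  · simp

/-- Pascal's rule as a classification of words in two loops by their first letter. -/
theorem choose_tsum_recursion (G : ℕ → ℕ → ℝ≥0∞) :
    ∑' c : ℕ × ℕ, ((c.1 + c.2).choose c.1 : ℝ≥0∞) * G c.1 c.2 =
      G 0 0 + ∑' c : ℕ × ℕ, ((c.1 + c.2).choose c.1 : ℝ≥0∞) * G (c.1 + 1) c.2 +
        ∑' c : ℕ × ℕ, ((c.1 + c.2).choose c.1 : ℝ≥0∞) * G c.1 (c.2 + 1) := by
  let t0 : ℕ × ℕ → ℝ≥0∞ := fun c => if c = (0, 0) then G 0 0 else 0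
  let t1 : ℕ × ℕ → ℝ≥0∞ := fun c =>
    if c.1 = 0 then 0 else ((c.1 - 1 + c.2).choose (c.1 - 1) : ℝ≥0∞) * G c.1 c.2
  let t2 : ℕ × ℕ → ℝ≥0∞ := fun c =>
    if c.2 = 0 then 0 else ((c.1 + (c.2 - 1)).choose c.1 : ℝ≥0∞) * G c.1 c.2
  have hsplit : ∀ c : ℕ × ℕ, ((c.1 + c.2).choose c.1 : ℝ≥0∞) * G c.1 c.2 = t0 c + t1 c + t2 c := by
    rintro ⟨_ | a, _ | b⟩
    · simp [t0, t1, t2]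
    · simp [t0, t1, t2]
    · simp [t0, t1, t2]
    · have h : (a + 1 + (b + 1)).choose (a + 1) =
          (a + (b + 1)).choose a + (a + 1 + b).choose (a + 1) := by
        rw [show a + 1 + (b + 1) = (a + (b + 1)) + 1 by ring, Nat.choose_succ_succ,
          show a + (b + 1) = a + 1 + b by ring]
      simp only [t0, t1, t2, h]
      simp [add_mul]
  rw [tsum_congr hsplit, ENNReal.tsum_add, ENNReal.tsum_add]
  congr 1
  · congr 1
    · exact tsum_ite_eq _ _
    · have hinj : Function.Injective fun c : ℕ × ℕ => (c.1 + 1, c.2) := by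
        rintro ⟨a, b⟩ ⟨a', b'⟩ h
        simpa using h
      rw [← hinj.tsum_eq]
      · simp [t1]
      · rintro ⟨_ | a, b⟩ hc
        · simp [t1] at hc
        · exact ⟨(a, b), rfl⟩
  · have hinj : Function.Injective fun c : ℕ × ℕ => (c.1, c.2 + 1) := by
      rintro ⟨a, b⟩ ⟨a', b'⟩ h
      simpa using h
    rw [← hinj.tsum_eq]
    · simp [t2]
    · rintro ⟨a, _ | b⟩ hc
      · simp [t2] at hc
      · exact ⟨(a, b), rfl⟩

/-- Prepending two loops of lengths `x` and `y` and an edge of length `1`. -/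
theorem IsWalkable.block {g : ℝ → ℝ≥0∞} (hg : IsWalkable g) {x y : ℝ} (hx : 0 < x) (hy : 0 < y) :
    IsWalkable fun L =>
      ∑' c : ℕ × ℕ, ((c.1 + c.2).choose c.1 : ℝ≥0∞) * g (L - 1 - c.1 * x - c.2 * y) := by
  classical
  set g' : ℝ → ℝ≥0∞ := fun L =>
      ∑' c : ℕ × ℕ, ((c.1 + c.2).choose c.1 : ℝ≥0∞) * g (L - 1 - c.1 * x - c.2 * y) with hg'
  have hneg : ∀ L, L < 0 → g' L = 0 := by
    intro L hL
    simp only [hg', ENNReal.tsum_eq_zero]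
    intro c
    rw [hg.of_neg, mul_zero]
    have : 0 ≤ c.1 * x := by positivity
    have : 0 ≤ c.2 * y := by positivity
    linarith
  have hrec : ∀ L, g' L = g (L - 1) + g' (L - x) + g' (L - y) := by
    intro L
    simp only [hg']
    rw [choose_tsum_recursion fun a b => g (L - 1 - a * x - b * y)]
    congr 1
    · congr 1
      · simp
      · refine tsum_congr fun c => ?_
        congr 2
        push_cast
        ring
    · refine tsum_congr fun c => ?_
      congr 2
      push_cast
      ring
  obtain ⟨Q, _, len, fin, N, s, h, rfl⟩ := hg
  -- The new start `none` carries both loops. Each loop is subdivided by a midpoint, since a length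
  -- function on pairs allows no parallel edges.
  let len' : Option (Bool ⊕ Q) → Option (Bool ⊕ Q) → ℝ
    | none, some (.inl false) => x / 2
    | none, some (.inl true) => y / 2
    | some (.inl false), none => x / 2
    | some (.inl true), none => y / 2
    | none, some (.inr q) => if q = s then 1 else 0
    | some (.inr p), some (.inr q) => len p q
    | _, _ => 0
  let N' : Option (Bool ⊕ Q) → ℝ → ℝ≥0∞
    | none, L => g' L
    | some (.inl false), L => g' (L - x / 2)
    | some (.inl true), L => g' (L - y / 2)
    | some (.inr q), L => N q L
  refine ⟨Option (Bool ⊕ Q), inferInstance, len', some (.inr fin), N', none, ⟨?_, ?_, ?_⟩, rfl⟩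
  · rintro (_ | (_ | _) | q)
    · simp [len']
    · simp [len']
    · simp [len']
    · exact h.fin_out q
  · rintro (_ | (_ | _) | q) L hL
    · exact hneg L hL
    · exact hneg _ (by linarith)
    · exact hneg _ (by linarith)
    · exact h.of_neg q L hL
  · have hite : ∀ q, (0 < if q = s then (1 : ℝ) else 0) ↔ q = s := by
      intro q
      split_ifs with hq <;> simp [hq]
    rintro (_ | (_ | _) | q) L
    · simp only [N', len', Fintype.sum_option, Fintype.sum_sum_type, Fintype.sum_bool, hite]
      rw [hrec]
      simp [hx, hy, sub_sub]
      ring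
    · simp [N', len', Fintype.sum_option, hx]
    · simp [N', len', Fintype.sum_option, hy]
    · simp only [N', len', Fintype.sum_option, Fintype.sum_sum_type, Fintype.sum_bool]
      rw [h.first_edge]
      simp

/-- A new source branches into both graphs by edges of lengths `x` and `y`, and edges of length `1`
merge the two ends into a new end without outgoing edges. -/
theorem IsWalkable.add {g₁ g₂ : ℝ → ℝ≥0∞} (h₁ : IsWalkable g₁) (h₂ : IsWalkable g₂) {x y : ℝ}
    (hx : 0 < x) (hy : 0 < y) : IsWalkable fun L => g₁ (L - x - 1) + g₂ (L - y - 1) := by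
  classical
  obtain ⟨Q₁, _, len₁, fin₁, N₁, s₁, h₁, rfl⟩ := h₁
  obtain ⟨Q₂, _, len₂, fin₂, N₂, s₂, h₂, rfl⟩ := h₂
  let len' : Bool ⊕ (Q₁ ⊕ Q₂) → Bool ⊕ (Q₁ ⊕ Q₂) → ℝ
    | .inl false, .inr (.inl q) => if q = s₁ then x else 0
    | .inl false, .inr (.inr q) => if q = s₂ then y else 0
    | .inr (.inl q), .inl true => if q = fin₁ then 1 else 0
    | .inr (.inr q), .inl true => if q = fin₂ then 1 else 0
    | .inr (.inl p), .inr (.inl q) => len₁ p q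
    | .inr (.inr p), .inr (.inr q) => len₂ p q
    | _, _ => 0
  let N' : Bool ⊕ (Q₁ ⊕ Q₂) → ℝ → ℝ≥0∞
    | .inl false, L => N₁ s₁ (L - x - 1) + N₂ s₂ (L - y - 1)
    | .inl true, L => if L = 0 then 1 else 0
    | .inr (.inl q), L => N₁ q (L - 1)
    | .inr (.inr q), L => N₂ q (L - 1)
  refine ⟨Bool ⊕ (Q₁ ⊕ Q₂), inferInstance, len', .inl true, N', .inl false, ⟨?_, ?_, ?_⟩, rfl⟩
  · rintro ((_ | _) | _ | _) <;> simp [len']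
  · rintro ((_ | _) | q | q) L hL
    · simp only [N']
      rw [h₁.of_neg _ _ (by linarith), h₂.of_neg _ _ (by linarith), add_zero]
    · simp [N', hL.ne]
    · exact h₁.of_neg _ _ (by linarith)
    · exact h₂.of_neg _ _ (by linarith)
  · have hite : ∀ {X : Type} (q s : X) {x : ℝ}, 0 < x →
        ((0 < if q = s then x else 0) ↔ q = s) := by
      intro X q s x hx
      split_ifs with hq <;> simp [hq, hx]
    rintro ((_ | _) | q | q) L
    · simp only [N', len', Fintype.sum_sum_type, Fintype.sum_bool, hite _ _ hx, hite _ _ hy]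
      simp
    · simp [N', len']
    · simp only [N', len', Fintype.sum_sum_type, Fintype.sum_bool, hite _ _ one_pos]
      rw [h₁.first_edge]
      by_cases hq : q = fin₁ <;> simp [hq, sub_right_comm]
    · simp only [N', len', Fintype.sum_sum_type, Fintype.sum_bool, hite _ _ one_pos]
      rw [h₂.first_edge]
      by_cases hq : q = fin₂ <;> simp [hq, sub_right_comm]

/-- Sequences obtained by evaluating a walk count at the points `n + η`. -/
def IsWalkSequence (f : ℕ → ℝ≥0∞) : Prop :=
  ∃ g, IsWalkable g ∧ ∃ η : ℝ, ∀ n : ℕ, f n = g (n + η)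

theorem isWalkSequence_zero : IsWalkSequence fun _ => 0 :=
  ⟨_, isWalkable_zero, 0, fun _ => rfl⟩

theorem IsWalkSequence.add {f₁ f₂ : ℕ → ℝ≥0∞} (h₁ : IsWalkSequence f₁) (h₂ : IsWalkSequence f₂) :
    IsWalkSequence fun n => f₁ n + f₂ n := by
  obtain ⟨g₁, hg₁, η₁, h₁⟩ := h₁
  obtain ⟨g₂, hg₂, η₂, h₂⟩ := h₂
  have hm₁ := le_max_left η₁ η₂
  have hm₂ := le_max_right η₁ η₂
  -- The branch lengths are positive and equalize the offsets: subtracting each of them and `1` from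
  -- `max η₁ η₂ + 2` leaves `η₁` and `η₂`.
  refine ⟨_, hg₁.add hg₂ (x := max η₁ η₂ + 1 - η₁) (y := max η₁ η₂ + 1 - η₂) (by linarith)
    (by linarith), max η₁ η₂ + 2, fun n => ?_⟩
  simp only [h₁, h₂]
  congr 2 <;> ring

theorem isWalkSequence_sum {X : Type*} (s : Finset X) (f : X → ℕ → ℝ≥0∞)
    (h : ∀ x ∈ s, IsWalkSequence (f x)) : IsWalkSequence fun n => ∑ x ∈ s, f x n := by
  classical
  induction s using Finset.induction_on with
  | empty => simpa using isWalkSequence_zero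
  | insert x s hx ih =>
    simp only [Finset.sum_insert hx]
    exact (h x (Finset.mem_insert_self x s)).add (ih fun y hy => h y (Finset.mem_insert_of_mem hy))

-- A chain of `m` blocks. The binomial coefficient counts the orders in which the two loops of a
-- block are traversed, and the `m` connecting edges of length `1` contribute the summand `m`.
open Classical in
theorem isWalkable_blocks_fin (m : ℕ) : ∀ x y : Fin m → ℝ, (∀ j, 0 < x j) → (∀ j, 0 < y j) →
    IsWalkable fun L => ∑' c : Fin m → ℕ × ℕ,
      if ∑ j, ((c j).1 * x j + (c j).2 * y j) + m = L then
        ∏ j, (((c j).1 + (c j).2).choose (c j).1 : ℝ≥0∞) else 0 := by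
  induction m with
  | zero =>
    intro x y _ _
    convert isWalkable_indicator_zero using 2 with L
    rw [tsum_eq_single default fun c hc => absurd (Subsingleton.elim c default) hc]
    simp [eq_comm]
  | succ m ih =>
    intro x y hx hy
    convert (ih (fun j => x j.succ) (fun j => y j.succ) (fun j => hx _) fun j => hy _).block
      (hx 0) (hy 0) using 2 with L
    rw [← (Fin.consEquiv fun _ : Fin (m + 1) => ℕ × ℕ).tsum_eq, ENNReal.tsum_prod']
    refine tsum_congr fun c => ?_
    rw [← ENNReal.tsum_mul_left]
    refine tsum_congr fun v => ?_
    simp only [Fin.consEquiv_apply, Fin.sum_univ_succ, Fin.prod_univ_succ, Fin.cons_zero,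
      Fin.cons_succ, mul_ite, mul_zero]
    congr 1
    rw [eq_iff_iff]
    push_cast
    constructor <;> intro h <;> linarith

open Classical in
theorem isWalkable_blocks {J : Type} [Fintype J] (x y : J → ℝ) (hx : ∀ j, 0 < x j)
    (hy : ∀ j, 0 < y j) :
    IsWalkable fun L => ∑' c : J → ℕ × ℕ,
      if ∑ j, ((c j).1 * x j + (c j).2 * y j) + Fintype.card J = L then
        ∏ j, (((c j).1 + (c j).2).choose (c j).1 : ℝ≥0∞) else 0 := by
  let e := Fintype.equivFin J
  convert isWalkable_blocks_fin (Fintype.card J) (x ∘ e.symm) (y ∘ e.symm) (fun _ => hx _)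
    fun _ => hy _ using 2 with L
  rw [← (e.arrowCongr (Equiv.refl (ℕ × ℕ))).tsum_eq]
  refine tsum_congr fun c => ?_
  simp only [Equiv.arrowCongr_apply, Equiv.coe_refl, Function.comp_apply, id_eq]
  rw [e.symm.sum_comp fun j => ((c j).1 * x j + (c j).2 * y j),
    e.symm.prod_comp fun j => (((c j).1 + (c j).2).choose (c j).1 : ℝ≥0∞)]

/-! ### Binomial multisums are walk sequences -/

section SystemSum

variable {J K : Type} [Fintype J]

/-- The coordinates of a family of pairs. -/
def unpair (c : J → ℕ × ℕ) : J ⊕ J → ℕ := Sum.elim (fun j => (c j).1) fun j => (c j).2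

open Classical in
/-- The sum of products of binomial coefficients over all natural solutions of a system of
equations in which a distinguished coordinate has the prescribed value `n`. -/
noncomputable def systemSum (j₀ : J) (φ : K → (J ⊕ J → ℕ) → ℤ) (n : ℕ) : ℝ≥0∞ :=
  ∑' c : J → ℕ × ℕ, if (c j₀).1 = n ∧ ∀ k, φ k (unpair c) = 0 then
    ∏ j, (((c j).1 + (c j).2).choose (c j).1 : ℝ≥0∞) else 0

theorem systemSum_eq_top {j₀ : J} {φ : K → (J ⊕ J → ℕ) → ℤ} {n : ℕ}
    (h : {c : J → ℕ × ℕ | (c j₀).1 = n ∧ ∀ k, φ k (unpair c) = 0}.Infinite) :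
    systemSum j₀ φ n = ⊤ := by
  classical
  by_contra hne
  have := ENNReal.finite_const_le_of_tsum_ne_top hne one_ne_zero
  refine h (this.subset fun c hc => ?_)
  simp only [Set.mem_ofPred_eq] at hc ⊢
  rw [if_pos hc, ← Nat.cast_prod]
  have : 1 ≤ ∏ j, ((c j).1 + (c j).2).choose (c j).1 :=
    Finset.prod_pos fun j _ => Nat.choose_pos (Nat.le_add_right _ _)
  exact_mod_cast this

/-- Gordan's alternative is applied to the columns of the system. A nonnegative relation would
produce infinitely many solutions; otherwise a generic positive functional assigns to every variable
a positive loop length so that one length equation is equivalent to the whole system. -/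
theorem isWalkSequence_systemSum [Fintype K] (j₀ : J) (φ : K → (J ⊕ J → ℕ) → ℤ)
    (hφ : ∀ k, IsAff (φ k)) (htop : ∀ n, systemSum j₀ φ n ≠ ⊤) :
    IsWalkSequence (systemSum j₀ φ) := by
  classical
  choose a e hφ using hφ
  let w : J ⊕ J → Option K → ℤ := fun x k => k.elim (if x = .inl j₀ then 1 else 0) fun k => a k x
  have hw : ∀ (u : J ⊕ J → ℕ) (n : ℕ), (u (.inl j₀) = n ∧ ∀ k, φ k u = 0) ↔
      ∀ k, ∑ x, (u x : ℤ) * w x k = k.elim (n : ℤ) fun k => -e k := by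
    intro u n
    rw [Option.forall]
    refine and_congr ?_ (forall_congr' fun k => ?_)
    · simp [w]
    · simp only [hφ, w, Option.elim_some, mul_comm (u _ : ℤ)]
      omega
  by_cases hex : ∃ (n : ℕ) (c : J → ℕ × ℕ), (c j₀).1 = n ∧ ∀ k, φ k (unpair c) = 0
  swap
  · have : systemSum j₀ φ = fun _ => 0 := by
      ext n
      push Not at hex
      refine ENNReal.tsum_eq_zero.mpr fun c => if_neg fun hc => ?_
      obtain ⟨k, hk⟩ := hex n c hc.1
      exact hk (hc.2 k)
    rw [this]
    exact isWalkSequence_zero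
  obtain ⟨n₀, c₀, hc₀⟩ := hex
  rcases gordan_int w with ⟨c, hc, hcw⟩ | ⟨y, hy⟩
  · exfalso
    refine htop n₀ (systemSum_eq_top ?_)
    -- Multiples of the relation can be added to one solution without changing any equation.
    let s : ℕ → J → ℕ × ℕ := fun t j => ((c₀ j).1 + t * c (.inl j), (c₀ j).2 + t * c (.inr j))
    have hs : ∀ t x, unpair (s t) x = unpair c₀ x + t * c x := by
      rintro t (x | x) <;> rfl
    refine Set.infinite_of_injective_forall_mem (f := s) ?_ fun t => ?_
    · intro t t' htt
      obtain ⟨x, hx⟩ := Function.ne_iff.mp hc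
      have := congrArg (unpair · x) htt
      simp only [hs, add_right_inj] at this
      exact Nat.eq_of_mul_eq_mul_right (Nat.pos_of_ne_zero hx) this
    · refine (hw (unpair (s t)) n₀).mpr fun k => ?_
      rw [← (hw (unpair c₀) n₀).mp hc₀ k]
      simp only [hs]
      push_cast
      simp only [add_mul, Finset.sum_add_distrib, mul_assoc, ← Finset.mul_sum, hcw, mul_zero,
        add_zero]
  -- The unit vector at `none` is added so that `l none > 0`; dividing by it gives the parameter `n`
  -- weight `1`. Raising `y` at `none` keeps it positive on the columns, whose entries there are `0`
  -- or `1`.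
  · let w' : Option (J ⊕ J) → Option K → ℤ := fun x => x.elim (Pi.single none 1) w
    let y' : Option K → ℤ := y + Pi.single none (|y none| + 1)
    obtain ⟨l, hl, hlpos⟩ := exists_generic_functional w' y' (by
      rintro (_ | x)
      · simp only [w', y', Option.elim_none, Pi.single_apply, mul_ite, mul_one, mul_zero,
          Finset.sum_ite_eq', Finset.mem_univ, if_true, Pi.add_apply]
        have := neg_abs_le (y none)
        linarith
      · simp only [w', y', Option.elim_some, Pi.add_apply, add_mul, Finset.sum_add_distrib]
        refine add_pos_of_pos_of_nonneg (hy x) ?_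
        simp only [Pi.single_apply, ite_mul, zero_mul, Finset.sum_ite_eq', Finset.mem_univ, if_true,
          w, Option.elim_none]
        split_ifs <;> positivity)
    have hl0 : 0 < l none := by
      have := hlpos none
      simpa [w', Pi.single_apply] using this
    let W : J ⊕ J → ℝ := fun x => (∑ k, (w x k : ℝ) * l k) / l none
    have hW : ∀ x, 0 < W x := fun x => div_pos (hlpos (some x)) hl0
    refine ⟨_, isWalkable_blocks (fun j => W (.inl j)) (fun j => W (.inr j)) (fun j => hW _)
      fun j => hW _, (∑ k, -(e k : ℝ) * l (some k)) / l none + Fintype.card J, fun n => ?_⟩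
    refine tsum_congr fun c => ?_
    congr 1
    rw [eq_iff_iff, ← add_assoc, add_left_inj]
    refine (hw (unpair c) n).trans ?_
    have hsum : ∑ j, ((c j).1 * W (.inl j) + (c j).2 * W (.inr j)) =
        ∑ x, (unpair c x : ℝ) * W x := by
      rw [Fintype.sum_sum_type, Finset.sum_add_distrib]
      rfl
    -- The defect of the system is an integer vector, so it vanishes as soon as the generic
    -- functional does.
    let z : Option K → ℤ := fun k =>
      ∑ x, (unpair c x : ℤ) * w x k - k.elim (n : ℤ) fun k => -e k
    have hz : (∑ k, (z k : ℝ) * l k) / l none = ∑ x, (unpair c x : ℝ) * W x -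
        (n + (∑ k, -(e k : ℝ) * l (some k)) / l none) := by
      have h1 : ∑ x, (unpair c x : ℝ) * W x =
          (∑ k, (∑ x, (unpair c x : ℝ) * w x k) * l k) / l none := by
        simp only [W, mul_div_assoc', ← Finset.sum_div, Finset.sum_mul, Finset.mul_sum]
        rw [Finset.sum_comm]
        simp only [mul_assoc]
      have h2 : (n : ℝ) + (∑ k, -(e k : ℝ) * l (some k)) / l none =
          (n * l none + ∑ k, -(e k : ℝ) * l (some k)) / l none := by
        field_simp
      rw [h1, h2, ← sub_div]
      congr 1
      simp only [z, Int.cast_sub, sub_mul, Finset.sum_sub_distrib]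
      congr 1
      · push_cast
        rfl
      · rw [Fintype.sum_option]
        simp
    rw [hsum]
    constructor
    · intro h
      have : z = 0 := funext fun k => sub_eq_zero.mpr (h k)
      rw [this] at hz
      simp only [Pi.zero_apply, Int.cast_zero, zero_mul, Finset.sum_const_zero, zero_div] at hz
      linarith
    · intro h k
      rw [h, sub_self, div_eq_zero_iff, or_iff_left hl0.ne'] at hz
      exact sub_eq_zero.mp (congrFun (hl z hz) k)

end SystemSum

/-- The integers as two copies of the natural numbers. -/
def signEquiv : Bool × ℕ ≃ ℤ where
  toFun x := if x.1 then x.2 else -1 - x.2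
  invFun z := if 0 ≤ z then (true, z.toNat) else (false, (-1 - z).toNat)
  left_inv := by
    rintro ⟨_ | _, u⟩
    · simp only [Bool.false_eq_true, if_false]
      rw [if_neg (by omega)]
      simp
    · simp
  right_inv z := by
    by_cases h : 0 ≤ z
    · simp [h]
    · simp only [if_neg h, Bool.false_eq_true, if_false]
      omega

/-- The regular values (for `true`) and the exceptional value at `(-1, 0)` (for `false`) of the
extended binomial coefficient. -/
def binomPart : Bool → ℤ → ℤ → ℕ
  | true, a, b => if 0 ≤ b ∧ b ≤ a then a.toNat.choose b.toNat else 0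
  | false, a, b => if a = -1 ∧ b = 0 then 1 else 0

theorem binom_eq_sum_binomPart (a b : ℤ) : binom a b = ∑ s, binomPart s a b := by
  simp only [Fintype.sum_bool, binomPart, binom]
  split_ifs <;> omega

theorem IsAff.ite {ι : Type} [Fintype ι] {φ ψ : (ι → ℕ) → ℤ} (hφ : IsAff φ) (b : Bool)
    (hψ : IsAff ψ) : IsAff fun p => if b then φ p else ψ p := by
  cases b
  · simpa using hψ
  · simpa using hφ

theorem AffineForm.isAff_eval {ι : Type} [Fintype ι] {d : ℕ} (α : AffineForm d)
    (v : Fin d → (ι → ℕ) → ℤ) (hv : ∀ j, IsAff (v j)) (i : ι) :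
    IsAff fun p => α.eval (fun j => v j p) (p i) := by
  unfold AffineForm.eval
  exact ((isAff_sum _ _ fun j _ => (hv j).const_mul _).add ((isAff_coord i).const_mul _)).add
    (isAff_const _)

theorem isAff_signEquiv {ι : Type} [Fintype ι] (b : Bool) (i : ι) :
    IsAff fun p : ι → ℕ => signEquiv (b, p i) := by
  cases b
  · exact (isAff_const (-1)).sub (isAff_coord i)
  · exact isAff_coord i

/-! ### Splitting a multisum into system sums -/

section Orthant

variable {r d : ℕ} (α β : Fin r → AffineForm d) (σ : Fin d → Bool) (S : Fin r → Bool)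

/-- The part of a binomial multisum that comes from one orthant and one choice of regular or
exceptional values of the binomial coefficients. -/
noncomputable def orthantSum (n : ℕ) : ℝ≥0∞ :=
  ∑' u : Fin d → ℕ, ∏ i, (binomPart (S i) ((α i).eval (fun j => signEquiv (σ j, u j)) n)
    ((β i).eval (fun j => signEquiv (σ j, u j)) n) : ℝ≥0∞)

theorem tsum_prod_binom_eq_sum_orthantSum (n : ℕ) :
    ∑' v : Fin d → ℤ, ((∏ i, binom ((α i).eval v n) ((β i).eval v n) : ℕ) : ℝ≥0∞) =
      ∑ σ, ∑ S, orthantSum α β σ S n := by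
  rw [← ((Equiv.arrowProdEquivProdArrow (Fin d) (fun _ => Bool) fun _ => ℕ).symm.trans
    ((Equiv.refl (Fin d)).arrowCongr signEquiv)).tsum_eq, ENNReal.tsum_prod', tsum_fintype]
  refine Finset.sum_congr rfl fun σ _ => ?_
  unfold orthantSum
  rw [← Summable.tsum_finsetSum fun _ _ => ENNReal.summable]
  refine tsum_congr fun u => ?_
  simp only [binom_eq_sum_binomPart, Finset.prod_univ_sum, Fintype.piFinset_univ, Nat.cast_sum,
    Nat.cast_prod]
  rfl

/-- Index set of the blocks: the parameter `n`, the summation variables, and the binomial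
coefficients. -/
abbrev OrthantIndex (r d : ℕ) : Type := Option (Fin d ⊕ Fin r)

/-- The equations describing an orthant sum as a system sum. -/
def orthantEquation : Option (Fin d) ⊕ (Fin r × Fin 4) →
    (OrthantIndex r d ⊕ OrthantIndex r d → ℕ) → ℤ
  -- Blocks for `n` and the variables have second entry `0`, hence binomial coefficient `1`. A
  -- regular coefficient has the block `(b, a - b)`; an exceptional one has `(0, 0)` together with
  -- `a = -1` and `b = 0`.
  | .inl none, p => p (.inr none)
  | .inl (some j), p => p (.inr (some (.inl j)))
  | .inr (i, 0), p => p (.inl (some (.inr i))) - if S i then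
      (β i).eval (fun j => signEquiv (σ j, p (.inl (some (.inl j))))) (p (.inl none)) else 0
  | .inr (i, 1), p => if S i then p (.inl (some (.inr i))) + p (.inr (some (.inr i))) -
      (α i).eval (fun j => signEquiv (σ j, p (.inl (some (.inl j))))) (p (.inl none))
      else p (.inr (some (.inr i)))
  | .inr (i, 2), p => if S i then 0 else
      (α i).eval (fun j => signEquiv (σ j, p (.inl (some (.inl j))))) (p (.inl none)) + 1
  | .inr (i, 3), p => if S i then 0 else
      (β i).eval (fun j => signEquiv (σ j, p (.inl (some (.inl j))))) (p (.inl none))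

theorem isAff_orthant_eval (γ : AffineForm d) :
    IsAff fun p : OrthantIndex r d ⊕ OrthantIndex r d → ℕ =>
      γ.eval (fun j => signEquiv (σ j, p (.inl (some (.inl j))))) (p (.inl none)) := by
  have h := fun j : Fin d => isAff_signEquiv (ι := OrthantIndex r d ⊕ OrthantIndex r d) (σ j)
    (.inl (some (.inl j)))
  have := γ.isAff_eval _ h (.inl none)
  exact this

theorem isAff_orthantEquation (k : Option (Fin d) ⊕ (Fin r × Fin 4)) :
    IsAff (orthantEquation α β σ S k) := by
  have hα : ∀ i, IsAff fun p : OrthantIndex r d ⊕ OrthantIndex r d → ℕ =>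
      (α i).eval (fun j => signEquiv (σ j, p (.inl (some (.inl j))))) (p (.inl none)) :=
    fun i => isAff_orthant_eval σ (α i)
  have hβ : ∀ i, IsAff fun p : OrthantIndex r d ⊕ OrthantIndex r d → ℕ =>
      (β i).eval (fun j => signEquiv (σ j, p (.inl (some (.inl j))))) (p (.inl none)) :=
    fun i => isAff_orthant_eval σ (β i)
  rcases k with (_ | j) | ⟨i, k⟩
  · exact isAff_coord _
  · exact isAff_coord _
  · fin_cases k
    · exact (isAff_coord (.inl (some (.inr i)))).sub ((hβ i).ite (S i) (isAff_const 0))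
    · exact (((isAff_coord (.inl (some (.inr i)))).add (isAff_coord (.inr (some (.inr i))))).sub
        (hα i)).ite (S i) (isAff_coord (.inr (some (.inr i))))
    · exact (isAff_const 0).ite (S i) ((hα i).add (isAff_const 1))
    · exact (isAff_const 0).ite (S i) (hβ i)

theorem orthantEquation_iff (c : OrthantIndex r d → ℕ × ℕ) :
    (∀ k, orthantEquation α β σ S k (unpair c) = 0) ↔
      (c none).2 = 0 ∧ (∀ j, (c (some (.inl j))).2 = 0) ∧ ∀ i,
        let a := (α i).eval (fun j => signEquiv (σ j, (c (some (.inl j))).1)) (c none).1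
        let b := (β i).eval (fun j => signEquiv (σ j, (c (some (.inl j))).1)) (c none).1
        if S i then ((c (some (.inr i))).1 : ℤ) = b ∧
          ((c (some (.inr i))).1 + (c (some (.inr i))).2 : ℤ) = a
        else c (some (.inr i)) = (0, 0) ∧ a = -1 ∧ b = 0 := by
  rw [Sum.forall, Option.forall, Prod.forall, and_assoc]
  refine and_congr (by simp [orthantEquation, unpair])
    (and_congr (by simp [orthantEquation, unpair]) (forall_congr' fun i => ?_))
  rw [Fin.forall_fin_succ, Fin.forall_fin_succ, Fin.forall_fin_succ, Fin.forall_fin_succ]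
  cases hS : S i
  · simp [orthantEquation, unpair, hS, Prod.ext_iff, and_assoc, add_eq_zero_iff_eq_neg]
  · simp [orthantEquation, unpair, hS, sub_eq_zero]

/-- The equations determine every block from the variables `u`, so solutions are values of `E`. A
`u` for which `E u` is not a solution has a vanishing factor in the orthant sum. -/
theorem orthantSum_eq_systemSum :
    orthantSum α β σ S = systemSum none (orthantEquation α β σ S) := by
  classical
  ext n
  let a : Fin r → (Fin d → ℕ) → ℤ := fun i u => (α i).eval (fun j => signEquiv (σ j, u j)) n
  let b : Fin r → (Fin d → ℕ) → ℤ := fun i u => (β i).eval (fun j => signEquiv (σ j, u j)) n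
  let E : (Fin d → ℕ) → OrthantIndex r d → ℕ × ℕ := fun u x =>
    x.elim (n, 0) (Sum.elim (fun j => (u j, 0)) fun i =>
      if S i then ((b i u).toNat, (a i u - b i u).toNat) else (0, 0))
  have hE : Function.Injective E := by
    intro u u' h
    ext j
    simpa [E] using congrFun h (some (.inl j))
  unfold systemSum orthantSum
  rw [← hE.tsum_eq]
  · refine tsum_congr fun u => ?_
    have hcond : ((E u none).1 = n ∧ ∀ k, orthantEquation α β σ S k (unpair (E u)) = 0) ↔
        ∀ i, if S i then 0 ≤ b i u ∧ b i u ≤ a i u else a i u = -1 ∧ b i u = 0 := by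
      rw [orthantEquation_iff]
      simp only [E, Option.elim_none, Option.elim_some, Sum.elim_inl, Sum.elim_inr, true_and,
        implies_true]
      refine forall_congr' fun i => ?_
      cases hS : S i
      · simp [a, b]
      · simp only [if_true]
        change (((b i u).toNat : ℤ) = b i u ∧ ((b i u).toNat + (a i u - b i u).toNat : ℤ) = a i u) ↔ _
        omega
    simp only [hcond, Fintype.prod_option, Fintype.prod_sum_type]
    split_ifs with h
    · simp only [E, Option.elim_none, Option.elim_some, Sum.elim_inl, Sum.elim_inr, add_zero,
        Nat.choose_self, Nat.cast_one, Finset.prod_const_one, one_mul]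
      refine Finset.prod_congr rfl fun i _ => ?_
      have hi := h i
      cases hS : S i
      · simp only [hS, Bool.false_eq_true, if_false] at hi
        simp only [binomPart]
        rw [if_pos hi]
        simp
      · simp only [hS, if_true] at hi
        simp only [binomPart, if_true]
        rw [if_pos hi]
        congr 2
        change (a i u).toNat = (b i u).toNat + (a i u - b i u).toNat
        omega
    · push Not at h
      obtain ⟨i, hi⟩ := h
      refine Finset.prod_eq_zero (Finset.mem_univ i) ?_
      cases hS : S i
      · simp only [hS, Bool.false_eq_true, if_false] at hi
        simp only [binomPart]
        rw [if_neg hi, Nat.cast_zero]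
      · simp only [hS, if_true] at hi
        simp only [binomPart]
        rw [if_neg hi, Nat.cast_zero]
  · intro c hc
    replace hc : (c none).1 = n ∧ ∀ k, orthantEquation α β σ S k (unpair c) = 0 := by
      by_contra h
      exact hc (if_neg h)
    obtain ⟨h0, h⟩ := hc
    obtain ⟨h1, h2, h3⟩ := (orthantEquation_iff α β σ S c).mp h
    refine ⟨fun j => (c (some (.inl j))).1, ?_⟩
    ext1 (_ | j | i)
    · exact Prod.ext h0.symm h1.symm
    · exact Prod.ext rfl (h2 j).symm
    · have hi := h3 i
      simp only [E, Option.elim_some, Sum.elim_inr]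
      cases hS : S i
      · simp only [hS, Bool.false_eq_true, if_false] at hi
        simpa using hi.1.symm
      · simp only [hS, if_true, h0] at hi
        simp only [if_true]
        simp only [a, b, ← hi.1, ← hi.2]
        ext <;> simp

end Orthant

theorem isWalkSequence_of_mem_binomialMultisums {f : ℕ → ℕ} (hf : f ∈ binomialMultisums) :
    IsWalkSequence fun n => (f n : ℝ≥0∞) := by
  obtain ⟨r, d, α, β, h⟩ := hf
  have hsum : ∀ n, (f n : ℝ≥0∞) = ∑ x : (Fin d → Bool) × (Fin r → Bool),
      orthantSum α β x.1 x.2 n := by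
    intro n
    rw [Fintype.sum_prod_type, ← tsum_prod_binom_eq_sum_orthantSum,
      (tsum_natCast_eq_iff _ _).mpr (h n)]
  simp only [hsum]
  refine isWalkSequence_sum _ _ fun x _ => ?_
  rw [orthantSum_eq_systemSum]
  refine isWalkSequence_systemSum _ _ (isAff_orthantEquation α β x.1 x.2) fun n => ?_
  rw [← orthantSum_eq_systemSum]
  -- All parts are nonnegative, so each is bounded by `f n`; this finiteness excludes the first
  -- alternative of Gordan's theorem.
  refine ne_top_of_le_ne_top (ENNReal.natCast_ne_top (f n)) ?_
  rw [hsum n]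
  exact Finset.single_le_sum (f := fun x : (Fin d → Bool) × (Fin r → Bool) =>
    orthantSum α β x.1 x.2 n) (fun _ _ => zero_le) (Finset.mem_univ x)

/-! ### Tiles realizing the edges of a digraph -/

/-- The boxes of the tile of length `ℓ` whose upper half has its left and right sides shifted by
`a` and `b`. -/
noncomputable def stepBoxes (a b ℓ : ℝ) : Finset ((ℝ × ℝ) × (ℝ × ℝ)) :=
  open Classical in {((0, 0), (ℓ, 1 / 2)), ((a, 1 / 2), (ℓ + b, 1))}

/-- The closed tile of length `ℓ` with left shift `a` and right shift `b`. -/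
def stepTile (a b ℓ : ℝ) : Set (ℝ × ℝ) := ⋃ c ∈ stepBoxes a b ℓ, Set.Icc c.1 c.2

/-- The part of the strip to the right of the left side of a step tile with left shift `a`. -/
def stepRegion (a : ℝ) : Set (ℝ × ℝ) :=
  {p | 0 ≤ p.2 ∧ p.2 < 1 ∧ (if p.2 < 1 / 2 then 0 else a) ≤ p.1}

/-- The half-open counterpart of a step tile. -/
def stepGerm (a b ℓ : ℝ) : Set (ℝ × ℝ) := stepRegion a \ translate (ℓ, 0) (stepRegion b)

theorem stepTile_eq (a b ℓ : ℝ) : stepTile a b ℓ =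
    Set.Icc (0, 0) (ℓ, 1 / 2) ∪ Set.Icc (a, 1 / 2) (ℓ + b, 1) := by
  simp [stepTile, stepBoxes]

theorem mem_stepTile {a b ℓ : ℝ} {p : ℝ × ℝ} : p ∈ stepTile a b ℓ ↔
    ((0 ≤ p.1 ∧ 0 ≤ p.2) ∧ p.1 ≤ ℓ ∧ p.2 ≤ 1 / 2) ∨
      ((a ≤ p.1 ∧ 1 / 2 ≤ p.2) ∧ p.1 ≤ ℓ + b ∧ p.2 ≤ 1) := by
  rw [stepTile_eq]
  rfl

theorem mem_stepGerm {a b ℓ : ℝ} {p : ℝ × ℝ} : p ∈ stepGerm a b ℓ ↔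
    0 ≤ p.2 ∧ p.2 < 1 ∧ (if p.2 < 1 / 2 then 0 else a) ≤ p.1 ∧
      p.1 < ℓ + (if p.2 < 1 / 2 then 0 else b) := by
  simp only [stepGerm, stepRegion, Set.mem_sdiff, mem_translate, Set.mem_ofPred_eq, Prod.fst_sub,
    Prod.snd_sub, sub_zero]
  constructor
  · rintro ⟨⟨h1, h2, h3⟩, h4⟩
    refine ⟨h1, h2, h3, ?_⟩
    by_contra! h
    exact h4 ⟨h1, h2, by linarith⟩
  · rintro ⟨h1, h2, h3, h4⟩
    exact ⟨⟨h1, h2, h3⟩, fun h => by linarith [h.2.2]⟩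

theorem germs_stepTile (a b ℓ : ℝ) : germs (stepTile a b ℓ) = stepGerm a b ℓ := by
  have h := germs_biUnion_Icc (stepBoxes a b ℓ).finite_toSet
  simp only [Finset.mem_coe] at h
  rw [stepTile, h]
  ext p
  rw [mem_stepGerm]
  simp only [stepBoxes, Finset.mem_insert, Finset.mem_singleton, Set.iUnion_iUnion_eq_or_left,
    Set.iUnion_iUnion_eq_left, Set.mem_union, mem_halfOpenBox]
  split_ifs with hp
  · constructor
    · rintro (h | h)
      · exact ⟨h.2.1, by linarith, h.1.1, by linarith [h.1.2]⟩
      · linarith [h.2.1]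
    · rintro ⟨h1, h2, h3, h4⟩
      exact .inl ⟨⟨h3, by linarith⟩, h1, hp⟩
  · constructor
    · rintro (h | h)
      · exact absurd h.2.2 hp
      · exact ⟨by linarith [h.2.1], h.2.2, h.1⟩
    · rintro ⟨h1, h2, h3, h4⟩
      exact .inr ⟨⟨h3, h4⟩, by linarith, h2⟩

section StepTile

variable {a b ℓ : ℝ}

theorem snd_image_stepTile (ha : 0 ≤ a) (hb : 0 ≤ b) (hℓ : a < ℓ) :
    Prod.snd '' stepTile a b ℓ = Set.Icc 0 1 := by
  ext y
  simp only [Set.mem_image, mem_stepTile, Set.mem_Icc]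
  constructor
  · rintro ⟨p, h | h, rfl⟩
    · exact ⟨h.1.2, by linarith [h.2.2]⟩
    · exact ⟨by linarith [h.1.2], h.2.2⟩
  · rintro ⟨h0, h1⟩
    refine ⟨(ℓ, y), ?_, rfl⟩
    rcases le_total y (1 / 2) with h | h
    · exact .inl ⟨⟨by simp only; linarith, h0⟩, le_rfl, h⟩
    · exact .inr ⟨⟨hℓ.le, h⟩, by simp only; linarith, h1⟩

theorem isTile_stepTile (ha : 0 ≤ a) (hb : 0 ≤ b) (hℓ : a < ℓ) : IsTile (stepTile a b ℓ) where
  region := by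
    refine ⟨stepBoxes a b ℓ, ?_, rfl⟩
    simp only [stepBoxes, Finset.mem_insert, Finset.mem_singleton, forall_eq_or_imp, forall_eq]
    norm_num
    constructor <;> linarith
  simplyConnected := by
    have hmem : ((ℓ, 1 / 2) : ℝ × ℝ) ∈ stepTile a b ℓ :=
      mem_stepTile.mpr (.inl ⟨⟨by simp only; linarith, by norm_num⟩, le_rfl, le_rfl⟩)
    -- The point `(ℓ, 1 / 2)` lies in both boxes, which are convex.
    have hstar : StarConvex ℝ ((ℓ, 1 / 2) : ℝ × ℝ) (stepTile a b ℓ) := by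
      rw [stepTile_eq]
      refine StarConvex.union ((convex_Icc _ _).starConvex ?_) ((convex_Icc _ _).starConvex ?_)
      · exact ⟨⟨by simp only; linarith, by norm_num⟩, le_rfl, le_rfl⟩
      · exact ⟨⟨hℓ.le, le_rfl⟩, by simp only; linarith, by norm_num⟩
    have : ContractibleSpace (stepTile a b ℓ) := hstar.contractibleSpace ⟨_, hmem⟩
    exact SimplyConnectedSpace.ofContractible _
  interior_connected := by
    -- `U` crosses the height `1 / 2` and links the open halves `V` and `W`. The interior lies
    -- between this connected union and its closure.
    let U : Set (ℝ × ℝ) := Set.Ioo a ℓ ×ˢ Set.Ioo 0 1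
    let V : Set (ℝ × ℝ) := Set.Ioo 0 ℓ ×ˢ Set.Ioo 0 (1 / 2)
    let W : Set (ℝ × ℝ) := Set.Ioo a (ℓ + b) ×ˢ Set.Ioo (1 / 2) 1
    have hUV : ((a + ℓ) / 2, 1 / 4) ∈ U ∩ V := by
      refine ⟨⟨⟨?_, ?_⟩, ?_, ?_⟩, ⟨?_, ?_⟩, ?_, ?_⟩ <;> norm_num <;> linarith
    have hUW : ((a + ℓ) / 2, 3 / 4) ∈ U ∩ W := by
      refine ⟨⟨⟨?_, ?_⟩, ?_, ?_⟩, ⟨?_, ?_⟩, ?_, ?_⟩ <;> norm_num <;> linarith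
    have hU : IsPreconnected U := isPreconnected_Ioo.prod isPreconnected_Ioo
    have hV : IsPreconnected V := isPreconnected_Ioo.prod isPreconnected_Ioo
    have hW : IsPreconnected W := isPreconnected_Ioo.prod isPreconnected_Ioo
    have hconn : IsPreconnected (U ∪ V ∪ W) :=
      (hU.union _ hUV.1 hUV.2 hV).union _ (.inl hUW.1) hUW.2 hW
    have hopen : IsOpen (U ∪ V ∪ W) := ((isOpen_Ioo.prod isOpen_Ioo).union
      (isOpen_Ioo.prod isOpen_Ioo)).union (isOpen_Ioo.prod isOpen_Ioo)
    have hsub : U ∪ V ∪ W ⊆ interior (stepTile a b ℓ) := by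
      refine interior_maximal ?_ hopen
      rintro p ((⟨⟨h1, h2⟩, h3, h4⟩ | ⟨⟨h1, h2⟩, h3, h4⟩) | ⟨⟨h1, h2⟩, h3, h4⟩)
      · rcases le_total p.2 (1 / 2) with h | h
        · exact mem_stepTile.mpr (.inl ⟨⟨by linarith, h3.le⟩, h2.le, h⟩)
        · exact mem_stepTile.mpr (.inr ⟨⟨h1.le, h⟩, by linarith, h4.le⟩)
      · exact mem_stepTile.mpr (.inl ⟨⟨h1.le, h3.le⟩, h2.le, h4.le⟩)
      · exact mem_stepTile.mpr (.inr ⟨⟨h1.le, h3.le⟩, h2.le, h4.le⟩)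
    have hcl : interior (stepTile a b ℓ) ⊆ closure (U ∪ V ∪ W) := by
      refine interior_subset.trans ?_
      rw [stepTile_eq, closure_union, closure_union]
      refine Set.union_subset ?_ ?_
      · refine (?_ : _ = closure V).subset.trans
          (Set.subset_union_right.trans Set.subset_union_left)
        rw [closure_prod_eq, closure_Ioo (by linarith), closure_Ioo (by norm_num),
          Set.Icc_prod_Icc]
      · refine (?_ : _ = closure W).subset.trans Set.subset_union_right
        rw [closure_prod_eq, closure_Ioo (by linarith), closure_Ioo (by norm_num),
          Set.Icc_prod_Icc]
    exact ⟨⟨_, hsub (.inl (.inl hUV.1))⟩, hconn.subset_closure hsub hcl⟩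

theorem isAnchored_stepGerm (hℓ : 0 < ℓ) : IsAnchored (stepGerm a b ℓ) := by
  refine ⟨mem_stepGerm.mpr (by simpa using hℓ), fun x hx => ?_⟩
  have := (mem_stepGerm.mp hx).2.2.1
  simpa using this

theorem isAnchored_stepRegion : IsAnchored (stepRegion a) := by
  refine ⟨by simp [stepRegion], fun x hx => ?_⟩
  have := hx.2.2
  simpa using this

theorem mem_stepRegion_half {x : ℝ} : ((x, 1 / 2) : ℝ × ℝ) ∈ stepRegion a ↔ a ≤ x := by
  simp [stepRegion]
  norm_num

theorem mem_stepGerm_half {x : ℝ} :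
    ((x, 1 / 2) : ℝ × ℝ) ∈ stepGerm a b ℓ ↔ a ≤ x ∧ x < ℓ + b := by
  rw [mem_stepGerm]
  simp
  norm_num

theorem mem_stepGerm_zero {x : ℝ} :
    ((x, 0) : ℝ × ℝ) ∈ stepGerm a b ℓ ↔ 0 ≤ x ∧ x < ℓ := by
  rw [mem_stepGerm]
  simp

theorem stepRegion_zero : stepRegion 0 = halfStrip 0 := by
  ext p
  simp only [stepRegion, Set.mem_ofPred_eq, mem_halfStrip, ite_self]
  tauto

theorem stepRegion_injective : Function.Injective stepRegion := by
  intro a b h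
  have h1 := mem_stepRegion_half (a := a) (x := a)
  have h2 := mem_stepRegion_half (a := a) (x := b)
  rw [h, mem_stepRegion_half] at h1 h2
  exact le_antisymm (h2.mp le_rfl) (h1.mpr le_rfl)

theorem translate_stepRegion_subset (ha : 0 ≤ a) (hb : 0 ≤ b) (hℓ : a < ℓ) :
    translate (ℓ, 0) (stepRegion b) ⊆ stepRegion a := by
  intro p hp
  rw [mem_translate] at hp
  obtain ⟨h1, h2, h3⟩ := hp
  simp only [Prod.fst_sub, Prod.snd_sub, sub_zero] at h1 h2 h3
  refine ⟨h1, h2, ?_⟩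
  split_ifs at h3 ⊢ <;> linarith

theorem stepRegion_diff_stepGerm (ha : 0 ≤ a) (hb : 0 ≤ b) (hℓ : a < ℓ) :
    stepRegion a \ stepGerm a b ℓ = translate (ℓ, 0) (stepRegion b) := by
  rw [stepGerm, Set.sdiff_sdiff_cancel_left (translate_stepRegion_subset ha hb hℓ)]

/-- Step tiles have determined length and shifts. -/
theorem stepGerm_inj {a' b' ℓ' : ℝ} (ha : a < ℓ) (hb : 0 ≤ b) (hℓ : 0 < ℓ) (ha' : a' < ℓ')
    (hb' : 0 ≤ b') (hℓ' : 0 < ℓ') (h : stepGerm a b ℓ = stepGerm a' b' ℓ') :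
    a = a' ∧ b = b' ∧ ℓ = ℓ' := by
  have h0 : ∀ x, (0 ≤ x ∧ x < ℓ) ↔ (0 ≤ x ∧ x < ℓ') := fun x => by
    rw [← mem_stepGerm_zero (a := a) (b := b), h, mem_stepGerm_zero]
  have h1 : ∀ x, (a ≤ x ∧ x < ℓ + b) ↔ (a' ≤ x ∧ x < ℓ' + b') := fun x => by
    rw [← mem_stepGerm_half, h, mem_stepGerm_half]
  have e1 : ℓ = ℓ' := by
    refine le_antisymm ?_ ?_
    · by_contra! hlt
      linarith [((h0 ℓ').mp ⟨hℓ'.le, hlt⟩).2]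
    · by_contra! hlt
      linarith [((h0 ℓ).mpr ⟨hℓ.le, hlt⟩).2]
  have e2 : a = a' := le_antisymm ((h1 a').mpr ⟨le_rfl, by linarith⟩).1
    ((h1 a).mp ⟨le_rfl, by linarith⟩).1
  refine ⟨e2, ?_, e1⟩
  refine le_antisymm ?_ ?_
  · by_contra! hlt
    linarith [((h1 (ℓ' + b')).mp ⟨by linarith, by linarith⟩).2]
  · by_contra! hlt
    linarith [((h1 (ℓ + b)).mpr ⟨by linarith, by linarith⟩).2]

end StepTile

/-! ### Walks in a digraph as partitions into step tiles -/

section Realization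

variable {Q : Type} [Fintype Q] (len : Q → Q → ℝ) (off : Q → ℝ)

open Classical in
/-- The edges of the digraph given by a length function. -/
noncomputable def edges : Finset (Q × Q) := Finset.univ.filter fun e => 0 < len e.1 e.2

theorem mem_edges {e : Q × Q} : e ∈ edges len ↔ 0 < len e.1 e.2 := by simp [edges]

open Classical in
/-- The half-open tiles of all edges. -/
noncomputable def edgeGerms : Finset (Set (ℝ × ℝ)) :=
  (edges len).image fun e => stepGerm (off e.1) (off e.2) (len e.1 e.2)

/-- The number of partial tilings starting with the left side belonging to a vertex. -/
noncomputable def vertexCount (q : Q) (L : ℝ) : ℕ∞ :=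
  remCount (edgeGerms len off) (stepRegion (off q)) L

variable {len off}

theorem isAnchored_of_mem_edgeGerms {τ : Set (ℝ × ℝ)} (hτ : τ ∈ edgeGerms len off) :
    IsAnchored τ := by
  obtain ⟨e, he, rfl⟩ := Finset.mem_image.mp hτ
  exact isAnchored_stepGerm ((mem_edges len).mp he)

-- A tile of an edge out of `p`, placed against the left side of `q`, overlaps it if `off p < off q`
-- and leaves a hole at height `1 / 2` if `off p > off q`. The hole lies behind the new frontier,
-- where no tile reaches, so only the edges out of `q` contribute.
open Classical in
theorem vertexCount_first_edge (hoff : Function.Injective off) (h0 : ∀ q, 0 ≤ off q)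
    (hlt : ∀ p q, 0 < len p q → off p < len p q) {fin : Q} (hfin : off fin = 0) (q : Q) (L : ℝ) :
    vertexCount len off q L = (if q = fin ∧ L = 0 then 1 else 0) +
      ∑ q', if 0 < len q q' then vertexCount len off q' (L - len q q') else 0 := by
  have hinj : Set.InjOn (fun e : Q × Q => stepGerm (off e.1) (off e.2) (len e.1 e.2))
      (edges len) := by
    intro e he e' he' h
    have he := (mem_edges len).mp (Finset.mem_coe.mp he)
    have he' := (mem_edges len).mp (Finset.mem_coe.mp he')
    obtain ⟨h1, h2, -⟩ := stepGerm_inj (hlt _ _ he) (h0 _) he (hlt _ _ he') (h0 _) he' h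
    exact Prod.ext (hoff h1) (hoff h2)
  have hregion : stepRegion (off q) = halfStrip 0 ↔ q = fin := by
    rw [← stepRegion_zero, stepRegion_injective.eq_iff, ← hfin, hoff.eq_iff]
  rw [vertexCount, remCount_anchored _ (fun τ hτ => isAnchored_of_mem_edgeGerms hτ)
    isAnchored_stepRegion]
  simp only [hregion]
  congr 1
  rw [edgeGerms, Finset.sum_image hinj, edges, Finset.sum_filter, Fintype.sum_prod_type,
    Finset.sum_eq_single q]
  · refine Finset.sum_congr rfl fun q' _ => ?_
    split_ifs with h1 h2
    · have h3 := remCount_translate (edgeGerms len off) (stepRegion (off q')) (len q q')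
        (L - len q q')
      rw [add_sub_cancel] at h3
      rw [stepRegion_diff_stepGerm (h0 q) (h0 q') (hlt _ _ h1), vertexCount, ← h3]
      rfl
    · exact absurd Set.sdiff_subset h2
    · rfl
  · intro p _ hpq
    refine Finset.sum_eq_zero fun q' _ => ?_
    split_ifs with h1 h2
    · have hle : off q ≤ off p :=
        mem_stepRegion_half.mp (h2 (mem_stepGerm_half.mpr
          ⟨le_rfl, by linarith [h0 q', hlt _ _ h1]⟩))
      have hlt' : off q < off p := lt_of_le_of_ne hle fun h => hpq (hoff h).symm
      have hmem : ((off q, 1 / 2) : ℝ × ℝ) ∈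
          stepRegion (off q) \ stepGerm (off p) (off q') (len p q') := by
        refine ⟨mem_stepRegion_half.mpr le_rfl, fun h => ?_⟩
        linarith [(mem_stepGerm_half.mp h).1]
      refine remCount_eq_zero_of_lt (𝓣 := edgeGerms len off)
        (fun τ hτ => isAnchored_of_mem_edgeGerms hτ) (W := 0) ?_ (q := len p q') ?_
        hmem ?_ le_rfl L
      · intro τ hτ x hx
        obtain ⟨e, he, rfl⟩ := Finset.mem_image.mp (Finset.mem_coe.mp hτ)
        have := (mem_stepGerm.mp hx).2.2.1
        have := h0 e.1
        split_ifs at * <;> linarith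
      · intro x hx
        by_contra! hlt
        exact hx.2 (mem_stepGerm_zero.mpr ⟨isAnchored_stepRegion.2 x hx.1, hlt⟩)
      · have := hlt _ _ h1
        simp only
        linarith
    · rfl
    · rfl
  · simp

end Realization

/-- Distinct fractions of a number `δ` below all positive edge lengths serve as offsets, and `fin`
receives `0`. -/
theorem exists_offsets {Q : Type} [Fintype Q] (len : Q → Q → ℝ) (fin : Q) :
    ∃ off : Q → ℝ, Function.Injective off ∧ (∀ q, 0 ≤ off q) ∧
      (∀ p q, 0 < len p q → off p < len p q) ∧ off fin = 0 := by
  classical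
  have hsmall : ∀ᶠ t in nhdsWithin (0 : ℝ) (Set.Ioi 0), ∀ e : Q × Q, 0 < len e.1 e.2 →
      t < len e.1 e.2 := by
    rw [Filter.eventually_all]
    intro e
    by_cases he : 0 < len e.1 e.2
    · filter_upwards [eventually_nhdsWithin_of_eventually_nhds (eventually_lt_nhds he)] with t ht _
      exact ht
    · exact Filter.Eventually.of_forall fun t h => absurd h he
  obtain ⟨δ, hδ, hδ0⟩ := (hsmall.and self_mem_nhdsWithin).exists
  have hδ0 : 0 < δ := hδ0
  let e := Fintype.equivFin Q
  refine ⟨fun q => if q = fin then 0 else δ / ((e q : ℕ) + 1), fun p q h => ?_, fun q => ?_,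
    fun p q hpq => ?_, if_pos rfl⟩
  · have hpos : ∀ q, 0 < δ / ((e q : ℕ) + 1 : ℝ) := fun q => by positivity
    simp only at h
    split_ifs at h with h1 h2 h2
    · rw [h1, h2]
    · exact absurd h (hpos q).ne
    · exact absurd h (hpos p).ne'
    · rw [div_eq_mul_inv, div_eq_mul_inv, mul_right_inj' hδ0.ne', inv_inj, add_left_inj,
        Nat.cast_inj, Fin.val_inj] at h
      exact e.injective h
  · beta_reduce
    split_ifs <;> positivity
  · beta_reduce
    split_ifs
    · exact hpq
    · refine lt_of_le_of_lt (div_le_self hδ0.le ?_) (hδ (p, q) hpq)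
      simp

/-- There are arbitrarily large reals all of whose positive multiples avoid a given finite
dimensional rational space. -/
theorem exists_gt_forall_mul_notMem {ι : Type*} [Fintype ι] (s : ι → ℝ) (B : ℝ) :
    ∃ (V : AddSubgroup ℝ) (ε : ℝ), (∀ i, s i ∈ V) ∧ B < ε ∧ ∀ k : ℕ, ((k : ℝ) + 1) * ε ∉ V := by
  classical
  let V : Submodule ℚ ℝ := LinearMap.range (Fintype.linearCombination ℚ s)
  -- A countable set has dense complement, which supplies `ε` beyond any bound; a rational subspace
  -- then excludes all multiples of `ε` along with `ε`.
  have hV : (V : Set ℝ).Countable := by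
    have : (V : Set ℝ) = Set.range (Fintype.linearCombination ℚ s) := LinearMap.coe_range _
    rw [this]
    exact Set.countable_range _
  obtain ⟨ε, hε, hB⟩ := (hV.dense_compl ℝ).exists_gt B
  refine ⟨V.toAddSubgroup, ε, fun i => ⟨Pi.single i 1, ?_⟩, hB, fun k hk => hε ?_⟩
  · simp
  · have h1 : ((k : ℚ) + 1)⁻¹ • (((k : ℝ) + 1) * ε) ∈ V := V.smul_mem _ hk
    have h2 : ((k : ℚ) + 1)⁻¹ • (((k : ℝ) + 1) * ε) = ε := by
      rw [Rat.smul_def]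
      push_cast
      have : (k : ℝ) + 1 ≠ 0 := by positivity
      field_simp
    rwa [h2] at h1

section ReturnEdge

variable {Q : Type} [Fintype Q] {len len' : Q → Q → ℝ} {fin : Q} {N M : Q → ℝ → ℝ≥0∞}

/-- Two walk counts agree on a group containing the edge lengths of the smaller graph if the larger
graph arises from it by an edge that leaves the end vertex and whose length is independent of the
group. -/
theorem walkCount_eq_of_return_edge (hN : IsSimpleWalkCount len fin N)
    (hneg : ∀ p L, L < 0 → M p L = 0)
    (hM : ∀ p L, M p L = (open Classical in if p = fin ∧ L = 0 then 1 else 0) +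
      ∑ q, if 0 < len' p q then M q (L - len' p q) else 0)
    {ε : ℝ} (hlen : ∀ p q, p ≠ fin → len' p q = len p q)
    (hfin : ∀ q, 0 < len' fin q → len' fin q = ε)
    {V : AddSubgroup ℝ} (hV : ∀ p q, len p q ∈ V) (hε : ∀ k : ℕ, ((k : ℝ) + 1) * ε ∉ V)
    (L : ℝ) (hL : L ∈ V) (p : Q) : M p L = N p L := by
  classical
  let E := {e : Q × Q // 0 < len' e.1 e.2}
  let lenE : E → ℝ := fun e => len' e.1.1 e.1.2
  -- Here `k` is the number of uses of the return edge. For `L ∈ V` a first use would put `(k + 1) *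
  -- ε` into `V`, so the edge is never used.
  have hsupp : ∀ L p, M p L ≠ 0 → ∃ k : ℕ, L - k * ε ∈ V := by
    intro L
    refine length_induction lenE (fun e => e.2)
      (motive := fun L => ∀ p, M p L ≠ 0 → ∃ k : ℕ, L - k * ε ∈ V) ?_ ?_ L
    · exact fun L hL p h => absurd (hneg p L hL) h
    · intro L _ ih p hp
      rw [hM] at hp
      by_cases h1 : p = fin ∧ L = 0
      · exact ⟨0, by simp [h1.2, V.zero_mem]⟩
      rw [if_neg h1, zero_add] at hp
      obtain ⟨q, -, hq⟩ := Finset.exists_ne_zero_of_sum_ne_zero hp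
      by_cases h2 : 0 < len' p q
      · rw [if_pos h2] at hq
        obtain ⟨k, hk⟩ := ih ⟨(p, q), h2⟩ q hq
        simp only [lenE] at hk
        by_cases hpf : p = fin
        · subst hpf
          rw [hfin q h2] at hk
          refine ⟨k + 1, ?_⟩
          convert hk using 1
          push_cast
          ring
        · rw [hlen p q hpf] at hk
          refine ⟨k, ?_⟩
          convert V.add_mem hk (hV p q) using 1
          ring
      · rw [if_neg h2] at hq
        exact absurd rfl hq
  revert hL p
  refine length_induction lenE (fun e => e.2)
    (motive := fun L => L ∈ V → ∀ p, M p L = N p L) ?_ ?_ L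
  · intro L hL _ p
    rw [hneg p L hL, hN.of_neg p L hL]
  · intro L _ ih hL p
    rw [hM, hN.first_edge]
    congr 1
    refine Finset.sum_congr rfl fun q _ => ?_
    by_cases hpf : p = fin
    · subst hpf
      rw [if_neg (hN.fin_out q).not_gt]
      split_ifs with h
      · by_contra hne
        obtain ⟨k, hk⟩ := hsupp _ _ hne
        rw [hfin q h] at hk
        refine hε k ?_
        convert V.sub_mem hL hk using 1
        ring
      · rfl
    · rw [hlen p q hpf]
      split_ifs with h
      · have h' : 0 < len' p q := by rwa [hlen p q hpf]
        have := ih ⟨(p, q), h'⟩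
        simp only [lenE, hlen p q hpf] at this
        exact this (V.sub_mem hL (hV p q)) q
      · rfl

end ReturnEdge

/-- Both sides of a rectangle are flat, so tilings are walks from `fin` to `fin`. An edge of length
`ε` from `fin` to the start `s` makes them walks from `s`, and rational independence prevents it
from being used again. Since `η` may be negative, `ε` is also taken larger than `-η`. -/
theorem mem_tileCountingFunctions_of_isWalkSequence {f : ℕ → ℕ}
    (hf : IsWalkSequence fun n => (f n : ℝ≥0∞)) : f ∈ tileCountingFunctions := by
  classical
  obtain ⟨g, ⟨Q, _, len, fin, N, s, hN, rfl⟩, η, hη⟩ := hf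
  obtain ⟨V, ε, hV, hεB, hε⟩ := exists_gt_forall_mul_notMem
    (Sum.elim (fun e : Q × Q => len e.1 e.2) fun b : Bool => if b then 1 else η) (max 0 (-η))
  have hε0 : 0 < ε := (le_max_left _ _).trans_lt hεB
  have hεη : 0 < η + ε := by linarith [(le_max_right 0 (-η)).trans_lt hεB]
  have hVlen : ∀ p q, len p q ∈ V := fun p q => hV (.inl (p, q))
  have hVη : ∀ n : ℕ, (n : ℝ) + η ∈ V := fun n => by
    refine V.add_mem ?_ (by simpa using hV (.inr false))
    have := V.nsmul_mem (hV (.inr true)) n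
    simpa using this
  let len' : Q → Q → ℝ := fun p q => if p = fin then (if q = s then ε else 0) else len p q
  obtain ⟨off, hoff, hoff0, hofflt, hofffin⟩ := exists_offsets len' fin
  have hfirst := vertexCount_first_edge hoff hoff0 hofflt hofffin
  have hcount : ∀ L ∈ V, ∀ p, (vertexCount len' off p L : ℝ≥0∞) = N p L := by
    refine walkCount_eq_of_return_edge (len' := len') hN
      (M := fun p L => (vertexCount len' off p L : ℝ≥0∞)) ?_ ?_ (ε := ε) ?_ ?_ hVlen hε
    · intro p L hL
      simp [vertexCount, remCount_of_neg _ isAnchored_stepRegion hL]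
    · intro p L
      have := congrArg ENat.toENNRealRingHom (hfirst p L)
      rw [map_add, map_sum] at this
      simp only [apply_ite ENat.toENNRealRingHom, map_one, map_zero] at this
      exact this
    · intro p q hp
      simp [len', hp]
    · intro q hq
      by_contra hne
      by_cases hqs : q = s <;> simp [len', hqs] at hq hne
  let T : Finset (Set (ℝ × ℝ)) :=
    (edges len').image fun e => stepTile (off e.1) (off e.2) (len' e.1 e.2)
  have hT : ∀ τ ∈ T, ∃ a b ℓ, 0 ≤ a ∧ 0 ≤ b ∧ a < ℓ ∧ τ = stepTile a b ℓ := by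
    intro τ hτ
    obtain ⟨e, he, rfl⟩ := Finset.mem_image.mp hτ
    exact ⟨_, _, _, hoff0 _, hoff0 _, hofflt _ _ ((mem_edges len').mp he), rfl⟩
  have htile : ∀ τ ∈ T, IsTile τ := fun τ hτ => by
    obtain ⟨a, b, ℓ, ha, hb, hℓ, rfl⟩ := hT τ hτ
    exact isTile_stepTile ha hb hℓ
  have hsnd : ∀ τ ∈ T, Prod.snd '' τ = Set.Icc 0 1 := fun τ hτ => by
    obtain ⟨a, b, ℓ, ha, hb, hℓ, rfl⟩ := hT τ hτ
    exact snd_image_stepTile ha hb hℓ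
  refine ⟨T, η + ε, T.finite_toSet, fun τ hτ => ⟨htile τ hτ, 0, by simpa using hsnd τ hτ⟩,
    hεη.le, fun n => ?_⟩
  have hpos : 0 < (n : ℝ) + (η + ε) := by positivity
  rw [encard_isTiling_eq_remCount T.finite_toSet (fun τ hτ => (htile τ hτ).region) (fun _ => 0)
    (fun τ hτ => by simpa using hsnd τ hτ) hpos.le]
  have himage : ((fun τ => translate 0 (germs τ)) '' (T : Set (Set (ℝ × ℝ)))) =
      edgeGerms len' off := by
    simp only [translate_zero, T, edgeGerms, Finset.coe_image, Set.image_image, germs_stepTile]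
  -- The return edge is the only edge out of `fin`, and the length is not zero, so every walk begins
  -- with it.
  have hval : vertexCount len' off fin (n + (η + ε)) = vertexCount len' off s (n + η) := by
    rw [hfirst, if_neg (fun h => hpos.ne' h.2), zero_add, Finset.sum_eq_single s]
    · simp only [len', if_true, hε0]
      congr 1
      ring
    · intro q _ hq
      simp [len', hq]
    · simp
  rw [himage, ← stepRegion_zero, ← hofffin]
  change vertexCount len' off fin (n + (η + ε)) = f n
  rw [hval]
  have := hcount _ (hVη n) s
  simp only [← hη n] at this
  exact_mod_cast this

theorem binomialMultisums_subset_tileCountingFunctions :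
    binomialMultisums ⊆ tileCountingFunctions := fun _ hf =>
  mem_tileCountingFunctions_of_isWalkSequence (isWalkSequence_of_mem_binomialMultisums hf)

theorem tileCountingFunctions_eq_diagonals : tileCountingFunctions = diagonals :=
  tileCountingFunctions_subset_diagonals.antisymm
    (diagonals_subset_binomialMultisums.trans binomialMultisums_subset_tileCountingFunctions)

theorem diagonals_eq_binomialMultisums : diagonals = binomialMultisums :=
  diagonals_subset_binomialMultisums.antisymm
    (binomialMultisums_subset_tileCountingFunctions.trans tileCountingFunctions_subset_diagonals)

theorem closedUnderAddMul_binomialMultisums : ClosedUnderAddMul binomialMultisums := by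
  intro f hf g hg
  constructor
  · rw [← diagonals_eq_binomialMultisums, ← tileCountingFunctions_eq_diagonals]
    refine mem_tileCountingFunctions_of_isWalkSequence ?_
    simpa using (isWalkSequence_of_mem_binomialMultisums hf).add
      (isWalkSequence_of_mem_binomialMultisums hg)
  · rw [← diagonals_eq_binomialMultisums] at hf hg
    exact mul_mem_binomialMultisums hf hg

end IrrationalTiling

theorem corollaryc :
    IrrationalTiling.tileCountingFunctions = IrrationalTiling.diagonals ∧
    IrrationalTiling.diagonals = IrrationalTiling.binomialMultisums ∧
    IrrationalTiling.ClosedUnderAddMul IrrationalTiling.tileCountingFunctions ∧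
    IrrationalTiling.ClosedUnderAddMul IrrationalTiling.diagonals ∧
    IrrationalTiling.ClosedUnderAddMul IrrationalTiling.binomialMultisums := by
  have h := IrrationalTiling.closedUnderAddMul_binomialMultisums
  have h₁ := IrrationalTiling.tileCountingFunctions_eq_diagonals
  have h₂ := IrrationalTiling.diagonals_eq_binomialMultisums
  exact ⟨h₁, h₂, by rwa [h₁, h₂], by rwa [h₂], h⟩
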